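/- **Setting.** Let $\Omega\subset\mathbb R^3$ be a bounded open set with boundary $\Gamma$ of class $C^1$ ($\Omega$ lying locally on one side of $\Gamma$). Let $\mathcal T_h$ be a finite compatible mesh of straight-edged closed tetrahedra (two tetrahedra meet in the convex hull of their common vertices), let $\Omega_h$ be the interior of $\bigcup_{T\in\mathcal T_h}T$, $\Gamma_h=\partial\Omega_h$, and $h=\max_{T}\operatorname{diam}T$. We assume that all vertices of the mesh belong to $\overline\Omega$ and that those located on $\Gamma_h$ lie on $\Gamma$. The mesh is regular with parameter $\sigma$: every $T\in\mathcal T_h$ contains a ball of radius $r>0$ with $\operatorname{diam}T\le\sigma r$. With every edge $e\subset\Gamma_h$ a plane $\delta_e$ containing $e$ is associated, whose angle with the bisector plane of two distinct mesh faces contained in $\Gamma_h$ that meet at $e$ is at most $\arcsin\kappa$, where $\kappa<1$ is fixed. For a face $F$ with centroid $G_F$ and an edge $e$ with end-points $A_e,B_e$ and mid-point $M_e$, put $$\mu_F(v)=v(G_F),\qquad \nu_e(v)=0.4\,v(M_e)+0.3\,[v(A_e)+v(B_e)].$$ * $V_h^*$ is the space of functions $v$ whose restriction to each $T\in\mathcal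 T_h$ is a polynomial of degree at most two, such that $\mu_F(v_{|T})$ (resp. $\nu_e(v_{|T})$) is the same for all $T\in\mathcal T_h$ having the face $F$ (resp. the edge $e$), and is zero if $F$ (resp. $e$) is contained in $\Gamma_h$. * $W_h^*$ is defined in the same way, except that for $F\subset\Gamma_h$ and $e\subset\Gamma_h$ the conditions on $\mu_F$ and $\nu_e$ are replaced, for each $T$ having $F$ (resp. $e$), by $\tilde\mu_F(w_{|T})=0$ and $\tilde\nu_e(w_{|T})=0$, where $\tilde\mu_F(w)=w(P)$ and $\tilde\nu_e(w)=0.4\,w(Q_e)+0.3\,[w(A_e)+w(B_e)]$. Here $P$ is the nearest (to $G_F$) intersection with $\Gamma$ of the perpendicular to $F$ through $G_F$, and $Q_e$ is the nearest (to $M_e$) intersection with $\Gamma$ of the perpendicular to $e$ in the plane $\delta_e$ through $M_e$; the polynomial expression of $w$ in $T$ is used at $P$ and $Q_e$ even if they lie outside $T$. Let $\mathbf{grad}_h$ be the gradient taken tetrahedron by tetrahedron, $a_h^*(w,v)=\int_{\Omega_h}\mathbf{grad}_h w\cdot\mathbf{grad}_h v$, and let $\|\cdot\|_{0,h}$ be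 the norm of $L^2(\Omega_h)$. **Proposition.** Given $\Omega$, $\sigma$ and $\kappa<1$, there are $\alpha^*>0$ and $h_0>0$ such that for every mesh $\mathcal T_h$ as above with $h\le h_0$ and every choice of the planes $\delta_e$ as above, $$\forall\, w\in W_h^*\setminus\{0\}:\qquad \sup_{v\in V_h^*\setminus\{0\}}\frac{a_h^*(w,v)}{\|\mathbf{grad}_h w\|_{0,h}\,\|\mathbf{grad}_h v\|_{0,h}}\ \ge\ \alpha^* .$$ -/

import Mathlib

open scoped RealInnerProductSpace

noncomputable section

namespace CurvedFEM

/-- Three-dimensional Euclidean space. -/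
abbrev E3 : Type := EuclideanSpace ℝ (Fin 3)

/-- Open sets whose boundary is of class `C¹`, the set lying locally on one side of it: near every
boundary point it is the negativity set of a `C¹` function with nonzero differential there. -/
def IsC1Domain (Ω : Set E3) : Prop :=
  IsOpen Ω ∧ ∀ x ∈ frontier Ω, ∃ U : Set E3, IsOpen U ∧ x ∈ U ∧ ∃ φ : E3 → ℝ,
    ContDiffOn ℝ 1 φ U ∧ fderiv ℝ φ x ≠ 0 ∧ Ω ∩ U = {y ∈ U | φ y < 0}

/-- The polynomials of degree at most two in three real variables. -/
abbrev P2 : Type := MvPolynomial.restrictTotalDegree (Fin 3) ℝ 2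

/-- The value of a polynomial at a point of space. -/
def val (p : P2) (x : E3) : ℝ := MvPolynomial.eval (fun i => x i) (p : MvPolynomial (Fin 3) ℝ)

/-- The gradient of a polynomial at a point of space. -/
def grad (p : P2) (x : E3) : E3 := gradient (fun y => val p y) x

@[simp] theorem val_zero (x : E3) : val 0 x = 0 := by simp [val]

@[simp] theorem val_add (p q : P2) (x : E3) : val (p + q) x = val p x + val q x := by simp [val]

@[simp] theorem val_smul (c : ℝ) (p : P2) (x : E3) : val (c • p) x = c * val p x := by
  simp [val, MvPolynomial.smul_eval]

/-- `q` is a point of `S` nearest to `m`. -/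
def IsNearest (S : Set E3) (m q : E3) : Prop := q ∈ S ∧ ∀ q' ∈ S, dist m q ≤ dist m q'

/-- The centroid of a face, or the mid-point of an edge, given by its set of vertices. -/
def center (s : Finset E3) : E3 := s.centroid ℝ id

/-- The line through the centroid of the face `F` perpendicular to `F`. -/
def faceNormalLine (F : Finset E3) : Set E3 :=
  {p | ∀ x ∈ F, ∀ y ∈ F, ⟪p - center F, x - y⟫ = 0}

/-- The line through the mid-point of the edge `e` in the direction `d`. -/
def edgeLine (e : Finset E3) (d : E3) : Set E3 := {p | ∃ τ : ℝ, p = center e + τ • d}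

/-- The weighted value `0.4 p(m) + 0.3 (p(A) + p(B))`, where `A`, `B` are the end-points of `e`. -/
def edgeValue (e : Finset E3) (m : E3) (p : P2) : ℝ := 0.4 * val p m + 0.3 * ∑ x ∈ e, val p x

@[simp] theorem edgeValue_zero (e : Finset E3) (m : E3) : edgeValue e m 0 = 0 := by
  simp [edgeValue]

@[simp] theorem edgeValue_add (e : Finset E3) (m : E3) (p q : P2) :
    edgeValue e m (p + q) = edgeValue e m p + edgeValue e m q := by
  simp only [edgeValue, val_add, Finset.sum_add_distrib]; ring

@[simp] theorem edgeValue_smul (e : Finset E3) (m : E3) (c : ℝ) (p : P2) :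
    edgeValue e m (c • p) = c * edgeValue e m p := by
  simp only [edgeValue, val_smul, ← Finset.mul_sum]; ring

/-- The face degree of freedom: the value at the centroid of the face. -/
def faceDof (F : Finset E3) (p : P2) : ℝ := val p (center F)

/-- The edge degree of freedom: the mean value along the edge. -/
def edgeDof (e : Finset E3) (p : P2) : ℝ := edgeValue e (center e) p

/-- A compatible mesh of tetrahedra: a finite simplicial complex in space all of whose simplices
are faces of tetrahedra of the complex. Simplices are given by their sets of vertices. -/
structure TetMesh where
  /-- the simplicial complex -/
  complex : Geometry.SimplicialComplex ℝ E3
  finite : complex.faces.Finite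
  pure : ∀ s ∈ complex.faces, ∃ T ∈ complex.faces, T.card = 4 ∧ s ⊆ T

namespace TetMesh

variable (M : TetMesh)

/-- The tetrahedra of the mesh. -/
def tets : Finset (Finset E3) := M.finite.toFinset.filter (fun T => T.card = 4)

/-- `Ω_h`, the interior of the union of the (closed) tetrahedra of the mesh. -/
def domain : Set E3 := interior (⋃ T ∈ M.tets, convexHull ℝ (T : Set E3))

/-- `Γ_h`, the boundary of `Ω_h`. -/
def bdry : Set E3 := frontier M.domain

/-- The face or edge with vertex set `s` is contained in `Γ_h`. -/
def OnBdry (s : Finset E3) : Prop := convexHull ℝ (s : Set E3) ⊆ M.bdry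

/-- `h`, the largest diameter of the tetrahedra of the mesh (`0` for the empty mesh). -/
def meshSize : ℝ := ⨆ T : M.tets, Metric.diam (convexHull ℝ ((T : Finset E3) : Set E3))

/-- Uniform regularity with parameter `σ`: every tetrahedron `T` contains a ball of radius `r` with
`diam T ≤ σ r`. -/
def IsRegular (σ : ℝ) : Prop :=
  ∀ T ∈ M.tets, ∃ c : E3, ∃ r : ℝ, 0 < r ∧ Metric.closedBall c r ⊆ convexHull ℝ (T : Set E3) ∧
    Metric.diam (convexHull ℝ (T : Set E3)) ≤ σ * r

/-- The mesh fits `Ω`: all its vertices belong to the closure of `Ω`, and those located on `Γ_h`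
lie on the boundary of `Ω`. -/
def Fits (Ω : Set E3) : Prop :=
  ∀ T ∈ M.tets, ∀ x ∈ T, x ∈ closure Ω ∧ (x ∈ M.bdry → x ∈ frontier Ω)

/-- `t` is the unit vector orthogonal to the edge `e` of the face `F`, parallel to `F`, and pointing
from `e` into `F`. -/
def IsConormal (e F : Finset E3) (t : E3) : Prop :=
  ‖t‖ = 1 ∧ (∀ x ∈ e, ∀ y ∈ e, ⟪t, x - y⟫ = 0) ∧
    ∃ x ∈ F, ∃ c : ℝ, 0 < c ∧ x - c • t ∈ affineSpan ℝ (e : Set E3)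

/-- `d` chooses, for every edge `e` contained in `Γ_h`, the plane of the skin attached to `e`: this
plane contains `e` and is spanned by `e` and the unit vector `d e` orthogonal to `e`. With conormals
`t`, `t'` at `e` of two faces on `Γ_h` that meet at `e`, the vector `t - t'` is normal to the
bisector plane of these faces; the angle between the plane of the skin and the bisector plane is
required to be at most `arcsin κ`. -/
def IsSkinDirection (κ : ℝ) (d : Finset E3 → E3) : Prop :=
  ∀ e ∈ M.complex.faces, e.card = 2 → M.OnBdry e →
    ‖d e‖ = 1 ∧ (∀ x ∈ e, ∀ y ∈ e, ⟪d e, x - y⟫ = 0) ∧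
      ∃ F ∈ M.complex.faces, ∃ F' ∈ M.complex.faces, F.card = 3 ∧ F'.card = 3 ∧
        e ⊆ F ∧ e ⊆ F' ∧ F ≠ F' ∧ M.OnBdry F ∧ M.OnBdry F' ∧
          ∃ t t' : E3, IsConormal e F t ∧ IsConormal e F' t' ∧
            |⟪d e, t - t'⟫| ≤ κ * ‖t - t'‖

/-- Piecewise quadratic functions on the mesh: one polynomial for each tetrahedron. The polynomial
expression is also used outside the tetrahedron. -/
abbrev Broken : Type := M.tets → P2

/-- The degrees of freedom of `w` at faces and edges not contained in `Γ_h` are single-valued. -/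
def SingleValued (w : M.Broken) : Prop :=
  (∀ F : Finset E3, F.card = 3 → ¬ M.OnBdry F → ∀ T T' : M.tets, F ⊆ T.1 → F ⊆ T'.1 →
    faceDof F (w T) = faceDof F (w T')) ∧
  (∀ e : Finset E3, e.card = 2 → ¬ M.OnBdry e → ∀ T T' : M.tets, e ⊆ T.1 → e ⊆ T'.1 →
    edgeDof e (w T) = edgeDof e (w T'))

/-- The test space `V*_h`: the degrees of freedom vanish at faces and edges contained in `Γ_h`. -/
def testSpace : Submodule ℝ M.Broken where
  carrier := {v | M.SingleValued v ∧
    (∀ F : Finset E3, F.card = 3 → M.OnBdry F → ∀ T : M.tets, F ⊆ T.1 → faceDof F (v T) = 0) ∧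
    (∀ e : Finset E3, e.card = 2 → M.OnBdry e → ∀ T : M.tets, e ⊆ T.1 → edgeDof e (v T) = 0)}
  zero_mem' := by simp [SingleValued, faceDof, edgeDof]
  add_mem' := by
    rintro v w ⟨⟨hv1, hv2⟩, hv3, hv4⟩ ⟨⟨hw1, hw2⟩, hw3, hw4⟩
    simp only [faceDof, edgeDof] at *
    refine ⟨⟨?_, ?_⟩, ?_, ?_⟩
    · intro F h1 h2 T T' h3 h4
      simp [faceDof, hv1 F h1 h2 T T' h3 h4, hw1 F h1 h2 T T' h3 h4]
    · intro F h1 h2 T T' h3 h4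
      simp [edgeDof, hv2 F h1 h2 T T' h3 h4, hw2 F h1 h2 T T' h3 h4]
    · intro F h1 h2 T h3
      simp [hv3 F h1 h2 T h3, hw3 F h1 h2 T h3]
    · intro F h1 h2 T h3
      simp [hv4 F h1 h2 T h3, hw4 F h1 h2 T h3]
  smul_mem' := by
    rintro c v ⟨⟨hv1, hv2⟩, hv3, hv4⟩
    simp only [faceDof, edgeDof] at *
    refine ⟨⟨?_, ?_⟩, ?_, ?_⟩
    · intro F h1 h2 T T' h3 h4
      simp [faceDof, hv1 F h1 h2 T T' h3 h4]
    · intro F h1 h2 T T' h3 h4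
      simp [edgeDof, hv2 F h1 h2 T T' h3 h4]
    · intro F h1 h2 T h3
      simp [hv3 F h1 h2 T h3]
    · intro F h1 h2 T h3
      simp [hv4 F h1 h2 T h3]

/-- The trial space `W*_h` associated with `Γ = frontier Ω` and the skin directions `d`: for a face
`F` on `Γ_h`, the value at the nearest intersection `P` with `Γ` of the perpendicular to `F` through
its centroid vanishes; for an edge `e` on `Γ_h`, the mean value with the mid-point replaced by the
nearest intersection `Q` with `Γ` of the perpendicular to `e` in the skin through the mid-point
vanishes. -/
def trialSpace (Ω : Set E3) (d : Finset E3 → E3) : Submodule ℝ M.Broken where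
  carrier := {w | M.SingleValued w ∧
    (∀ F : Finset E3, F.card = 3 → M.OnBdry F → ∀ T : M.tets, F ⊆ T.1 →
      ∀ P : E3, IsNearest (frontier Ω ∩ faceNormalLine F) (center F) P → val (w T) P = 0) ∧
    (∀ e : Finset E3, e.card = 2 → M.OnBdry e → ∀ T : M.tets, e ⊆ T.1 →
      ∀ Q : E3, IsNearest (frontier Ω ∩ edgeLine e (d e)) (center e) Q →
        edgeValue e Q (w T) = 0)}
  zero_mem' := by simp [SingleValued, faceDof, edgeDof]
  add_mem' := by
    rintro v w ⟨⟨hv1, hv2⟩, hv3, hv4⟩ ⟨⟨hw1, hw2⟩, hw3, hw4⟩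
    simp only [faceDof, edgeDof] at hv1 hv2 hw1 hw2
    refine ⟨⟨?_, ?_⟩, ?_, ?_⟩
    · intro F h1 h2 T T' h3 h4
      simp [faceDof, hv1 F h1 h2 T T' h3 h4, hw1 F h1 h2 T T' h3 h4]
    · intro F h1 h2 T T' h3 h4
      simp [edgeDof, hv2 F h1 h2 T T' h3 h4, hw2 F h1 h2 T T' h3 h4]
    · intro F h1 h2 T h3 P hP
      simp [hv3 F h1 h2 T h3 P hP, hw3 F h1 h2 T h3 P hP]
    · intro F h1 h2 T h3 P hP
      simp [hv4 F h1 h2 T h3 P hP, hw4 F h1 h2 T h3 P hP]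
  smul_mem' := by
    rintro c v ⟨⟨hv1, hv2⟩, hv3, hv4⟩
    simp only [faceDof, edgeDof] at hv1 hv2
    refine ⟨⟨?_, ?_⟩, ?_, ?_⟩
    · intro F h1 h2 T T' h3 h4
      simp [faceDof, hv1 F h1 h2 T T' h3 h4]
    · intro F h1 h2 T T' h3 h4
      simp [edgeDof, hv2 F h1 h2 T T' h3 h4]
    · intro F h1 h2 T h3 P hP
      simp [hv3 F h1 h2 T h3 P hP]
    · intro F h1 h2 T h3 P hP
      simp [hv4 F h1 h2 T h3 P hP]

/-- The bilinear form `∫_{Ω_h} grad_h w · grad_h v`, the integral of the broken gradients taken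
tetrahedron by tetrahedron. -/
def form (w v : M.Broken) : ℝ :=
  ∑ T : M.tets, ∫ x in convexHull ℝ ((T : Finset E3) : Set E3), ⟪grad (w T) x, grad (v T) x⟫

/-- The `L²(Ω_h)` norm of the broken gradient. -/
def energyNorm (w : M.Broken) : ℝ := Real.sqrt (M.form w w)

end TetMesh

end CurvedFEM

end

/-! ### Barycentric coordinates of a tetrahedron -/

namespace CurvedFEM

open Metric

/-! Every trial function is close in energy to a test function. For `w` in the trial space, let `q`
be the piecewise quadratic whose face and edge degrees of freedom agree with those of `w` on Γ_h and
vanish elsewhere; then `w - q` is in the test space. Since `w` vanishes at a point of Γ within `ε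
diam T` of the centroid of a boundary face (and similarly for edges), these degrees of freedom are
at most `ε diam T` times a bound of the gradient of `w` near `T`. Inverse estimates on regular
tetrahedra turn this into ‖grad q‖ ≤ C ε ‖grad w‖, where C depends only on σ (`exists_correction`).
As soon as C ε ≤ 1/2, the test function `w - q` gives a quotient of at least 1/3 (`ratio_ge`).

The geometric task is to make ε small together with the mesh size (`exists_frontier_points`). By
compactness, a C¹ boundary is almost flat in all balls of one fixed radius (`exists_isFlatOn`). A
boundary face has its vertices on Γ, so by regularity it is almost tangent to Γ, and its
perpendicular meets Γ nearby. For an edge, the skin plane is controlled only relative to the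
bisector of two boundary faces, and the bisector is nearly normal to Γ only if these faces extend to
opposite sides of the edge. Folding is impossible: the vertices lie in the closure of Ω, so both
tetrahedra lie on the inner side of Γ, and with nearly parallel conormals they would have to overlap
(`Corner.not_overlap`, `not_folded`).

The quotient also requires ‖grad w‖ > 0. A trial function of zero energy is constant on each
tetrahedron, and it is zero on those with a face on Γ_h. The value zero spreads to all others
because every nonempty set of tetrahedra has a face that lies on Γ_h or is shared with a tetrahedron
outside the set (`exists_face_leaving`). -/

/-- The affine function `x ↦ c a + ⟪g a, x⟫`. -/
noncomputable def lam (c : E3 → ℝ) (g : E3 → E3) (a x : E3) : ℝ := c a + ⟪g a, x⟫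

/-- The functions `lam c g a`, for `a ∈ T`, are the barycentric coordinates with respect to the
vertices of the tetrahedron `T`. -/
structure IsBary (T : Finset E3) (c : E3 → ℝ) (g : E3 → E3) : Prop where
  self : ∀ a ∈ T, lam c g a a = 1
  ne : ∀ a ∈ T, ∀ b ∈ T, a ≠ b → lam c g a b = 0
  sum_one : ∀ x, ∑ a ∈ T, lam c g a x = 1
  sum_smul : ∀ x, ∑ a ∈ T, lam c g a x • a = x

theorem lam_sub (c : E3 → ℝ) (g : E3 → E3) (a x y : E3) :
    lam c g a x - lam c g a y = ⟪g a, x - y⟫ := by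
  simp [lam, inner_sub_right]

theorem lam_add_smul (c : E3 → ℝ) (g : E3 → E3) (a x u : E3) (s : ℝ) :
    lam c g a (x + s • u) = lam c g a x + s * ⟪g a, u⟫ := by
  simp [lam, inner_add_right, inner_smul_right]; ring

theorem lam_sum (c : E3 → ℝ) (g : E3 → E3) (a : E3) (s : Finset E3) (w : E3 → ℝ)
    (hw : ∑ x ∈ s, w x = 1) :
    lam c g a (∑ x ∈ s, w x • x) = ∑ x ∈ s, w x * lam c g a x := by
  simp [lam, inner_sum, inner_smul_right, mul_add, Finset.sum_add_distrib, ← Finset.sum_mul, hw]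

theorem lam_continuous (c : E3 → ℝ) (g : E3 → E3) (a : E3) : Continuous (lam c g a) := by
  unfold lam; fun_prop

theorem exists_isBary (T : Finset E3) (hT : T.card = 4)
    (hi : AffineIndependent ℝ (Subtype.val : T → E3)) : ∃ c g, IsBary T c g := by
  classical
  have htop : affineSpan ℝ (Set.range (Subtype.val : T → E3)) = ⊤ := by
    rw [hi.affineSpan_eq_top_iff_card_eq_finrank_add_one]
    simp [hT]
  let B : AffineBasis T ℝ E3 := ⟨Subtype.val, hi, htop⟩
  let c : E3 → ℝ := fun a => if h : a ∈ T then B.coord ⟨a, h⟩ 0 else 0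
  let g : E3 → E3 := fun a => if h : a ∈ T then
    (InnerProductSpace.toDual ℝ E3).symm (LinearMap.toContinuousLinearMap (B.coord ⟨a, h⟩).linear)
    else 0
  have key : ∀ (a : T) (x : E3), lam c g a x = B.coord a x := by
    intro a x
    have h1 : B.coord a x = (B.coord a).linear x + B.coord a 0 := by
      have := congrFun (AffineMap.decomp (B.coord a)) x
      simpa using this
    rw [h1]
    simp [lam, c, g]
    ring
  refine ⟨c, g, ?_, ?_, ?_, ?_⟩
  · intro a ha
    rw [key ⟨a, ha⟩]
    exact B.coord_apply_eq ⟨a, ha⟩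
  · intro a ha b hb hab
    rw [key ⟨a, ha⟩]
    exact B.coord_apply_ne (i := ⟨a, ha⟩) (j := ⟨b, hb⟩) (by simpa using hab)
  · intro x
    rw [← Finset.sum_coe_sort]
    simp_rw [key]
    exact B.sum_coord_apply_eq_one x
  · intro x
    rw [← Finset.sum_coe_sort T (fun a => lam c g a x • a)]
    simp_rw [key]
    exact B.linear_combination_coord_eq_self x

theorem mem_convexHull_iff_weights (s : Finset E3) (x : E3) :
    x ∈ convexHull ℝ (s : Set E3) ↔
      ∃ w : E3 → ℝ, (∀ a ∈ s, 0 ≤ w a) ∧ ∑ a ∈ s, w a = 1 ∧ ∑ a ∈ s, w a • a = x := by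
  rw [Finset.mem_convexHull']

namespace IsBary

variable {T : Finset E3} {c : E3 → ℝ} {g : E3 → E3}

theorem sum_grad (h : IsBary T c g) : ∑ a ∈ T, g a = 0 := by
  have h1 : ∀ u : E3, ⟪∑ a ∈ T, g a, u⟫ = 0 := by
    intro u
    have h2 := h.sum_one u
    have h3 := h.sum_one 0
    simp only [lam, inner_zero_right, Finset.sum_add_distrib, add_zero] at h2 h3
    rw [sum_inner]; linarith
  exact inner_self_eq_zero.mp (h1 _)

theorem sum_inner_smul (h : IsBary T c g) (u : E3) : ∑ a ∈ T, ⟪g a, u⟫ • a = u := by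
  have h2 := h.sum_smul u
  have h3 := h.sum_smul 0
  simp only [lam, inner_zero_right, add_smul, Finset.sum_add_distrib, add_zero] at h2 h3
  rw [h3, zero_add] at h2
  exact h2

theorem lam_of_weights (h : IsBary T c g) {s : Finset E3} (hs : s ⊆ T) {w : E3 → ℝ}
    (hw : ∑ a ∈ s, w a = 1) {a : E3} (ha : a ∈ s) :
    lam c g a (∑ x ∈ s, w x • x) = w a := by
  rw [lam_sum _ _ _ _ _ hw, Finset.sum_eq_single a]
  · rw [h.self a (hs ha), mul_one]
  · intro b hb hba
    rw [h.ne a (hs ha) b (hs hb) (Ne.symm hba), mul_zero]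
  · exact fun h => absurd ha h

theorem lam_of_weights_notMem (h : IsBary T c g) {s : Finset E3} (hs : s ⊆ T) {w : E3 → ℝ}
    (hw : ∑ a ∈ s, w a = 1) {a : E3} (haT : a ∈ T) (ha : a ∉ s) :
    lam c g a (∑ x ∈ s, w x • x) = 0 := by
  rw [lam_sum _ _ _ _ _ hw]
  refine Finset.sum_eq_zero fun b hb => ?_
  rw [h.ne a haT b (hs hb) (fun e => ha (e ▸ hb)), mul_zero]

theorem mem_convexHull_subset (h : IsBary T c g) {s : Finset E3} (hs : s ⊆ T) (x : E3) :
    x ∈ convexHull ℝ (s : Set E3) ↔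
      (∀ a ∈ T, 0 ≤ lam c g a x) ∧ ∀ a ∈ T, a ∉ s → lam c g a x = 0 := by
  rw [mem_convexHull_iff_weights]
  constructor
  · rintro ⟨w, hw0, hw1, rfl⟩
    refine ⟨fun a ha => ?_, fun a ha has => h.lam_of_weights_notMem hs hw1 ha has⟩
    by_cases has : a ∈ s
    · rw [h.lam_of_weights hs hw1 has]; exact hw0 a has
    · rw [h.lam_of_weights_notMem hs hw1 ha has]
  · rintro ⟨h0, h1⟩
    refine ⟨fun a => lam c g a x, fun a ha => h0 a (hs ha), ?_, ?_⟩
    · rw [← h.sum_one x]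
      exact Finset.sum_subset hs fun a ha has => h1 a ha has
    · conv_rhs => rw [← h.sum_smul x]
      exact Finset.sum_subset hs fun a ha has => by simp [h1 a ha has]

theorem mem_convexHull (h : IsBary T c g) (x : E3) :
    x ∈ convexHull ℝ (T : Set E3) ↔ ∀ a ∈ T, 0 ≤ lam c g a x := by
  rw [h.mem_convexHull_subset subset_rfl]
  exact ⟨fun h => h.1, fun h => ⟨h, fun a ha hn => absurd ha hn⟩⟩

theorem lam_le_one (h : IsBary T c g) {x : E3} (hx : x ∈ convexHull ℝ (T : Set E3)) {a : E3}
    (ha : a ∈ T) : lam c g a x ≤ 1 := by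
  rw [h.mem_convexHull] at hx
  rw [← h.sum_one x]
  exact Finset.single_le_sum (f := fun a => lam c g a x) hx ha

/-- The coordinate stays in [0, 1] on the inscribed ball, while a step of length `r` from its centre
along `g a` raises it by `r ‖g a‖`. -/
theorem norm_grad_le (h : IsBary T c g) {z : E3} {r : ℝ} (hr : 0 < r)
    (hb : closedBall z r ⊆ convexHull ℝ (T : Set E3)) {a : E3} (ha : a ∈ T) :
    ‖g a‖ ≤ 1 / r := by
  by_cases h0 : g a = 0
  · rw [h0, norm_zero]; positivity
  have hn : 0 < ‖g a‖ := norm_pos_iff.mpr h0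
  have hz : z ∈ convexHull ℝ (T : Set E3) := hb (mem_closedBall_self hr.le)
  have hy : z + (r / ‖g a‖) • g a ∈ convexHull ℝ (T : Set E3) := by
    apply hb
    rw [mem_closedBall, dist_eq_norm, add_sub_cancel_left, norm_smul, Real.norm_of_nonneg
      (by positivity)]
    field_simp; rfl
  have h1 := h.lam_le_one hy ha
  have h2 := (h.mem_convexHull z).mp hz a ha
  rw [lam_add_smul, real_inner_self_eq_norm_sq] at h1
  rw [le_div_iff₀ hr]
  have : r / ‖g a‖ * ‖g a‖ ^ 2 = ‖g a‖ * r := by field_simp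
  linarith

theorem grad_ne_zero (h : IsBary T c g) {a b : E3} (ha : a ∈ T) (hb : b ∈ T) (hab : a ≠ b) :
    ⟪g a, a - b⟫ = 1 := by
  rw [← lam_sub, h.self a ha, h.ne a ha b hb hab, sub_zero]

theorem le_dist (h : IsBary T c g) {z : E3} {r : ℝ} (hr : 0 < r)
    (hb : closedBall z r ⊆ convexHull ℝ (T : Set E3)) {a b : E3} (ha : a ∈ T) (hbT : b ∈ T)
    (hab : a ≠ b) : r ≤ ‖a - b‖ := by
  have h1 := h.grad_ne_zero ha hbT hab
  have h2 := real_inner_le_norm (g a) (a - b)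
  have h3 := mul_le_mul_of_nonneg_right (h.norm_grad_le hr hb ha) (norm_nonneg (a - b))
  have h4 : 1 ≤ 1 / r * ‖a - b‖ := by linarith
  rw [one_div, inv_mul_eq_div, le_div_iff₀ hr] at h4
  linarith

/-- Membership amounts to finitely many affine inequalities: those strict at `x` persist for small
steps, the others are preserved by the sign of their slope along `d`. -/
theorem eventually_mem (h : IsBary T c g) {x d : E3}
    (hx : ∀ a ∈ T, 0 < lam c g a x ∨ (lam c g a x = 0 ∧ 0 ≤ ⟪g a, d⟫)) :
    ∀ᶠ s in nhdsWithin (0 : ℝ) (Set.Ioi 0), x + s • d ∈ convexHull ℝ (T : Set E3) := by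
  simp_rw [h.mem_convexHull]
  rw [Filter.eventually_all_finset]
  intro a ha
  simp_rw [lam_add_smul]
  rcases hx a ha with h1 | ⟨h1, h2⟩
  · have hc : Filter.Tendsto (fun s : ℝ => lam c g a x + s * ⟪g a, d⟫)
        (nhdsWithin 0 (Set.Ioi 0)) (nhds (lam c g a x + 0 * ⟪g a, d⟫)) := by
      refine Filter.Tendsto.mono_left ?_ nhdsWithin_le_nhds
      exact Continuous.tendsto (by fun_prop) 0
    rw [zero_mul, add_zero] at hc
    exact (hc.eventually (lt_mem_nhds h1)).mono fun s hs => hs.le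
  · filter_upwards [self_mem_nhdsWithin] with s hs
    rw [h1, zero_add]
    exact mul_nonneg (le_of_lt hs) h2

end IsBary

theorem center_eq (s : Finset E3) (hs : s.Nonempty) :
    center s = ∑ x ∈ s, ((s.card : ℝ)⁻¹) • x := by
  have h1 : ∑ i ∈ s, s.centroidWeights ℝ i = 1 :=
    s.sum_centroidWeights_eq_one_of_nonempty ℝ hs
  rw [center, Finset.centroid_def, Finset.affineCombination_eq_linear_combination _ _ _ h1]
  simp [Finset.centroidWeights]

theorem sum_inv_card (s : Finset E3) (hs : s.Nonempty) :
    ∑ _x ∈ s, ((s.card : ℝ)⁻¹) = 1 := by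
  have : (s.card : ℝ) ≠ 0 := by exact_mod_cast hs.card_pos.ne'
  simp [this]

theorem center_mem_convexHull (s : Finset E3) (hs : s.Nonempty) :
    center s ∈ convexHull ℝ (s : Set E3) := by
  rw [mem_convexHull_iff_weights]
  exact ⟨fun _ => (s.card : ℝ)⁻¹, fun _ _ => by positivity, sum_inv_card s hs,
    (center_eq s hs).symm⟩

namespace IsBary

variable {T : Finset E3} {c : E3 → ℝ} {g : E3 → E3}

theorem lam_center (h : IsBary T c g) {s : Finset E3} (hs : s ⊆ T) (hne : s.Nonempty) {a : E3}
    (ha : a ∈ s) : lam c g a (center s) = (s.card : ℝ)⁻¹ := by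
  rw [center_eq s hne]
  exact h.lam_of_weights hs (w := fun _ => (s.card : ℝ)⁻¹) (sum_inv_card s hne) ha

theorem lam_center_notMem (h : IsBary T c g) {s : Finset E3} (hs : s ⊆ T) (hne : s.Nonempty)
    {a : E3} (haT : a ∈ T) (ha : a ∉ s) : lam c g a (center s) = 0 := by
  rw [center_eq s hne]
  exact h.lam_of_weights_notMem hs (w := fun _ => (s.card : ℝ)⁻¹) (sum_inv_card s hne) haT ha

end IsBary

end CurvedFEM
-- Quadratic polynomials and their gradients
namespace CurvedFEM

theorem hasGradientAt_lin (b : E3) (x : E3) : HasFDerivAt (fun y => ⟪b, y⟫) (innerSL ℝ b) x :=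
  (innerSL ℝ b).hasFDerivAt

theorem monomial_cases (s : Fin 3 →₀ ℕ) (hs : (s.sum fun _ e => e) ≤ 2) :
    (∀ x : E3, ∏ i ∈ s.support, (x i) ^ s i = 1) ∨
      (∃ i, ∀ x : E3, ∏ i ∈ s.support, (x i) ^ s i = x i) ∨
      ∃ i j, ∀ x : E3, ∏ i ∈ s.support, (x i) ^ s i = x i * x j := by
  have h1 : ∀ x : E3, ∏ i ∈ s.support, (x i) ^ s i = x 0 ^ s 0 * x 1 ^ s 1 * x 2 ^ s 2 := by
    intro x
    rw [Finset.prod_subset (Finset.subset_univ _), Fin.prod_univ_three]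
    intro i _ hi
    rw [Finsupp.notMem_support_iff.mp hi, pow_zero]
  simp_rw [h1]
  have h2 : (s.sum fun _ e => e) = s 0 + s 1 + s 2 := by
    rw [Finsupp.sum_fintype _ _ (fun _ => rfl), Fin.sum_univ_three]
  rw [h2] at hs
  generalize s 0 = a at *
  generalize s 1 = b at *
  generalize s 2 = e at *
  have ha : a ≤ 2 := by omega
  have hb : b ≤ 2 := by omega
  have he : e ≤ 2 := by omega
  interval_cases a <;> interval_cases b <;> interval_cases e <;> first
    | omega
    | (left; intro x; ring1)
    | (right; left; use 0; intro x; ring1)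
    | (right; left; use 1; intro x; ring1)
    | (right; left; use 2; intro x; ring1)
    | (right; right; use 0, 0; intro x; ring1)
    | (right; right; use 0, 1; intro x; ring1)
    | (right; right; use 0, 2; intro x; ring1)
    | (right; right; use 1, 1; intro x; ring1)
    | (right; right; use 1, 2; intro x; ring1)
    | (right; right; use 2, 2; intro x; ring1)

theorem val_quadratic (p : P2) : ∃ (k : ℝ) (b : E3) (A : E3 →L[ℝ] E3),
    ∀ x, val p x = k + ⟪b, x⟫ + ⟪A x, x⟫ := by
  obtain ⟨p, hp⟩ := p
  rw [MvPolynomial.mem_restrictTotalDegree] at hp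
  have key : ∀ S : Finset (Fin 3 →₀ ℕ), S ⊆ p.support → ∃ (k : ℝ) (b : E3) (A : E3 →L[ℝ] E3),
      ∀ x : E3, ∑ d ∈ S, p.coeff d * ∏ i ∈ d.support, x i ^ d i = k + ⟪b, x⟫ + ⟪A x, x⟫ := by
    classical
    intro S
    induction S using Finset.induction_on with
    | empty => exact fun _ => ⟨0, 0, 0, by simp⟩
    | insert s S hs ih =>
      intro hS
      obtain ⟨k, b, A, h⟩ := ih ((Finset.subset_insert _ _).trans hS)
      have hd := (MvPolynomial.le_totalDegree (hS (Finset.mem_insert_self s S))).trans hp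
      simp_rw [Finset.sum_insert hs, h]
      rcases monomial_cases s hd with h1 | ⟨i, h1⟩ | ⟨i, j, h1⟩
      · refine ⟨k + p.coeff s, b, A, fun x => ?_⟩
        rw [h1]; ring
      · refine ⟨k, b + p.coeff s • EuclideanSpace.single i 1, A, fun x => ?_⟩
        rw [h1, inner_add_left, inner_smul_left, EuclideanSpace.inner_single_left]
        simp; ring
      · refine ⟨k, b, A + p.coeff s • (innerSL ℝ (EuclideanSpace.single i (1 : ℝ))).smulRight
          (EuclideanSpace.single j (1 : ℝ)), fun x => ?_⟩
        rw [h1]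
        simp [inner_add_left, inner_smul_left, EuclideanSpace.inner_single_left]; ring
  obtain ⟨k, b, A, h⟩ := key _ subset_rfl
  exact ⟨k, b, A, fun x => by rw [← h x, val, MvPolynomial.eval_eq]⟩

theorem hasGradientAt_quadratic (k : ℝ) (b : E3) (A : E3 →L[ℝ] E3) (x : E3) :
    HasGradientAt (fun x => k + ⟪b, x⟫ + ⟪A x, x⟫) (b + (A + ContinuousLinearMap.adjoint A) x) x := by
  rw [hasGradientAt_iff_hasFDerivAt]
  have h1 : HasFDerivAt (fun y : E3 => ⟪A y, y⟫) _ x :=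
    A.hasFDerivAt.inner ℝ (hasFDerivAt_id x)
  refine (((hasGradientAt_lin b x).const_add k).add h1).congr_fderiv ?_
  ext u
  simp [ContinuousLinearMap.adjoint_inner_left, real_inner_comm]

/-- Affinity of the gradient is how degree two enters the inverse estimates: it allows reflection
through a point and extrapolation along a line. -/
theorem grad_affine (p : P2) : ∃ (b : E3) (A : E3 →L[ℝ] E3),
    ∀ x, HasGradientAt (val p) (b + A x) x ∧ grad p x = b + A x := by
  obtain ⟨k, b, A, h⟩ := val_quadratic p
  refine ⟨b, A + ContinuousLinearMap.adjoint A, fun x => ?_⟩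
  have : HasGradientAt (val p) (b + (A + ContinuousLinearMap.adjoint A) x) x := by
    rw [funext h]; exact hasGradientAt_quadratic k b A x
  exact ⟨this, this.gradient⟩

theorem hasGradientAt_val (p : P2) (x : E3) : HasGradientAt (val p) (grad p x) x := by
  obtain ⟨b, A, h⟩ := grad_affine p
  rw [(h x).2]; exact (h x).1

theorem grad_eq_of_hasFDerivAt {p : P2} {x v : E3} (h : HasFDerivAt (val p) (innerSL ℝ v) x) :
    grad p x = v :=
  HasGradientAt.gradient (hasGradientAt_iff_hasFDerivAt.mpr h)

theorem hasFDerivAt_val (p : P2) (x : E3) : HasFDerivAt (val p) (innerSL ℝ (grad p x)) x :=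
  hasGradientAt_iff_hasFDerivAt.mp (hasGradientAt_val p x)

theorem continuous_grad (p : P2) : Continuous (grad p) := by
  obtain ⟨b, A, h⟩ := grad_affine p
  rw [funext fun x => (h x).2]; fun_prop

theorem grad_add (p q : P2) (x : E3) : grad (p + q) x = grad p x + grad q x := by
  apply grad_eq_of_hasFDerivAt
  rw [map_add, show val (p + q) = fun y => val p y + val q y from funext (val_add p q)]
  exact (hasFDerivAt_val p x).add (hasFDerivAt_val q x)

theorem grad_smul (c : ℝ) (p : P2) (x : E3) : grad (c • p) x = c • grad p x := by
  apply grad_eq_of_hasFDerivAt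
  rw [map_smul, show val (c • p) = fun y => c * val p y from funext (val_smul c p)]
  exact (hasFDerivAt_val p x).const_mul c

/-- The gradient at a point as a linear map. -/
noncomputable def gradLin (x : E3) : P2 →ₗ[ℝ] E3 where
  toFun p := grad p x
  map_add' p q := grad_add p q x
  map_smul' c p := grad_smul c p x

theorem gradLin_apply (x : E3) (p : P2) : gradLin x p = grad p x := rfl

/-- The value at a point as a linear map. -/
noncomputable def valLin (x : E3) : P2 →ₗ[ℝ] ℝ where
  toFun p := val p x
  map_add' p q := val_add p q x
  map_smul' c p := val_smul c p x

theorem valLin_apply (x : E3) (p : P2) : valLin x p = val p x := rfl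

theorem abs_val_sub_le (p : P2) {s : Set E3} (hs : Convex ℝ s) {K : ℝ}
    (hK : ∀ x ∈ s, ‖grad p x‖ ≤ K) {x y : E3} (hx : x ∈ s) (hy : y ∈ s) :
    |val p y - val p x| ≤ K * ‖y - x‖ := by
  rw [← Real.norm_eq_abs]
  refine hs.norm_image_sub_le_of_norm_hasFDerivWithin_le
    (fun z _ => (hasFDerivAt_val p z).hasFDerivWithinAt) (fun z hz => ?_) hx hy
  rw [innerSL_apply_norm]; exact hK z hz

theorem eq_of_val_eq {p q : P2} (h : ∀ x, val p x = val q x) : p = q := by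
  apply Subtype.ext
  apply MvPolynomial.funext
  intro x
  exact h (WithLp.toLp 2 x)

/-- The polynomial `x ↦ k + ⟪b, x⟫`. -/
noncomputable def affPoly (k : ℝ) (b : E3) : MvPolynomial (Fin 3) ℝ :=
  MvPolynomial.C k + ∑ i, MvPolynomial.C (b i) * MvPolynomial.X i

theorem totalDegree_affPoly (k : ℝ) (b : E3) : (affPoly k b).totalDegree ≤ 1 := by
  refine (MvPolynomial.totalDegree_add _ _).trans (max_le (by simp) ?_)
  refine MvPolynomial.totalDegree_finsetSum_le fun i _ => ?_
  refine (MvPolynomial.totalDegree_mul _ _).trans ?_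
  simp

theorem eval_affPoly (k : ℝ) (b x : E3) :
    MvPolynomial.eval (fun i => x i) (affPoly k b) = k + ⟪b, x⟫ := by
  simp [affPoly, PiLp.inner_apply, mul_comm]

/-- The square of an affine function. -/
noncomputable def sqP (k : ℝ) (b : E3) : P2 :=
  ⟨affPoly k b ^ 2, by
    rw [MvPolynomial.mem_restrictTotalDegree]
    refine (MvPolynomial.totalDegree_pow _ _).trans ?_
    have := totalDegree_affPoly k b
    omega⟩

/-- An affine function. -/
noncomputable def affP (k : ℝ) (b : E3) : P2 :=
  ⟨affPoly k b, by
    rw [MvPolynomial.mem_restrictTotalDegree]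
    exact (totalDegree_affPoly k b).trans (by norm_num)⟩

theorem val_affP (k : ℝ) (b x : E3) : val (affP k b) x = k + ⟪b, x⟫ := eval_affPoly k b x

theorem val_sqP (k : ℝ) (b x : E3) : val (sqP k b) x = (k + ⟪b, x⟫) ^ 2 := by
  simp [val, sqP, eval_affPoly]

theorem grad_affP (k : ℝ) (b x : E3) : grad (affP k b) x = b := by
  apply grad_eq_of_hasFDerivAt
  rw [funext (val_affP k b)]
  exact (hasGradientAt_lin b x).const_add k

theorem grad_sqP (k : ℝ) (b x : E3) : grad (sqP k b) x = (2 * (k + ⟪b, x⟫)) • b := by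
  apply grad_eq_of_hasFDerivAt
  rw [funext (val_sqP k b)]
  refine (((hasGradientAt_lin b x).const_add k).pow 2).congr_fderiv ?_
  rw [map_smul]; simp [mul_add]

end CurvedFEM
-- Shape functions dual to the degrees of freedom
namespace CurvedFEM

/-- The quadratic function `k₀ + k₁ L + k₂ L² + k₃ ∑_{a ∈ s} λ_a² + k₄ ∑_{a ∈ T} λ_a²`, where `L` is
the sum of the barycentric coordinates `λ_a` with `a ∈ s`. -/
noncomputable def shape (T : Finset E3) (c : E3 → ℝ) (g : E3 → E3) (k₀ k₁ k₂ k₃ k₄ : ℝ)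
    (s : Finset E3) : P2 :=
  k₀ • affP 1 0 + k₁ • affP (∑ a ∈ s, c a) (∑ a ∈ s, g a) +
    k₂ • sqP (∑ a ∈ s, c a) (∑ a ∈ s, g a) + k₃ • ∑ a ∈ s, sqP (c a) (g a) +
    k₄ • ∑ a ∈ T, sqP (c a) (g a)

/-- The shape function dual to the face degree of freedom. -/
noncomputable abbrev faceShape (T : Finset E3) (c : E3 → ℝ) (g : E3 → E3) : Finset E3 → P2 :=
  -- The four coefficients solve four equations: value 1 at the centroid of the face itself and 0 at
  -- the others, and edge value 0 for edges with one or two vertices in the face.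
  shape T c g 3 (-54 / 7) (45 / 7) 0 (-15 / 7)

/-- The shape function dual to the edge degree of freedom. -/
noncomputable abbrev edgeShape (T : Finset E3) (c : E3 → ℝ) (g : E3 → E3) : Finset E3 → P2 :=
  -- Five equations for five coefficients: edge values 0, 0, 1 for edges sharing 0, 1, 2 vertices
  -- with the given one, and centroid value 0 for faces containing one or two of its vertices.
  shape T c g (40 / 21) (-40 / 7) 5 (15 / 7) (-50 / 21)

theorem sum_lam (c : E3 → ℝ) (g : E3 → E3) (s : Finset E3) (x : E3) :
    ∑ a ∈ s, c a + ⟪∑ a ∈ s, g a, x⟫ = ∑ a ∈ s, lam c g a x := by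
  simp [lam, sum_inner, Finset.sum_add_distrib]

theorem val_shape (T : Finset E3) (c : E3 → ℝ) (g : E3 → E3) (k₀ k₁ k₂ k₃ k₄ : ℝ)
    (s : Finset E3) (x : E3) :
    val (shape T c g k₀ k₁ k₂ k₃ k₄ s) x = k₀ + k₁ * ∑ a ∈ s, lam c g a x +
      k₂ * (∑ a ∈ s, lam c g a x) ^ 2 + k₃ * ∑ a ∈ s, lam c g a x ^ 2 +
      k₄ * ∑ a ∈ T, lam c g a x ^ 2 := by
  simp only [shape, val_add, val_smul, val_affP, val_sqP, sum_lam]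
  simp only [← valLin_apply x (∑ a ∈ _, sqP (c a) (g a)), map_sum]
  simp only [valLin_apply, val_sqP, lam, inner_zero_left, add_zero, mul_one]

theorem grad_shape (T : Finset E3) (c : E3 → ℝ) (g : E3 → E3) (k₀ k₁ k₂ k₃ k₄ : ℝ)
    (s : Finset E3) (x : E3) :
    grad (shape T c g k₀ k₁ k₂ k₃ k₄ s) x = k₁ • ∑ a ∈ s, g a +
      k₂ • (2 * ∑ a ∈ s, lam c g a x) • ∑ a ∈ s, g a + k₃ • ∑ a ∈ s, (2 * lam c g a x) • g a +
      k₄ • ∑ a ∈ T, (2 * lam c g a x) • g a := by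
  simp only [shape, grad_add, grad_smul, grad_affP, grad_sqP, sum_lam]
  simp only [← gradLin_apply x (∑ a ∈ _, sqP (c a) (g a)), map_sum]
  simp only [gradLin_apply, grad_sqP, lam, smul_zero, zero_add]

namespace IsBary

variable {T : Finset E3} {c : E3 → ℝ} {g : E3 → E3}

open Classical in
theorem sum_ite_inter (s u : Finset E3) (v : ℝ) :
    ∑ a ∈ s, (if a ∈ u then v else 0) = (s ∩ u).card * v := by
  rw [← Finset.sum_filter, Finset.sum_const, nsmul_eq_mul, Finset.filter_mem_eq_inter]

open Classical in
theorem lam_center_eq (h : IsBary T c g) {u : Finset E3} (hu : u ⊆ T) (hne : u.Nonempty) {a : E3}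
    (ha : a ∈ T) : lam c g a (center u) = if a ∈ u then (u.card : ℝ)⁻¹ else 0 := by
  split_ifs with hau
  · exact h.lam_center hu hne hau
  · exact h.lam_center_notMem hu hne ha hau

-- At the centre of `u` the coordinates are `1 / u.card` on `u` and 0 elsewhere, so only the size of
-- `s ∩ u` matters.
open Classical in
theorem val_shape_center (h : IsBary T c g) (k₀ k₁ k₂ k₃ k₄ : ℝ) {s u : Finset E3} (hs : s ⊆ T)
    (hu : u ⊆ T) (hne : u.Nonempty) :
    val (shape T c g k₀ k₁ k₂ k₃ k₄ s) (center u) = k₀ + k₁ * ((s ∩ u).card * (u.card : ℝ)⁻¹) +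
      k₂ * ((s ∩ u).card * (u.card : ℝ)⁻¹) ^ 2 + k₃ * ((s ∩ u).card * ((u.card : ℝ)⁻¹) ^ 2) +
      k₄ * (u.card : ℝ)⁻¹ := by
  have h1 : ∀ a ∈ T, lam c g a (center u) ^ 2 = if a ∈ u then ((u.card : ℝ)⁻¹) ^ 2 else 0 := by
    intro a ha
    rw [h.lam_center_eq hu hne ha]; split_ifs <;> simp
  rw [val_shape, Finset.sum_congr rfl fun a ha => h.lam_center_eq hu hne (hs ha),
    Finset.sum_congr rfl fun a ha => h1 a (hs ha), Finset.sum_congr rfl h1, sum_ite_inter,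
    sum_ite_inter, sum_ite_inter, Finset.inter_eq_right.mpr hu]
  have : (u.card : ℝ) ≠ 0 := by exact_mod_cast hne.card_pos.ne'
  field_simp

open Classical in
theorem val_shape_vertex (h : IsBary T c g) (k₀ k₁ k₂ k₃ k₄ : ℝ) {s : Finset E3} (hs : s ⊆ T)
    {x : E3} (hx : x ∈ T) :
    val (shape T c g k₀ k₁ k₂ k₃ k₄ s) x = k₀ + k₄ + if x ∈ s then k₁ + k₂ + k₃ else 0 := by
  have h0 : ∀ a ∈ T, lam c g a x = if a = x then 1 else 0 := by
    intro a ha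
    split_ifs with hax
    · subst hax; exact h.self a ha
    · exact h.ne a ha x hx hax
  have h1 : ∀ a ∈ T, lam c g a x ^ 2 = if a = x then 1 else 0 := by
    intro a ha
    rw [h0 a ha]; split_ifs <;> simp
  rw [val_shape, Finset.sum_congr rfl fun a ha => h0 a (hs ha),
    Finset.sum_congr rfl fun a ha => h1 a (hs ha), Finset.sum_congr rfl h1]
  simp only [Finset.sum_ite_eq', hx, if_true]
  split_ifs <;> ring

-- Again only the size `m` of `s ∩ e` matters. For instance `L` is `m / 2` at the mid-point, and
-- `L²` sums to `m` over the end-points, which gives `m² / 10 + 3 m / 10`.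
open Classical in
theorem edgeDof_shape (h : IsBary T c g) (k₀ k₁ k₂ k₃ k₄ : ℝ) {s e : Finset E3} (hs : s ⊆ T)
    (he : e ⊆ T) (hcard : e.card = 2) :
    edgeDof e (shape T c g k₀ k₁ k₂ k₃ k₄ s) = k₀ + k₁ * ((s ∩ e).card / 2) +
      k₂ * ((s ∩ e).card ^ 2 / 10 + 3 / 10 * (s ∩ e).card) + k₃ * (2 / 5 * (s ∩ e).card) +
      k₄ * (4 / 5) := by
  have hne : e.Nonempty := Finset.card_pos.mp (by omega)
  have h1 : ∑ x ∈ e, val (shape T c g k₀ k₁ k₂ k₃ k₄ s) x =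
      2 * (k₀ + k₄) + (s ∩ e).card * (k₁ + k₂ + k₃) := by
    rw [Finset.sum_congr rfl fun x hx => h.val_shape_vertex k₀ k₁ k₂ k₃ k₄ hs (he hx),
      Finset.sum_add_distrib, sum_ite_inter, Finset.inter_comm e s, Finset.sum_const, hcard]
    simp [mul_add]
  have h2 := h.val_shape_center k₀ k₁ k₂ k₃ k₄ hs he hne
  rw [edgeDof, edgeValue, h1, h2, hcard]
  push_cast
  ring

open Classical in
theorem card_inter_face {F F' : Finset E3} (hT : T.card = 4) (hF : F ⊆ T) (hF' : F' ⊆ T)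
    (h3 : F.card = 3) (h3' : F'.card = 3) : (F ∩ F').card = if F = F' then 3 else 2 := by
  have h1 := Finset.card_union_add_card_inter F F'
  have h2 : (F ∪ F').card ≤ 4 := (Finset.card_le_card (Finset.union_subset hF hF')).trans hT.le
  split_ifs with h
  · rw [h, Finset.inter_self, h3']
  · have h4 : (F ∩ F').card ≤ 3 := (Finset.card_le_card Finset.inter_subset_left).trans h3.le
    have h5 : (F ∩ F').card ≠ 3 := by
      intro h5
      have h6 := Finset.eq_of_subset_of_card_le (Finset.inter_subset_left (s₁ := F) (s₂ := F'))
        (by omega)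
      have h7 := Finset.eq_of_subset_of_card_le (Finset.inter_subset_right (s₁ := F) (s₂ := F'))
        (by omega)
      exact h (h6.symm.trans h7)
    omega

open Classical in
theorem card_inter_face_edge {F e : Finset E3} (hT : T.card = 4) (hF : F ⊆ T) (he : e ⊆ T)
    (h3 : F.card = 3) (h2 : e.card = 2) : (F ∩ e).card = 1 ∨ (F ∩ e).card = 2 := by
  have h1 := Finset.card_union_add_card_inter F e
  have h5 : (F ∪ e).card ≤ 4 := (Finset.card_le_card (Finset.union_subset hF he)).trans hT.le
  have h4 : (F ∩ e).card ≤ 2 := (Finset.card_le_card Finset.inter_subset_right).trans h2.le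
  omega

open Classical in
theorem faceDof_faceShape (h : IsBary T c g) (hT : T.card = 4) {F F' : Finset E3} (hF : F ⊆ T)
    (hF' : F' ⊆ T) (h3 : F.card = 3) (h3' : F'.card = 3) :
    faceDof F' (faceShape T c g F) = if F = F' then 1 else 0 := by
  rw [faceDof, h.val_shape_center _ _ _ _ _ hF hF' (Finset.card_pos.mp (by omega)),
    card_inter_face hT hF hF' h3 h3', h3']
  split_ifs <;> norm_num

theorem edgeDof_faceShape (h : IsBary T c g) (hT : T.card = 4) {F e : Finset E3} (hF : F ⊆ T)
    (he : e ⊆ T) (h3 : F.card = 3) (h2 : e.card = 2) :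
    edgeDof e (faceShape T c g F) = 0 := by
  classical
  rw [h.edgeDof_shape _ _ _ _ _ hF he h2]
  rcases card_inter_face_edge hT hF he h3 h2 with h1 | h1 <;> rw [h1] <;> norm_num

theorem faceDof_edgeShape (h : IsBary T c g) (hT : T.card = 4) {F e : Finset E3} (hF : F ⊆ T)
    (he : e ⊆ T) (h3 : F.card = 3) (h2 : e.card = 2) :
    faceDof F (edgeShape T c g e) = 0 := by
  classical
  rw [faceDof, h.val_shape_center _ _ _ _ _ he hF (Finset.card_pos.mp (by omega)), h3,
    Finset.inter_comm]
  rcases card_inter_face_edge hT hF he h3 h2 with h1 | h1 <;> rw [h1] <;> norm_num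

open Classical in
theorem edgeDof_edgeShape (h : IsBary T c g) {e e' : Finset E3} (he : e ⊆ T)
    (he' : e' ⊆ T) (h2 : e.card = 2) (h2' : e'.card = 2) :
    edgeDof e' (edgeShape T c g e) = if e = e' then 1 else 0 := by
  rw [h.edgeDof_shape _ _ _ _ _ he he' h2']
  have h4 : (e ∩ e').card ≤ 2 := (Finset.card_le_card Finset.inter_subset_left).trans h2.le
  split_ifs with h
  · rw [h, Finset.inter_self, h2']; norm_num
  · have h5 : (e ∩ e').card ≠ 2 := by
      intro h5
      have h6 := Finset.eq_of_subset_of_card_le (Finset.inter_subset_left (s₁ := e) (s₂ := e'))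
        (by omega)
      have h7 := Finset.eq_of_subset_of_card_le (Finset.inter_subset_right (s₁ := e) (s₂ := e'))
        (by omega)
      exact h (h6.symm.trans h7)
    generalize (e ∩ e').card = m at *
    interval_cases m <;> norm_num
    omega

-- On `T` the coordinates are in [0, 1] and their gradients are at most `1 / r`; each term has at
-- most four summands and a factor at most 2, whence the 8.
open Metric in
theorem norm_grad_shape_le (h : IsBary T c g) (hT : T.card = 4) (k₀ k₁ k₂ k₃ k₄ : ℝ)
    {s : Finset E3} (hs : s ⊆ T) {z : E3} {r : ℝ} (hr : 0 < r)
    (hb : closedBall z r ⊆ convexHull ℝ (T : Set E3)) {x : E3}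
    (hx : x ∈ convexHull ℝ (T : Set E3)) :
    ‖grad (shape T c g k₀ k₁ k₂ k₃ k₄ s) x‖ ≤ 8 * (|k₁| + |k₂| + |k₃| + |k₄|) / r := by
  have hcard : ∀ s ⊆ T, (s.card : ℝ) ≤ 4 := fun s hs => by
    exact_mod_cast (Finset.card_le_card hs).trans hT.le
  have hpos := (h.mem_convexHull x).mp hx
  have hL0 : 0 ≤ ∑ a ∈ s, lam c g a x := Finset.sum_nonneg fun a ha => hpos a (hs ha)
  have hL1 : ∑ a ∈ s, lam c g a x ≤ 1 := by
    rw [← h.sum_one x]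
    exact Finset.sum_le_sum_of_subset_of_nonneg hs fun a ha _ => hpos a ha
  have hG : ‖∑ a ∈ s, g a‖ ≤ 4 / r := by
    refine (norm_sum_le_of_le s fun a ha => h.norm_grad_le hr hb (hs ha)).trans ?_
    rw [Finset.sum_const, nsmul_eq_mul, mul_one_div]
    gcongr; exact hcard s hs
  have hQ : ∀ s ⊆ T, ‖∑ a ∈ s, (2 * lam c g a x) • g a‖ ≤ 8 / r := by
    intro s hs
    have : ∀ a ∈ s, ‖(2 * lam c g a x) • g a‖ ≤ 2 * (1 / r) := by
      intro a ha
      have h0 := hpos a (hs ha)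
      rw [norm_smul, Real.norm_of_nonneg (by positivity)]
      refine mul_le_mul ?_ (h.norm_grad_le hr hb (hs ha)) (norm_nonneg _) (by norm_num)
      linarith [h.lam_le_one hx (hs ha)]
    refine (norm_sum_le_of_le s this).trans ?_
    rw [Finset.sum_const, nsmul_eq_mul, mul_one_div, ← mul_div_assoc]
    have := hcard s hs
    gcongr; linarith
  have hLG : ‖(2 * ∑ a ∈ s, lam c g a x) • ∑ a ∈ s, g a‖ ≤ 8 / r := by
    rw [norm_smul, Real.norm_of_nonneg (by positivity)]
    calc _ ≤ 2 * (4 / r) := by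
          refine mul_le_mul (by linarith) hG (norm_nonneg _) (by norm_num)
      _ = 8 / r := by ring
  rw [grad_shape]
  have e : ∀ (k : ℝ) (v : E3), ‖v‖ ≤ 8 / r → ‖k • v‖ ≤ |k| * (8 / r) := fun k v hv => by
    rw [norm_smul, Real.norm_eq_abs]; gcongr
  have h48 : 4 / r ≤ 8 / r := by gcongr; norm_num
  refine (norm_add_le_of_le (norm_add_le_of_le (norm_add_le_of_le (e k₁ _ (hG.trans h48))
    (e k₂ _ hLG)) (e k₃ _ (hQ s hs))) (e k₄ _ (hQ T subset_rfl))).trans (le_of_eq ?_)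
  ring

end IsBary

end CurvedFEM
-- Inverse estimates and the size of the correction
namespace CurvedFEM

open Metric MeasureTheory

/-- The volume of the unit ball. -/
noncomputable def unitVol : ℝ := volume.real (ball (0 : E3) 1)

theorem unitVol_pos : 0 < unitVol := by
  unfold unitVol
  rw [measureReal_def]
  exact ENNReal.toReal_pos (measure_ball_pos _ _ one_pos).ne' measure_ball_lt_top.ne

theorem volume_real_closedBall (x : E3) {r : ℝ} (hr : 0 ≤ r) :
    volume.real (closedBall x r) = r ^ 3 * unitVol := by
  rw [Measure.addHaar_real_closedBall _ _ hr, unitVol]; simp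

theorem isCompact_convexHull (T : Finset E3) : IsCompact (convexHull ℝ (T : Set E3)) :=
  T.finite_toSet.isCompact_convexHull ℝ

theorem integrableOn_inner_grad {S : Set E3} (hS : IsCompact S) (p q : P2) :
    IntegrableOn (fun x => ⟪grad p x, grad q x⟫) S :=
  ((continuous_grad p).inner (continuous_grad q)).continuousOn.integrableOn_compact hS

theorem integrableOn_norm_grad {S : Set E3} (hS : IsCompact S) (p : P2) :
    IntegrableOn (fun x => ‖grad p x‖ ^ 2) S :=
  ((continuous_grad p).norm.pow 2).continuousOn.integrableOn_compact hS

theorem setIntegral_closedBall_reflect (f : E3 → ℝ) (x : E3) (ρ : ℝ) :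
    ∫ y in closedBall x ρ, f (x + x - y) = ∫ y in closedBall x ρ, f y := by
  rw [← integral_indicator measurableSet_closedBall, ← integral_indicator measurableSet_closedBall,
    ← integral_sub_left_eq_self _ volume (x + x)]
  congr 1
  ext y
  have : x + x - y ∈ closedBall x ρ ↔ y ∈ closedBall x ρ := by
    rw [mem_closedBall, mem_closedBall, dist_eq_norm, dist_eq_norm, norm_sub_rev y x]
    rw [show x + x - y - x = x - y by abel]
  by_cases h : y ∈ closedBall x ρ
  · rw [Set.indicator_of_mem h, Set.indicator_of_mem (this.mpr h), sub_sub_cancel]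
  · rw [Set.indicator_of_notMem h, Set.indicator_of_notMem (fun h' => h (this.mp h'))]

/-- A sub-mean value property of the gradient of a quadratic polynomial. -/
theorem norm_grad_sq_le_integral (p : P2) {S : Set E3} (hS : IsCompact S) {x : E3} {ρ : ℝ}
    (hρ : 0 ≤ ρ) (hb : closedBall x ρ ⊆ S) :
    ρ ^ 3 * unitVol * ‖grad p x‖ ^ 2 ≤ ∫ y in S, ‖grad p y‖ ^ 2 := by
  obtain ⟨b, A, hA⟩ := grad_affine p
  -- The gradient at `x` is the mean of its values at two points symmetric about `x`; convexity of
  -- the square does the rest.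
  have hsym : ∀ y, 2 * ‖grad p x‖ ^ 2 ≤ ‖grad p y‖ ^ 2 + ‖grad p (x + x - y)‖ ^ 2 := by
    intro y
    have h1 : grad p y + grad p (x + x - y) = (2 : ℝ) • grad p x := by
      rw [(hA y).2, (hA x).2, (hA _).2, map_sub, map_add, two_smul]; abel
    have h2 := norm_add_le (grad p y) (grad p (x + x - y))
    rw [h1, norm_smul, Real.norm_of_nonneg zero_le_two] at h2
    nlinarith [sq_nonneg (‖grad p y‖ - ‖grad p (x + x - y)‖), norm_nonneg (grad p x)]
  have hB : IsCompact (closedBall x ρ) := isCompact_closedBall x ρ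
  have hi1 := integrableOn_norm_grad hB p
  have hi2 : IntegrableOn (fun y => ‖grad p (x + x - y)‖ ^ 2) (closedBall x ρ) := by
    refine Continuous.continuousOn ?_ |>.integrableOn_compact hB
    exact ((continuous_grad p).comp (by fun_prop)).norm.pow 2
  have h1 : ∫ _y in closedBall x ρ, 2 * ‖grad p x‖ ^ 2 ≤
      ∫ y in closedBall x ρ, (‖grad p y‖ ^ 2 + ‖grad p (x + x - y)‖ ^ 2) :=
    setIntegral_mono (integrableOn_const (hs := hB.measure_lt_top.ne)) (hi1.add hi2) hsym
  rw [integral_add hi1 hi2, setIntegral_closedBall_reflect (fun y => ‖grad p y‖ ^ 2),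
    setIntegral_const, volume_real_closedBall x hρ, smul_eq_mul] at h1
  have h2 : ∫ y in closedBall x ρ, ‖grad p y‖ ^ 2 ≤ ∫ y in S, ‖grad p y‖ ^ 2 :=
    setIntegral_mono_set (integrableOn_norm_grad hS p)
      (Filter.Eventually.of_forall fun y => by positivity)
      (LE.le.eventuallyLE hb)
  linarith

/-- An inverse estimate: the size of the gradient at a point at distance at most `R` of the centre
of a ball contained in `S`. -/
theorem norm_grad_le_of_closedBall (p : P2) {S : Set E3} (hS : IsCompact S) {z : E3} {r R : ℝ}
    (hr : 0 < r) (hR : 0 < R) (hb : closedBall z r ⊆ S) {y : E3} (hy : ‖y - z‖ ≤ R) :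
    ‖grad p y‖ ≤ (1 + 4 * R / r) *
      Real.sqrt (8 / (unitVol * r ^ 3) * ∫ x in S, ‖grad p x‖ ^ 2) := by
  have hV := unitVol_pos
  set m := Real.sqrt (8 / (unitVol * r ^ 3) * ∫ x in S, ‖grad p x‖ ^ 2) with hm
  have hm0 : 0 ≤ m := Real.sqrt_nonneg _
  -- A ball of radius `r / 2` around a point of the half-size ball still fits in `S`; the factor 8
  -- is the inverse cube of 1/2.
  have key : ∀ x ∈ closedBall z (r / 2), ‖grad p x‖ ≤ m := by
    intro x hx
    have h1 : closedBall x (r / 2) ⊆ S := by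
      refine (closedBall_subset_closedBall' ?_).trans hb
      rw [mem_closedBall] at hx; linarith
    have h2 := norm_grad_sq_le_integral p hS (by positivity) h1
    rw [hm]
    apply Real.le_sqrt_of_sq_le
    rw [div_mul_eq_mul_div, le_div_iff₀ (by positivity)]
    nlinarith
  obtain ⟨b, A, hA⟩ := grad_affine p
  have hθ : 0 < r / (2 * R) := by positivity
  -- A point of the half-size ball on the ray from `z` to `y`: the affine gradient at `y` is
  -- extrapolated from `z` and `x`.
  set x := z + (r / (2 * R)) • (y - z) with hx
  have hxm : x ∈ closedBall z (r / 2) := by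
    rw [mem_closedBall, dist_eq_norm, hx, add_sub_cancel_left, norm_smul,
      Real.norm_of_nonneg hθ.le]
    calc r / (2 * R) * ‖y - z‖ ≤ r / (2 * R) * R := by gcongr
      _ = r / 2 := by field_simp
  have h1 : grad p y = grad p z + (2 * R / r) • (grad p x - grad p z) := by
    rw [(hA y).2, (hA x).2, (hA z).2, hx, map_add, map_smul, map_sub, add_sub_add_left_eq_sub,
      add_sub_cancel_left, smul_smul, show 2 * R / r * (r / (2 * R)) = 1 by field_simp, one_smul]
    abel
  have h2 := key z (mem_closedBall_self (by positivity))
  have h3 := key x hxm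
  rw [h1]
  calc ‖grad p z + (2 * R / r) • (grad p x - grad p z)‖
      ≤ ‖grad p z‖ + 2 * R / r * (‖grad p x‖ + ‖grad p z‖) := by
        refine (norm_add_le _ _).trans ?_
        rw [norm_smul, Real.norm_of_nonneg (by positivity)]
        gcongr
        exact norm_sub_le _ _
    _ ≤ m + 2 * R / r * (m + m) := by gcongr
    _ = (1 + 4 * R / r) * m := by ring

theorem integral_norm_grad_sq_le (q : P2) {S : Set E3} (hS : IsCompact S) (hne : S.Nonempty)
    {K : ℝ} (hK : ∀ x ∈ S, ‖grad q x‖ ≤ K) :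
    ∫ x in S, ‖grad q x‖ ^ 2 ≤ diam S ^ 3 * unitVol * K ^ 2 := by
  obtain ⟨a, ha⟩ := hne
  have h1 : ‖∫ x in S, ‖grad q x‖ ^ 2‖ ≤ K ^ 2 * volume.real S := by
    refine norm_setIntegral_le_of_norm_le_const hS.measure_lt_top fun x hx => ?_
    rw [Real.norm_of_nonneg (by positivity)]
    exact pow_le_pow_left₀ (norm_nonneg _) (hK x hx) 2
  have h2 : volume.real S ≤ diam S ^ 3 * unitVol := by
    rw [← volume_real_closedBall a diam_nonneg]
    refine measureReal_mono (fun x hx => ?_) measure_closedBall_lt_top.ne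
    exact dist_le_diam_of_mem hS.isBounded hx ha
  calc _ ≤ _ := le_abs_self _
    _ ≤ _ := h1
    _ ≤ K ^ 2 * (diam S ^ 3 * unitVol) := by gcongr
    _ = _ := by ring

/-- The polynomial with given face and edge degrees of freedom. -/
noncomputable def interp (T : Finset E3) (c : E3 → ℝ) (g : E3 → E3) (α β : Finset E3 → ℝ) : P2 :=
  ∑ F ∈ T.powersetCard 3, α F • faceShape T c g F + ∑ e ∈ T.powersetCard 2, β e • edgeShape T c g e

namespace IsBary

variable {T : Finset E3} {c : E3 → ℝ} {g : E3 → E3}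

theorem faceDof_interp (h : IsBary T c g) (hT : T.card = 4) (α β : Finset E3 → ℝ) {F : Finset E3}
    (hF : F ⊆ T) (h3 : F.card = 3) : faceDof F (interp T c g α β) = α F := by
  classical
  rw [faceDof, ← valLin_apply, interp, map_add, map_sum, map_sum]
  simp only [map_smul, valLin_apply]
  rw [Finset.sum_eq_single F, Finset.sum_eq_zero]
  · have := h.faceDof_faceShape hT hF hF h3 h3
    rw [faceDof] at this
    rw [this]; simp
  · intro e he
    rw [Finset.mem_powersetCard] at he
    have := h.faceDof_edgeShape hT hF he.1 h3 he.2
    rw [faceDof] at this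
    rw [this, smul_zero]
  · intro F' hF' hne
    rw [Finset.mem_powersetCard] at hF'
    have := h.faceDof_faceShape hT hF'.1 hF hF'.2 h3
    rw [faceDof] at this
    rw [this, if_neg hne, smul_zero]
  · exact fun hn => absurd (Finset.mem_powersetCard.mpr ⟨hF, h3⟩) hn

/-- The edge degree of freedom as a linear map. -/
noncomputable def edgeDofLin (e : Finset E3) : P2 →ₗ[ℝ] ℝ where
  toFun p := edgeDof e p
  map_add' p q := edgeValue_add e _ p q
  map_smul' c p := edgeValue_smul e _ c p

theorem edgeDofLin_apply (e : Finset E3) (p : P2) : edgeDofLin e p = edgeDof e p := rfl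

theorem edgeDof_interp (h : IsBary T c g) (hT : T.card = 4) (α β : Finset E3 → ℝ) {e : Finset E3}
    (he : e ⊆ T) (h2 : e.card = 2) : edgeDof e (interp T c g α β) = β e := by
  classical
  rw [← edgeDofLin_apply, interp, map_add, map_sum, map_sum]
  simp only [map_smul, edgeDofLin_apply]
  rw [Finset.sum_eq_zero, Finset.sum_eq_single e]
  · rw [h.edgeDof_edgeShape he he h2 h2]; simp
  · intro e' he' hne
    rw [Finset.mem_powersetCard] at he'
    rw [h.edgeDof_edgeShape he'.1 he he'.2 h2, if_neg hne, smul_zero]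
  · exact fun hn => absurd (Finset.mem_powersetCard.mpr ⟨he, h2⟩) hn
  · intro F hF
    rw [Finset.mem_powersetCard] at hF
    rw [h.edgeDof_faceShape hT hF.1 he hF.2 h2, smul_zero]

/-- There are ten shape functions (four faces, six edges), each with gradient at most `200 / r`. -/
theorem norm_grad_interp_le (h : IsBary T c g) (hT : T.card = 4) {α β : Finset E3 → ℝ} {m : ℝ}
    (hα : ∀ F ⊆ T, F.card = 3 → |α F| ≤ m) (hβ : ∀ e ⊆ T, e.card = 2 → |β e| ≤ m)
    {z : E3} {r : ℝ} (hr : 0 < r) (hb : closedBall z r ⊆ convexHull ℝ (T : Set E3)) {x : E3}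
    (hx : x ∈ convexHull ℝ (T : Set E3)) :
    ‖grad (interp T c g α β) x‖ ≤ 2000 * m / r := by
  rw [← gradLin_apply, interp, map_add, map_sum, map_sum]
  simp only [map_smul, gradLin_apply]
  have h1 : ∀ F ∈ T.powersetCard 3, ‖α F • grad (faceShape T c g F) x‖ ≤ m * (200 / r) := by
    intro F hF
    rw [Finset.mem_powersetCard] at hF
    have hm := hα F hF.1 hF.2
    rw [norm_smul, Real.norm_eq_abs]
    refine mul_le_mul hm ((h.norm_grad_shape_le hT _ _ _ _ _ hF.1 hr hb hx).trans ?_)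
      (norm_nonneg _) ((abs_nonneg _).trans hm)
    gcongr
    norm_num [abs_of_nonneg, abs_of_neg]
  have h2 : ∀ e ∈ T.powersetCard 2, ‖β e • grad (edgeShape T c g e) x‖ ≤ m * (200 / r) := by
    intro F hF
    rw [Finset.mem_powersetCard] at hF
    have hm := hβ F hF.1 hF.2
    rw [norm_smul, Real.norm_eq_abs]
    refine mul_le_mul hm ((h.norm_grad_shape_le hT _ _ _ _ _ hF.1 hr hb hx).trans ?_)
      (norm_nonneg _) ((abs_nonneg _).trans hm)
    gcongr
    norm_num [abs_of_nonneg, abs_of_neg]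
  refine (norm_add_le_of_le (norm_sum_le_of_le _ h1) (norm_sum_le_of_le _ h2)).trans (le_of_eq ?_)
  rw [Finset.sum_const, Finset.sum_const, Finset.card_powersetCard, Finset.card_powersetCard, hT,
    show Nat.choose 4 3 = 4 from rfl, show Nat.choose 4 2 = 6 from rfl]
  simp only [nsmul_eq_mul]
  push_cast
  ring

end IsBary

/-- The constant of the estimate for the correction at the boundary. -/
noncomputable def corrConst (σ : ℝ) : ℝ := 3 * (1 + σ) ^ 2 * (1 + 8 * σ) * (2000 * σ)

/-- The bound of the gradient of `w` near a tetrahedron. -/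
noncomputable def gradBound (σ r : ℝ) (S : Set E3) (w : P2) : ℝ :=
  (1 + 8 * σ) * Real.sqrt (8 / (unitVol * r ^ 3) * ∫ x in S, ‖grad w x‖ ^ 2)

theorem norm_grad_le_gradBound (w : P2) {S : Set E3} (hS : IsCompact S) {z : E3} {r σ : ℝ}
    (hr : 0 < r) (hb : closedBall z r ⊆ S) (hd : 0 < diam S) (hσ : diam S ≤ σ * r) {y : E3}
    (hy : ‖y - z‖ ≤ 2 * diam S) : ‖grad w y‖ ≤ gradBound σ r S w := by
  -- Here `R = 2 * diam S`, so `4 * R / r` is at most `8 * σ`.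
  refine (norm_grad_le_of_closedBall w hS hr (by positivity) hb hy).trans ?_
  unfold gradBound
  gcongr
  rw [div_le_iff₀ hr]; linarith

/-- The point `y`, later a point of Γ, may lie outside `S`; the mean value inequality is therefore
applied in a ball of radius `2 * diam S` around `z`, where `gradBound` still controls the gradient.
-/
theorem abs_val_sub_le_gradBound (w : P2) {S : Set E3} (hS : IsCompact S) {z : E3} {r σ : ℝ}
    (hr : 0 < r) (hb : closedBall z r ⊆ S) (hd : 0 < diam S) (hσ : diam S ≤ σ * r) {x y : E3}
    (hx : x ∈ S) {ε : ℝ} (hε1 : ε ≤ 1) (hy : ‖y - x‖ ≤ ε * diam S) :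
    |val w x - val w y| ≤ ε * diam S * gradBound σ r S w := by
  have hxz : ‖x - z‖ ≤ diam S := by
    rw [← dist_eq_norm]
    exact dist_le_diam_of_mem hS.isBounded hx (hb (mem_closedBall_self hr.le))
  have h1 : x ∈ closedBall z (2 * diam S) := by rw [mem_closedBall, dist_eq_norm]; linarith
  have h2 : y ∈ closedBall z (2 * diam S) := by
    rw [mem_closedBall, dist_eq_norm]
    calc ‖y - z‖ = ‖(y - x) + (x - z)‖ := by congr 1; abel
      _ ≤ ε * diam S + diam S := norm_add_le_of_le hy hxz
      _ ≤ 2 * diam S := by nlinarith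
  have h3 : ∀ u ∈ closedBall z (2 * diam S), ‖grad w u‖ ≤ gradBound σ r S w := by
    intro u hu
    rw [mem_closedBall, dist_eq_norm] at hu
    exact norm_grad_le_gradBound w hS hr hb hd hσ hu
  refine (abs_val_sub_le w (convex_closedBall z _) h3 h2 h1).trans ?_
  rw [norm_sub_rev, mul_comm]
  have : 0 ≤ gradBound σ r S w := (norm_nonneg _).trans (h3 x h1)
  gcongr

/-- A scaling argument: the coefficients are at most `ε D G`, the shape gradients are of order `1 /
r`, the volume is at most of order `D ^ 3`, and `G ^ 2` carries `r ^ (-3)`. With `D ≤ σ r` all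
powers of `r` cancel. -/
theorem IsBary.integral_grad_interp_le {T : Finset E3} {c : E3 → ℝ} {g : E3 → E3}
    (h : IsBary T c g) (hT : T.card = 4) (w : P2) {α β : Finset E3 → ℝ} {z : E3} {r σ ε : ℝ}
    (hr : 0 < r) (hb : closedBall z r ⊆ convexHull ℝ (T : Set E3))
    (hd : 0 < diam (convexHull ℝ (T : Set E3))) (hσ : diam (convexHull ℝ (T : Set E3)) ≤ σ * r)
    (hε : 0 ≤ ε)
    (hα : ∀ F ⊆ T, F.card = 3 → |α F| ≤
      ε * diam (convexHull ℝ (T : Set E3)) * gradBound σ r (convexHull ℝ (T : Set E3)) w)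
    (hβ : ∀ e ⊆ T, e.card = 2 → |β e| ≤
      ε * diam (convexHull ℝ (T : Set E3)) * gradBound σ r (convexHull ℝ (T : Set E3)) w) :
    ∫ x in convexHull ℝ (T : Set E3), ‖grad (interp T c g α β) x‖ ^ 2 ≤
      (corrConst σ * ε) ^ 2 * ∫ x in convexHull ℝ (T : Set E3), ‖grad w x‖ ^ 2 := by
  have hV := unitVol_pos
  have hS := isCompact_convexHull T
  have hK := fun x hx => h.norm_grad_interp_le hT hα hβ hr hb (x := x) hx
  have h1 := integral_norm_grad_sq_le _ hS ⟨z, hb (mem_closedBall_self hr.le)⟩ hK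
  set D := diam (convexHull ℝ (T : Set E3)) with hD
  set I := ∫ x in convexHull ℝ (T : Set E3), ‖grad w x‖ ^ 2 with hI
  have hI0 : 0 ≤ I := integral_nonneg fun x => by positivity
  have hσ0 : 0 < σ := by
    by_contra hn
    nlinarith
  have hG : gradBound σ r (convexHull ℝ (T : Set E3)) w ^ 2 =
      (1 + 8 * σ) ^ 2 * (8 / (unitVol * r ^ 3) * I) := by
    rw [gradBound, mul_pow, Real.sq_sqrt (by positivity)]
  set G := gradBound σ r (convexHull ℝ (T : Set E3)) w
  refine h1.trans ?_
  calc D ^ 3 * unitVol * (2000 * (ε * D * G) / r) ^ 2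
      ≤ (σ * r) ^ 3 * unitVol * (2000 * (ε * (σ * r) * |G|) / r) ^ 2 := by
        have : (2000 * (ε * D * G) / r) ^ 2 = (2000 * (ε * D * |G|) / r) ^ 2 := by
          rw [div_pow, div_pow, mul_pow, mul_pow, mul_pow (2000 : ℝ), mul_pow _ (|G|), sq_abs]
        rw [this]
        gcongr
    _ = σ ^ 3 * r ^ 3 * unitVol * (2000 * ε * σ) ^ 2 * G ^ 2 := by
        rw [← sq_abs G]; field_simp
    _ = (8 * σ ^ 3) * ((1 + 8 * σ) ^ 2 * (2000 * ε * σ) ^ 2 * I) := by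
        rw [hG]; field_simp
    -- The factor `8 σ ^ 3` is rounded up to a perfect square, so that the constant survives the
    -- square root.
    _ ≤ (9 * (1 + σ) ^ 4) * ((1 + 8 * σ) ^ 2 * (2000 * ε * σ) ^ 2 * I) := by
        gcongr ?_ * _
        have : σ ^ 3 ≤ (1 + σ) ^ 3 := by gcongr; linarith
        have : (1 + σ) ^ 3 ≤ (1 + σ) ^ 4 := by
          apply pow_le_pow_right₀ <;> [linarith; norm_num]
        have : 0 ≤ σ ^ 3 := by positivity
        linarith
    _ = _ := by rw [corrConst]; ring

end CurvedFEM
-- Almost flat boundaries and plane geometry across an edge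
namespace CurvedFEM

open Metric

/-- On `U` the set `Ω` is the negativity set of the function `ψ`, which differs from the linear
function `⟪n, ·⟫` by a function with Lipschitz constant `η`. -/
structure IsFlatOn (Ω U : Set E3) (η : ℝ) (n : E3) (ψ : E3 → ℝ) : Prop where
  norm_eq : ‖n‖ = 1
  sub_le : ∀ y ∈ U, ∀ z ∈ U, |ψ y - ψ z - ⟪n, y - z⟫| ≤ η * ‖y - z‖
  mem_iff : ∀ y ∈ U, y ∈ Ω ↔ ψ y < 0

namespace IsFlatOn

variable {Ω U : Set E3} {η : ℝ} {n : E3} {ψ : E3 → ℝ}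

theorem mono (h : IsFlatOn Ω U η n ψ) {V : Set E3} (hV : V ⊆ U) : IsFlatOn Ω V η n ψ :=
  ⟨h.norm_eq, fun y hy z hz => h.sub_le y (hV hy) z (hV hz), fun y hy => h.mem_iff y (hV hy)⟩

theorem continuousOn (h : IsFlatOn Ω U η n ψ) : ContinuousOn ψ U := by
  refine LipschitzOnWith.continuousOn (K := Real.toNNReal (1 + η)) ?_
  refine LipschitzOnWith.of_dist_le_mul fun y hy z hz => ?_
  rw [Real.dist_eq, dist_eq_norm]
  have h1 := abs_le.mp (h.sub_le y hy z hz)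
  have h2 := abs_le.mp (abs_real_inner_le_norm n (y - z))
  rw [h.norm_eq, one_mul] at h2
  have h3 : |ψ y - ψ z| ≤ (1 + η) * ‖y - z‖ := abs_le.mpr ⟨by linarith, by linarith⟩
  refine h3.trans ?_
  gcongr
  exact Real.le_coe_toNNReal _

theorem nonpos_of_mem_closure (h : IsFlatOn Ω U η n ψ) (hU : IsOpen U) {y : E3} (hy : y ∈ U)
    (hc : y ∈ closure Ω) : ψ y ≤ 0 := by
  by_contra! hn
  have h1 := h.continuousOn.isOpen_inter_preimage hU isOpen_Ioi (t := Set.Ioi 0)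
  obtain ⟨x, ⟨hxU, hx⟩, hxΩ⟩ := mem_closure_iff.mp hc _ h1 ⟨hy, hn⟩
  have := (h.mem_iff x hxU).mp hxΩ
  have hx' : 0 < ψ x := hx
  linarith

theorem eq_zero_of_mem_frontier (h : IsFlatOn Ω U η n ψ) (hU : IsOpen U) (hΩ : IsOpen Ω) {y : E3}
    (hy : y ∈ U) (hf : y ∈ frontier Ω) : ψ y = 0 := by
  rw [hΩ.frontier_eq] at hf
  refine le_antisymm (h.nonpos_of_mem_closure hU hy hf.1) ?_
  by_contra! hn
  exact hf.2 ((h.mem_iff y hy).mpr hn)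

/-- Because `η < 1`, `ψ` becomes negative when one moves from a zero along `-n`, so the zero is a
limit of points of `Ω`; it is not in `Ω` itself. -/
theorem mem_frontier (h : IsFlatOn Ω U η n ψ) (hU : IsOpen U) (hΩ : IsOpen Ω) (hη : η < 1) {y : E3}
    (hy : y ∈ U) (h0 : ψ y = 0) : y ∈ frontier Ω := by
  rw [hΩ.frontier_eq]
  refine ⟨?_, fun hc => by rw [h.mem_iff y hy, h0] at hc; exact lt_irrefl _ hc⟩
  have ht : Filter.Tendsto (fun s : ℝ => y - s • n) (nhdsWithin 0 (Set.Ioi 0)) (nhds y) := by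
    have : Filter.Tendsto (fun s : ℝ => y - s • n) (nhds 0) (nhds (y - (0 : ℝ) • n)) :=
      Continuous.tendsto (by fun_prop) 0
    rw [zero_smul, sub_zero] at this
    exact this.mono_left nhdsWithin_le_nhds
  refine mem_closure_of_tendsto ht ?_
  filter_upwards [ht.eventually (hU.mem_nhds hy), self_mem_nhdsWithin] with s hs hs0
  have hs0' : 0 < s := hs0
  rw [h.mem_iff _ hs]
  have h1 := (abs_le.mp (h.sub_le _ hs y hy)).2
  rw [h0, show y - s • n - y = -(s • n) by abel, inner_neg_right, norm_neg, inner_smul_right,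
    real_inner_self_eq_norm_sq, norm_smul, h.norm_eq, Real.norm_of_nonneg hs0'.le] at h1
  nlinarith

/-- A line that crosses the boundary transversally meets it near a point where `ψ` is small. -/
theorem exists_zero (h : IsFlatOn Ω U η n ψ) {G m : E3} (hm : ‖m‖ = 1) {c₀ μ t : ℝ}
    (hc : c₀ ≤ |⟪n, m⟫|) (hG : |ψ G| ≤ μ) (ht : 0 ≤ t) (hμ : μ ≤ t * (c₀ - η))
    (hU : ∀ s : ℝ, |s| ≤ t → G + s • m ∈ U) : ∃ s : ℝ, |s| ≤ t ∧ ψ (G + s • m) = 0 := by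
  have hGU : G ∈ U := by simpa using hU 0 (by simpa using ht)
  have hcont : ContinuousOn (fun s : ℝ => ψ (G + s • m)) (Set.uIcc (-t) t) := by
    refine h.continuousOn.comp (by fun_prop) fun s hs => hU s ?_
    rw [Set.uIcc_of_le (by linarith)] at hs
    exact abs_le.mpr hs
  have key : ∀ s : ℝ, |s| = t → |ψ (G + s • m) - ψ G - s * ⟪n, m⟫| ≤ η * t := by
    intro s hs
    have := h.sub_le _ (hU s hs.le) G hGU
    rwa [add_sub_cancel_left, inner_smul_right, norm_smul, hm, mul_one, Real.norm_eq_abs, hs]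
      at this
  have h1 := abs_le.mp (key t (abs_of_nonneg ht))
  have h2 := abs_le.mp (key (-t) (by rw [abs_neg, abs_of_nonneg ht]))
  have hG' := abs_le.mp hG
  -- At `s = ± t` the linear part has modulus at least `c₀ t`, which dominates the value at `G` and
  -- the error `η t`; the two end values have opposite signs in the weak sense.
  have h0 : (0 : ℝ) ∈ Set.uIcc (ψ (G + (-t) • m)) (ψ (G + t • m)) := by
    rw [Set.mem_uIcc]
    rcases le_abs'.mp hc with hc' | hc'
    · right
      constructor <;> nlinarith
    · left
      constructor <;> nlinarith
  obtain ⟨s, hs, hs0⟩ := intermediate_value_uIcc hcont h0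
  rw [Set.uIcc_of_le (by linarith)] at hs
  exact ⟨s, abs_le.mpr hs, hs0⟩

end IsFlatOn

/-- A C¹ function is strictly differentiable, and the strict form compares any two nearby points, as
a Lipschitz bound on the remainder requires. Dividing by the norm of the gradient makes `n` a unit
vector. -/
theorem exists_isFlatOn_nhds {Ω : Set E3} (hΩ : IsC1Domain Ω) {η : ℝ} (hη : 0 < η) {x : E3}
    (hx : x ∈ frontier Ω) :
    ∃ U : Set E3, IsOpen U ∧ x ∈ U ∧ ∃ n ψ, IsFlatOn Ω U η n ψ := by
  obtain ⟨U, hU, hxU, φ, hφ, hd, hΩU⟩ := hΩ.2 x hx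
  have hs : HasStrictFDerivAt φ (fderiv ℝ φ x) x :=
    (hφ.contDiffAt (hU.mem_nhds hxU)).hasStrictFDerivAt one_ne_zero
  set v : E3 := (InnerProductSpace.toDual ℝ E3).symm (fderiv ℝ φ x) with hv
  have hv0 : 0 < ‖v‖ := by
    rw [norm_pos_iff, hv]
    exact fun h0 => hd (by simpa using h0)
  have hin : ∀ u : E3, fderiv ℝ φ x u = ⟪v, u⟫ := fun u => by
    rw [hv, InnerProductSpace.toDual_symm_apply]
  have h1 := hs.isLittleO.def (c := η * ‖v‖) (by positivity)
  obtain ⟨ε, hε, h2⟩ := Metric.eventually_nhds_iff_ball.mp h1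
  refine ⟨U ∩ ball x ε, hU.inter isOpen_ball, ⟨hxU, mem_ball_self hε⟩, ‖v‖⁻¹ • v,
    fun y => ‖v‖⁻¹ * φ y, ?_, ?_, ?_⟩
  · rw [norm_smul, norm_inv, norm_norm, inv_mul_cancel₀ hv0.ne']
  · intro y hy z hz
    have h3 := h2 (y, z) (by
      rw [← ball_prod_same]
      exact ⟨hy.2, hz.2⟩)
    simp only [hin, Real.norm_eq_abs] at h3
    rw [real_inner_smul_left, ← mul_sub, ← mul_sub, abs_mul, abs_of_nonneg (by positivity),
      inv_mul_le_iff₀ hv0]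
    linarith
  · intro y hy
    have h3 : y ∈ Ω ↔ y ∈ Ω ∩ U := ⟨fun h => ⟨h, hy.1⟩, fun h => h.1⟩
    rw [h3, hΩU]
    have h4 : ‖v‖⁻¹ * φ y < 0 ↔ φ y < 0 := by
      rw [inv_mul_lt_iff₀ hv0, mul_zero]
    rw [h4]
    exact ⟨fun h => h.2, fun h => ⟨hy.1, h⟩⟩

/-- A Lebesgue number of a cover of the compact frontier provides one radius for all boundary
points; the threshold on the mesh size comes from it. -/
theorem exists_isFlatOn {Ω : Set E3} (hΩ : IsC1Domain Ω) (hb : Bornology.IsBounded Ω) {η : ℝ}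
    (hη : 0 < η) :
    ∃ ρ : ℝ, 0 < ρ ∧ ∀ x ∈ frontier Ω, ∃ n ψ, IsFlatOn Ω (ball x ρ) η n ψ := by
  have hc : IsCompact (frontier Ω) :=
    Metric.isCompact_of_isClosed_isBounded isClosed_frontier
      (hb.closure.subset frontier_subset_closure)
  choose U hU hxU n ψ hf using fun x : frontier Ω => exists_isFlatOn_nhds hΩ hη x.2
  obtain ⟨ρ, hρ, h⟩ := lebesgue_number_lemma_of_metric hc hU
    (fun x hx => Set.mem_iUnion.mpr ⟨⟨x, hx⟩, hxU ⟨x, hx⟩⟩)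
  refine ⟨ρ, hρ, fun x hx => ?_⟩
  obtain ⟨i, hi⟩ := h x hx
  exact ⟨n i, ψ i, (hf i).mono hi⟩

/-- Completing the edge direction `b` and a conormal `t` to an orthonormal frame reduces vectors
orthogonal to the edge to two coordinates. -/
theorem exists_orthonormal_third {b t : E3} (hb : ‖b‖ = 1) (ht : ‖t‖ = 1) (hbt : ⟪b, t⟫ = 0) :
    ∃ ν : E3, ∀ u v : E3, ⟪u, v⟫ = ⟪b, u⟫ * ⟪b, v⟫ + ⟪t, u⟫ * ⟪t, v⟫ + ⟪ν, u⟫ * ⟪ν, v⟫ := by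
  have ho : Orthonormal ℝ (({0, 1} : Set (Fin 3)).domRestrict ![b, t, 0]) := by
    constructor
    · rintro ⟨i, rfl | rfl⟩ <;> simp [hb, ht]
    · rintro ⟨i, rfl | rfl⟩ ⟨j, rfl | rfl⟩ hij
      · simp at hij
      · simpa using hbt
      · simpa [real_inner_comm] using hbt
      · simp at hij
  obtain ⟨B, hB⟩ := ho.exists_orthonormalBasis_extension_of_card_eq (by simp)
  have h0 : B 0 = b := hB 0 (by simp)
  have h1 : B 1 = t := hB 1 (by simp)
  refine ⟨B 2, fun u v => ?_⟩
  rw [← B.sum_inner_mul_inner u v, Fin.sum_univ_three, h0, h1]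
  simp only [real_inner_comm]

/-- Unit vectors `t`, `t'` orthogonal to a unit vector `b`, all nearly orthogonal to `n`, are nearly
parallel. -/
theorem nearly_parallel_aux {n₀ n₁ n₂ p q δ : ℝ} (hn : n₀ * n₀ + n₁ * n₁ + n₂ * n₂ = 1)
    (hp : p * p + q * q = 1) (h0 : |n₀| ≤ δ) (h1 : |n₁| ≤ δ) (h2 : |p * n₁ + q * n₂| ≤ δ)
    (hδ : δ ≤ 1 / 16) : 1 / 2 ≤ |n₂| ∧ |q| ≤ 4 * δ := by
  have hδ0 : 0 ≤ δ := (abs_nonneg _).trans h0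
  have e0 : n₀ * n₀ ≤ δ * δ := abs_le_iff_mul_self_le.mp (h0.trans (le_abs_self δ))
  have e1 : n₁ * n₁ ≤ δ * δ := abs_le_iff_mul_self_le.mp (h1.trans (le_abs_self δ))
  -- In the frame `b, t, ν` the data are `n = (n₀, n₁, n₂)` and `t' = (0, p, q)`. Two small
  -- components of `n` leave `n₂` large, and then a small `⟪n, t'⟫` forces `q` to be small.
  have h3 : 1 / 2 ≤ |n₂| := by
    by_contra! hc
    have : n₂ * n₂ = |n₂| * |n₂| := (abs_mul_abs_self n₂).symm
    nlinarith [abs_nonneg n₂]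
  refine ⟨h3, ?_⟩
  have hp1 : |p| ≤ 1 := by
    rw [← abs_one]; apply abs_le_iff_mul_self_le.mpr; nlinarith [mul_self_nonneg q]
  have h4 : |q * n₂| ≤ 2 * δ := by
    have e2 : |p * n₁| ≤ 1 * δ := by rw [abs_mul]; gcongr
    have : q * n₂ = (p * n₁ + q * n₂) - p * n₁ := by ring
    rw [this]
    refine (abs_sub _ _).trans ?_
    linarith
  rw [abs_mul] at h4
  nlinarith [abs_nonneg q]

/-- Since `t'` has no component along `b`, the vector `t' - ⟪t, t'⟫ • t` is its component along the
third frame vector. -/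
theorem nearly_parallel {n b t t' : E3} {δ : ℝ} (hn : ‖n‖ = 1) (hb : ‖b‖ = 1) (ht : ‖t‖ = 1)
    (ht' : ‖t'‖ = 1) (hbt : ⟪b, t⟫ = 0) (hbt' : ⟪b, t'⟫ = 0) (hnb : |⟪n, b⟫| ≤ δ)
    (hnt : |⟪n, t⟫| ≤ δ) (hnt' : |⟪n, t'⟫| ≤ δ) (hδ : δ ≤ 1 / 16) :
    ‖t' - ⟪t, t'⟫ • t‖ ≤ 4 * δ := by
  obtain ⟨ν, hν⟩ := exists_orthonormal_third hb ht hbt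
  have hnn := hν n n
  have htt := hν t' t'
  have hnt2 := hν t' n
  rw [real_inner_self_eq_norm_sq, hn] at hnn
  rw [real_inner_self_eq_norm_sq, ht', hbt'] at htt
  rw [hbt', real_inner_comm] at hnt2
  rw [hnt2] at hnt'
  rw [real_inner_comm] at hnb hnt
  have h1 := (nearly_parallel_aux (n₀ := ⟪b, n⟫) (n₁ := ⟪t, n⟫) (n₂ := ⟪ν, n⟫) (p := ⟪t, t'⟫)
    (q := ⟪ν, t'⟫) (by linarith) (by linarith) hnb hnt (by convert hnt' using 2; ring) hδ).2
  have h2 : ‖t' - ⟪t, t'⟫ • t‖ ^ 2 = ⟪ν, t'⟫ ^ 2 := by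
    rw [← real_inner_self_eq_norm_sq, inner_sub_left, inner_sub_right, inner_sub_right,
      inner_smul_left, inner_smul_right, inner_smul_right, inner_smul_left,
      real_inner_self_eq_norm_sq, real_inner_self_eq_norm_sq, ht, ht', real_inner_comm t t']
    simp only [conj_trivial]
    linarith
  rw [← abs_of_nonneg (norm_nonneg (t' - ⟪t, t'⟫ • t))]
  rwa [(sq_eq_sq_iff_abs_eq_abs _ _).mp h2]

/-- In the coordinates along `t` and `ν`, `d = (x, y)`, `t' = (p, q)` and `t - t' = (1 - p, -q)`,
where `1 - p > 1` and `q` is small. The angle condition thus keeps `|x|` away from 1, which leaves a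
definite `y`; and `n` is nearly `± ν`. -/
theorem abs_skin_aux {n₁ n₂ p q x y δ κ N : ℝ} (hxy : x * x + y * y = 1)
    (h1 : 1 / 2 ≤ |n₂|) (h2 : |q| ≤ 4 * δ) (hn₁ : |n₁| ≤ δ) (hκ0 : 0 ≤ κ) (hκ : κ < 1)
    (hδ : δ ≤ (1 - κ) / 16) (hp : p < 0) (hN : N ≤ (1 - p) + |q|)
    (hdt : |x - (x * p + y * q)| ≤ κ * N) : (1 - κ) / 8 ≤ |n₁ * x + n₂ * y| := by
  have hq := abs_nonneg q
  have hy1 : |y| ≤ 1 := by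
    rw [← abs_one]; apply abs_le_iff_mul_self_le.mpr; linarith [mul_self_nonneg x]
  have hx1 : |x| ≤ 1 := by
    rw [← abs_one]; apply abs_le_iff_mul_self_le.mpr; linarith [mul_self_nonneg y]
  have h4 : |x| * (1 - p) ≤ κ * ((1 - p) + |q|) + 1 * |q| := by
    have e1 : x * (1 - p) = (x - (x * p + y * q)) + y * q := by ring
    have e2 : |x * (1 - p)| = |x| * (1 - p) := by
      rw [abs_mul, abs_of_nonneg (by linarith : 0 ≤ 1 - p)]
    rw [← e2, e1]
    refine (abs_add_le _ _).trans (add_le_add (hdt.trans (by gcongr)) ?_)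
    rw [abs_mul]; gcongr
  have h5 : |x| ≤ (1 + κ) / 2 := by
    refine le_of_mul_le_mul_right (a := 1 - p) (h4.trans ?_) (by linarith)
    have e1 : κ * |q| ≤ 1 * |q| := by gcongr
    have e2 : 0 ≤ (1 - κ) / 2 * (-p) := by apply mul_nonneg <;> linarith
    linarith
  -- From `|y| ≥ y² = 1 - x² ≥ 1 - |x|`.
  have h6 : (1 - κ) / 2 ≤ |y| := by
    have e1 : y * y = |y| * |y| := (abs_mul_abs_self y).symm
    have e2 : x * x = |x| * |x| := (abs_mul_abs_self x).symm
    have e3 : |y| * |y| ≤ 1 * |y| := by gcongr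
    have e4 : |x| * |x| ≤ 1 * |x| := by gcongr
    linarith
  have h7 : |n₂ * y| ≤ |n₁ * x + n₂ * y| + |n₁ * x| := by
    have : n₂ * y = (n₁ * x + n₂ * y) - n₁ * x := by ring
    rw [this]
    refine (abs_sub _ _).trans (le_of_eq ?_)
    rw [← this]
  have h8 : |n₁ * x| ≤ δ * 1 := by
    rw [abs_mul]; gcongr; exact (abs_nonneg _).trans hn₁
  rw [abs_mul n₂] at h7
  have h9 : 1 / 2 * ((1 - κ) / 2) ≤ |n₂| * |y| := by
    apply mul_le_mul h1 h6 <;> [linarith; exact abs_nonneg _]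
  linarith

theorem abs_inner_skin_ge {n b t t' d : E3} {δ κ : ℝ} (hn : ‖n‖ = 1) (hb : ‖b‖ = 1) (ht : ‖t‖ = 1)
    (ht' : ‖t'‖ = 1) (hd : ‖d‖ = 1) (hbt : ⟪b, t⟫ = 0) (hbt' : ⟪b, t'⟫ = 0) (hbd : ⟪b, d⟫ = 0)
    (hnb : |⟪n, b⟫| ≤ δ) (hnt : |⟪n, t⟫| ≤ δ) (hnt' : |⟪n, t'⟫| ≤ δ) (hκ0 : 0 ≤ κ) (hκ : κ < 1)
    (hδ : δ ≤ (1 - κ) / 16) (htt' : ⟪t, t'⟫ < 0) (hdt : |⟪d, t - t'⟫| ≤ κ * ‖t - t'‖) :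
    (1 - κ) / 8 ≤ |⟪n, d⟫| := by
  obtain ⟨ν, hν⟩ := exists_orthonormal_third hb ht hbt
  have hnn := hν n n
  have htt := hν t' t'
  have hdd := hν d d
  have hnt2 := hν t' n
  have hnd := hν n d
  have hdt2 := hν d t'
  rw [real_inner_self_eq_norm_sq, hn] at hnn
  rw [real_inner_self_eq_norm_sq, ht', hbt'] at htt
  rw [real_inner_self_eq_norm_sq, hd, hbd] at hdd
  rw [hbt', real_inner_comm] at hnt2
  rw [hbd] at hnd
  rw [hbd] at hdt2
  rw [hnt2] at hnt'
  rw [real_inner_comm] at hnb hnt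
  obtain ⟨h1, h2⟩ := nearly_parallel_aux (n₀ := ⟪b, n⟫) (n₁ := ⟪t, n⟫) (n₂ := ⟪ν, n⟫)
    (p := ⟪t, t'⟫) (q := ⟪ν, t'⟫) (by linarith) (by linarith) hnb hnt
    (by convert hnt' using 2; ring) (by linarith)
  have h3 : ‖t - t'‖ ≤ (1 - ⟪t, t'⟫) + |⟪ν, t'⟫| := by
    have hq := abs_nonneg ⟪ν, t'⟫
    refine (sq_le_sq₀ (norm_nonneg _) (by linarith)).mp ?_
    rw [← real_inner_self_eq_norm_sq, inner_sub_left, inner_sub_right, inner_sub_right,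
      real_inner_self_eq_norm_sq, real_inner_self_eq_norm_sq, ht, ht', real_inner_comm t t']
    have e1 : 0 ≤ (1 - ⟪t, t'⟫) * |⟪ν, t'⟫| := mul_nonneg (by linarith) hq
    have e2 : |⟪ν, t'⟫| ^ 2 = ⟪ν, t'⟫ * ⟪ν, t'⟫ := by rw [sq_abs, sq]
    rw [add_sq, e2]
    linarith
  rw [inner_sub_right, hdt2, real_inner_comm t d, zero_mul, zero_add] at hdt
  have := abs_skin_aux (by linarith) h1 h2 hnt hκ0 hκ hδ htt' h3 hdt
  rwa [hnd, mul_zero, zero_add]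

/-- Here `m = γ ν`, `m' = α t + β ν` and `t' = p t + q ν`, up to components along `b` that vanish.
The signs force `n₂ * β > 0`, and orthogonality of `m'` and `t'` gives `|α| ≤ |β| / 2`; hence `n₂ *
β` dominates `⟪n, m'⟫`, which cannot be negative. -/
theorem not_folded_aux {n₁ n₂ p q α β γ δ : ℝ} (hpq : p * p + q * q = 1) (hp : 0 ≤ p)
    (h1 : 1 / 2 ≤ |n₂|) (h2 : |q| ≤ 4 * δ) (hn₁ : |n₁| ≤ δ) (hδ : δ ≤ 1 / 16) (e1 : γ * q < 0)
    (hα : α < 0) (e2 : n₂ * γ < 0) (e3 : n₁ * α + n₂ * β < 0) (e4 : p * α + q * β = 0) : False := by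
  have hq : |q| ≤ 1 / 4 := by linarith
  have hp2 : 1 / 2 < p := by
    by_contra! hc
    have e5 : q * q = |q| * |q| := (abs_mul_abs_self q).symm
    have e6 : |q| * |q| ≤ 1 / 4 * (1 / 4) := by gcongr
    have e7 : p * p ≤ 1 / 2 * (1 / 2) := by gcongr
    linarith
  have e5 : 0 < q * n₂ := by
    have h7 : 0 < γ ^ 2 * (q * n₂) := by
      have := mul_pos_of_neg_of_neg e1 e2
      exact lt_of_lt_of_eq this (by ring)
    exact pos_of_mul_pos_right h7 (sq_nonneg γ)
  have e6 : 0 < q * β := by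
    have := mul_neg_of_pos_of_neg (by linarith : 0 < p) hα
    linarith
  have e7 : 0 < n₂ * β := by
    have h7 : 0 < q ^ 2 * (n₂ * β) := by
      have := mul_pos e5 e6
      exact lt_of_lt_of_eq this (by ring)
    exact pos_of_mul_pos_right h7 (sq_nonneg q)
  have e8 : |α| ≤ |β| / 2 := by
    have h7 : |p * α| = |q * β| := by
      rw [show p * α = -(q * β) by linarith, abs_neg]
    rw [abs_mul, abs_mul, abs_of_nonneg hp] at h7
    have h8 : 1 / 2 * |α| ≤ p * |α| := by gcongr
    have h9 : |q| * |β| ≤ 1 / 4 * |β| := by gcongr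
    linarith
  have e9 : n₂ * β = |n₂| * |β| := by rw [← abs_mul, abs_of_pos e7]
  have e10 : -(|n₁| * |α|) ≤ n₁ * α := by rw [← abs_mul]; exact neg_abs_le _
  have e11 : 0 < |β| := by
    rw [abs_pos]; rintro rfl; simp at e7
  have e12 : |n₁| * |α| ≤ 1 / 16 * (|β| / 2) := by
    apply mul_le_mul (by linarith) e8 (abs_nonneg _) (by norm_num)
  have e13 : 1 / 2 * |β| ≤ |n₂| * |β| := by gcongr
  linarith

/-- Two conormals `t`, `t'` of faces on the boundary cannot point to the same side if the
tetrahedra with these faces lie on the same side of the boundary. -/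
theorem not_folded {n b t t' m m' : E3} {δ : ℝ} (hn : ‖n‖ = 1) (hb : ‖b‖ = 1) (ht : ‖t‖ = 1)
    (ht' : ‖t'‖ = 1) (hbt : ⟪b, t⟫ = 0) (hbt' : ⟪b, t'⟫ = 0) (hnb : |⟪n, b⟫| ≤ δ)
    (hnt : |⟪n, t⟫| ≤ δ) (hnt' : |⟪n, t'⟫| ≤ δ) (hδ : δ ≤ 1 / 16) (hbm : ⟪b, m⟫ = 0)
    (hbm' : ⟪b, m'⟫ = 0) (htm : ⟪t, m⟫ = 0) (htm' : ⟪t', m'⟫ = 0) (h1 : ⟪m, t'⟫ < 0)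
    (h2 : ⟪m', t⟫ < 0) (h3 : ⟪n, m⟫ < 0) (h4 : ⟪n, m'⟫ < 0) : ⟪t, t'⟫ < 0 := by
  by_contra! hp
  obtain ⟨ν, hν⟩ := exists_orthonormal_third hb ht hbt
  have hnn := hν n n
  have htt := hν t' t'
  have hnt2 := hν t' n
  rw [real_inner_self_eq_norm_sq, hn] at hnn
  rw [real_inner_self_eq_norm_sq, ht', hbt'] at htt
  rw [hbt', real_inner_comm] at hnt2
  rw [hnt2] at hnt'
  rw [real_inner_comm] at hnb hnt
  obtain ⟨h5, h6⟩ := nearly_parallel_aux (n₀ := ⟪b, n⟫) (n₁ := ⟪t, n⟫) (n₂ := ⟪ν, n⟫)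
    (p := ⟪t, t'⟫) (q := ⟪ν, t'⟫) (by linarith) (by linarith) hnb hnt
    (by convert hnt' using 2; ring) hδ
  rw [hν m t', hbm, htm] at h1
  rw [real_inner_comm] at h2
  rw [hν n m, hbm, htm] at h3
  rw [hν n m', hbm'] at h4
  rw [hν t' m', hbm', hbt'] at htm'
  exact not_folded_aux (by linarith) hp h5 h6 hnt hδ (γ := ⟪ν, m⟫) (by linarith) h2 (by linarith)
    (by linarith : ⟪t, n⟫ * ⟪t, m'⟫ + ⟪ν, n⟫ * ⟪ν, m'⟫ < 0) (by linarith)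

end CurvedFEM
-- Regular tetrahedra at a boundary edge
namespace CurvedFEM

open Metric

/-- `T` is a tetrahedron with barycentric coordinates given by `c` and `g` which contains the ball
of centre `z` and radius `r` and whose diameter is at most `σ r`. -/
structure RegTet (T : Finset E3) (c : E3 → ℝ) (g : E3 → E3) (z : E3) (r σ : ℝ) : Prop where
  bary : IsBary T c g
  card : T.card = 4
  rpos : 0 < r
  ball : closedBall z r ⊆ convexHull ℝ (T : Set E3)
  diam_le : diam (convexHull ℝ (T : Set E3)) ≤ σ * r

theorem norm_sub_le_diam {T : Finset E3} {x y : E3} (hx : x ∈ convexHull ℝ (T : Set E3))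
    (hy : y ∈ convexHull ℝ (T : Set E3)) : ‖x - y‖ ≤ diam (convexHull ℝ (T : Set E3)) := by
  rw [← dist_eq_norm]
  exact dist_le_diam_of_mem (isCompact_convexHull T).isBounded hx hy

theorem mem_convexHull_of_mem {T : Finset E3} {x : E3} (hx : x ∈ T) :
    x ∈ convexHull ℝ (T : Set E3) := subset_convexHull ℝ _ hx

namespace RegTet

variable {T : Finset E3} {c : E3 → ℝ} {g : E3 → E3} {z : E3} {r σ : ℝ}

theorem norm_sub_le (_h : RegTet T c g z r σ) {a b : E3} (ha : a ∈ T) (hb : b ∈ T) :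
    ‖a - b‖ ≤ diam (convexHull ℝ (T : Set E3)) :=
  norm_sub_le_diam (mem_convexHull_of_mem ha) (mem_convexHull_of_mem hb)

theorem r_le_diam (h : RegTet T c g z r σ) : r ≤ diam (convexHull ℝ (T : Set E3)) := by
  obtain ⟨a, ha, b, hb, hab⟩ := Finset.one_lt_card.mp (by rw [h.card]; norm_num : 1 < T.card)
  exact (h.bary.le_dist h.rpos h.ball ha hb hab).trans (h.norm_sub_le ha hb)

theorem diam_pos (h : RegTet T c g z r σ) : 0 < diam (convexHull ℝ (T : Set E3)) :=
  h.rpos.trans_le h.r_le_diam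

theorem one_le (h : RegTet T c g z r σ) : 1 ≤ σ := by
  have h1 := h.r_le_diam.trans h.diam_le
  have h2 := h.rpos
  by_contra! hc
  nlinarith

/-- A vector parallel to the face opposite to `E` is nearly orthogonal to `n` if the vertices of this
face are nearly in a plane orthogonal to `n`. -/
theorem abs_inner_parallel_le (h : RegTet T c g z r σ) {n A E u : E3} {η : ℝ} (hη : 0 ≤ η)
    (hA : ∀ x ∈ T, x ≠ E → |⟪n, x - A⟫| ≤ η * diam (convexHull ℝ (T : Set E3)))
    (hu : ⟪g E, u⟫ = 0) : |⟪n, u⟫| ≤ 4 * σ * η * ‖u‖ := by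
  -- Subtracting `A` is free because the gradients sum to zero; the term of `E`, the only vertex
  -- possibly far from the plane, drops out.
  have h1 : u = ∑ a ∈ T, ⟪g a, u⟫ • (a - A) := by
    simp_rw [smul_sub]
    rw [Finset.sum_sub_distrib, h.bary.sum_inner_smul, ← Finset.sum_smul, ← sum_inner,
      h.bary.sum_grad, inner_zero_left, zero_smul, sub_zero]
  have h2 : ⟪n, u⟫ = ∑ a ∈ T, ⟪g a, u⟫ * ⟪n, a - A⟫ := by
    conv_lhs => rw [h1]
    rw [inner_sum]
    simp_rw [inner_smul_right]
  have h3 : ∀ a ∈ T, |⟪g a, u⟫ * ⟪n, a - A⟫| ≤ σ * η * ‖u‖ := by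
    intro a ha
    have hσ := h.one_le
    by_cases haE : a = E
    · rw [haE, hu, zero_mul, abs_zero]; positivity
    · have hr := h.rpos
      rw [abs_mul]
      have e1 : |⟪g a, u⟫| ≤ 1 / r * ‖u‖ := (abs_real_inner_le_norm _ _).trans (by
        gcongr; exact h.bary.norm_grad_le h.rpos h.ball ha)
      calc _ ≤ 1 / r * ‖u‖ * (η * (σ * r)) := by
            gcongr
            exact (hA a ha haE).trans (by gcongr; exact h.diam_le)
        _ = σ * η * ‖u‖ := by field_simp
  rw [h2]
  refine (Finset.abs_sum_le_sum_abs _ _).trans ((Finset.sum_le_sum h3).trans (le_of_eq ?_))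
  rw [Finset.sum_const, h.card, nsmul_eq_mul]; push_cast; ring

end RegTet

/-- The component `u` of `n` orthogonal to `m` satisfies `‖u‖² = ⟪n, u⟫ ≤ δ ‖u‖`, so it has norm at
most 1/2 and most of `n` is along `m`. -/
theorem abs_inner_normal_ge {n m : E3} {δ : ℝ} (hn : ‖n‖ = 1) (hm : m ≠ 0)
    (h : ∀ u, ⟪m, u⟫ = 0 → |⟪n, u⟫| ≤ δ * ‖u‖) (hδ : δ ≤ 1 / 2) : ‖m‖ / 2 ≤ |⟪n, m⟫| := by
  have hm0 : 0 < ‖m‖ := norm_pos_iff.mpr hm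
  set q := ⟪n, m⟫ with hq
  set u := n - (q / ‖m‖ ^ 2) • m with hu
  have h1 : ⟪m, u⟫ = 0 := by
    rw [hu, inner_sub_right, inner_smul_right, real_inner_self_eq_norm_sq, real_inner_comm, ← hq]
    field_simp; ring
  have h2 : ⟪n, u⟫ = 1 - q ^ 2 / ‖m‖ ^ 2 := by
    rw [hu, inner_sub_right, inner_smul_right, real_inner_self_eq_norm_sq, hn, ← hq]
    ring
  have h3 : ‖u‖ ^ 2 = ⟪n, u⟫ := by
    rw [← real_inner_self_eq_norm_sq]
    conv_lhs => rw [hu, inner_sub_left, inner_smul_left, ← hu, h1]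
    simp
  have h4 : ‖u‖ ≤ 1 / 2 := by
    have h5 := (le_abs_self _).trans (h u h1)
    by_contra! hc
    nlinarith
  have h5 : 1 - q ^ 2 / ‖m‖ ^ 2 ≤ 1 / 4 := by
    rw [← h2, ← h3]; nlinarith [norm_nonneg u]
  have h6 : 3 / 4 * ‖m‖ ^ 2 ≤ q ^ 2 := by
    rw [← le_div_iff₀ (by positivity)]; linarith
  by_contra! hc
  have := abs_nonneg q
  nlinarith [sq_abs q]

/-- The edge `e = AB` of the face `F = ABC` of the tetrahedron `T = ABCE`. -/
structure Corner (T F e : Finset E3) (A B C E : E3) : Prop where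
  mem_e : ∀ x, x ∈ e ↔ x = A ∨ x = B
  mem_F : ∀ x, x ∈ F ↔ x = A ∨ x = B ∨ x = C
  mem_T : ∀ x, x ∈ T ↔ x = A ∨ x = B ∨ x = C ∨ x = E
  AB : A ≠ B
  AC : A ≠ C
  BC : B ≠ C
  AE : A ≠ E
  BE : B ≠ E
  CE : C ≠ E

theorem exists_corner {T F e : Finset E3} (hT : T.card = 4) (hF : F.card = 3) (hFT : F ⊆ T)
    (heF : e ⊆ F) {A B : E3} (hAB : A ≠ B) (he : ∀ x, x ∈ e ↔ x = A ∨ x = B)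
    (he2 : e.card = 2) : ∃ C E, Corner T F e A B C E := by
  classical
  have h1 : (F \ e).card = 1 := by rw [Finset.card_sdiff_of_subset heF, hF, he2]
  have h2 : (T \ F).card = 1 := by rw [Finset.card_sdiff_of_subset hFT, hF, hT]
  obtain ⟨C, hC⟩ := Finset.card_eq_one.mp h1
  obtain ⟨E, hE⟩ := Finset.card_eq_one.mp h2
  have hC' : ∀ x, (x ∈ F ∧ x ∉ e) ↔ x = C := fun x => by
    rw [← Finset.mem_sdiff, hC, Finset.mem_singleton]
  have hE' : ∀ x, (x ∈ T ∧ x ∉ F) ↔ x = E := fun x => by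
    rw [← Finset.mem_sdiff, hE, Finset.mem_singleton]
  have mF : ∀ x, x ∈ F ↔ x = A ∨ x = B ∨ x = C := fun x => by
    rw [← or_assoc, ← he, ← hC']
    have := @heF x
    tauto
  have mT : ∀ x, x ∈ T ↔ x = A ∨ x = B ∨ x = C ∨ x = E := fun x => by
    have := @hFT x
    have h3 := mF x
    have h4 := hE' x
    tauto
  have hCe := ((hC' C).mpr rfl).2
  have hEF := ((hE' E).mpr rfl).2
  rw [he] at hCe
  rw [mF] at hEF
  push Not at hCe hEF
  exact ⟨C, E, he, mF, mT, hAB, hCe.1.symm, hCe.2.symm, hEF.1.symm, hEF.2.1.symm, hEF.2.2.symm⟩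

namespace Corner

variable {T F e : Finset E3} {A B C E : E3} {c : E3 → ℝ} {g : E3 → E3} {z : E3} {r σ : ℝ}

theorem A_mem (k : Corner T F e A B C E) : A ∈ T := (k.mem_T A).mpr (by simp)
theorem B_mem (k : Corner T F e A B C E) : B ∈ T := (k.mem_T B).mpr (by simp)
theorem C_mem (k : Corner T F e A B C E) : C ∈ T := (k.mem_T C).mpr (by simp)
theorem E_mem (k : Corner T F e A B C E) : E ∈ T := (k.mem_T E).mpr (by simp)

theorem e_subset (k : Corner T F e A B C E) : e ⊆ T := fun x hx => by
  rw [k.mem_e] at hx; rw [k.mem_T]; tauto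

theorem F_subset (k : Corner T F e A B C E) : F ⊆ T := fun x hx => by
  rw [k.mem_F] at hx; rw [k.mem_T]; tauto

theorem coe_e (k : Corner T F e A B C E) : (e : Set E3) = {A, B} := by
  ext x; simp [k.mem_e]

theorem mem_F_of_ne (k : Corner T F e A B C E) {x : E3} (hx : x ∈ T) (hE : x ≠ E) : x ∈ F := by
  rw [k.mem_T] at hx; rw [k.mem_F]; tauto

/-- The vertex in `IsConormal` can only be `C`, and `γ` is its distance to the line `AB`. The
coordinate of `C` rises from 0 to 1 over this height, which is at most the diameter. -/
theorem conormal (k : Corner T F e A B C E) (h : RegTet T c g z r σ) {t : E3}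
    (ht : TetMesh.IsConormal e F t) :
    ⟪g E, t⟫ = 0 ∧ 1 ≤ ⟪g C, t⟫ * diam (convexHull ℝ (T : Set E3)) ∧ ⟪t, B - A⟫ = 0 := by
  obtain ⟨h1, h2, x, hx, γ, hγ, hs⟩ := ht
  have hBA : ⟪t, B - A⟫ = 0 := h2 B (by rw [k.mem_e]; simp) A (by rw [k.mem_e]; simp)
  rw [k.coe_e, ← sub_add_cancel (x - γ • t) A, ← vadd_eq_add,
    vadd_left_mem_affineSpan_pair] at hs
  obtain ⟨τ, hτ⟩ := hs
  have hx' : x = A + τ • (B - A) + γ • t := by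
    rw [vsub_eq_sub] at hτ
    rw [hτ]; abel
  have hEx : lam c g E x = 0 := by
    refine h.bary.ne E k.E_mem x (k.F_subset hx) fun hE => ?_
    rw [k.mem_F] at hx
    rcases hx with hx | hx | hx
    · exact k.AE (hx.symm.trans hE.symm)
    · exact k.BE (hx.symm.trans hE.symm)
    · exact k.CE (hx.symm.trans hE.symm)
  have hgE : ⟪g E, B - A⟫ = 0 := by
    rw [← lam_sub, h.bary.ne E k.E_mem B k.B_mem k.BE.symm,
      h.bary.ne E k.E_mem A k.A_mem k.AE.symm, sub_zero]
  have hgC : ⟪g C, B - A⟫ = 0 := by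
    rw [← lam_sub, h.bary.ne C k.C_mem B k.B_mem k.BC.symm,
      h.bary.ne C k.C_mem A k.A_mem k.AC.symm, sub_zero]
  have hE0 : ⟪g E, t⟫ = 0 := by
    rw [hx', lam_add_smul, lam_add_smul, hgE, h.bary.ne E k.E_mem A k.A_mem k.AE.symm] at hEx
    simpa [hγ.ne'] using hEx
  have hγx : γ = ⟪t, x - A⟫ := by
    rw [hx', add_assoc, add_sub_cancel_left, inner_add_right, inner_smul_right, inner_smul_right,
      hBA, real_inner_self_eq_norm_sq, h1]; ring
  have hxC : x = C := by
    rw [k.mem_F] at hx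
    rcases hx with rfl | rfl | hx
    · rw [sub_self, inner_zero_right] at hγx; exact absurd hγx hγ.ne'
    · rw [hBA] at hγx; exact absurd hγx hγ.ne'
    · exact hx
  have hC1 : γ * ⟪g C, t⟫ = 1 := by
    have e1 := h.bary.self C k.C_mem
    have e2 : lam c g C x = 1 := by rwa [hxC]
    rw [hx', lam_add_smul, lam_add_smul, hgC, h.bary.ne C k.C_mem A k.A_mem k.AC.symm] at e2
    linarith
  have hγD : γ ≤ diam (convexHull ℝ (T : Set E3)) := by
    rw [hγx, hxC]
    refine (real_inner_le_norm _ _).trans ?_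
    rw [h1, one_mul]
    exact h.norm_sub_le k.C_mem k.A_mem
  refine ⟨hE0, ?_, hBA⟩
  have : 0 < ⟪g C, t⟫ := by
    by_contra! hc
    nlinarith
  rw [← hC1, mul_comm γ]
  gcongr

theorem lam_center (k : Corner T F e A B C E) (h : IsBary T c g) (he : e.card = 2) :
    lam c g A (center e) = 1 / 2 ∧ lam c g B (center e) = 1 / 2 ∧ lam c g C (center e) = 0 ∧
      lam c g E (center e) = 0 := by
  have hA : A ∈ e := by rw [k.mem_e]; simp
  have hB : B ∈ e := by rw [k.mem_e]; simp
  have hC : C ∉ e := by rw [k.mem_e]; simp [k.AC.symm, k.BC.symm]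
  have hE : E ∉ e := by rw [k.mem_e]; simp [k.AE.symm, k.BE.symm]
  rw [h.lam_center k.e_subset ⟨A, hA⟩ hA, h.lam_center k.e_subset ⟨A, hA⟩ hB,
    h.lam_center_notMem k.e_subset ⟨A, hA⟩ k.C_mem hC,
    h.lam_center_notMem k.e_subset ⟨A, hA⟩ k.E_mem hE, he]
  norm_num

theorem eventually_mem (k : Corner T F e A B C E) (h : IsBary T c g) (he : e.card = 2) {t : E3}
    (hC : 0 ≤ ⟪g C, t⟫) (hE : 0 ≤ ⟪g E, t⟫) :
    ∀ᶠ s in nhdsWithin (0 : ℝ) (Set.Ioi 0), center e + s • t ∈ convexHull ℝ (T : Set E3) := by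
  obtain ⟨h1, h2, h3, h4⟩ := k.lam_center h he
  refine h.eventually_mem fun a ha => ?_
  rw [k.mem_T] at ha
  rcases ha with rfl | rfl | rfl | rfl
  · left; rw [h1]; norm_num
  · left; rw [h2]; norm_num
  · right; exact ⟨h3, hC⟩
  · right; exact ⟨h4, hE⟩

/-- Otherwise a short move along `t'` from the mid-point of `e` would stay both in `T` and in the
face `F'`. By compatibility the point reached lies in the hull of the common vertices, where the
coordinate of `C` vanishes, although it has grown. -/
theorem not_overlap (M : TetMesh) {T' F' : Finset E3} {C' E' : E3} {c' : E3 → ℝ} {g' : E3 → E3}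
    (k : Corner T F e A B C E) (k' : Corner T' F' e A B C' E') (h : IsBary T c g)
    (h' : IsBary T' c' g') (hT : T ∈ M.complex.faces) (hF' : F' ∈ M.complex.faces)
    (he : e.card = 2) (hne : F ≠ F') {t' : E3} (hE't : ⟪g' E', t'⟫ = 0) (hC't : 0 ≤ ⟪g' C', t'⟫)
    (hC : 0 < ⟪g C, t'⟫) : ⟪g E, t'⟫ < 0 := by
  classical
  by_contra! hE
  obtain ⟨s, ⟨hs1, hs2⟩, hs0⟩ := ((k.eventually_mem h he hC.le hE).and
    (k'.eventually_mem h' he hC't hE't.ge)).and self_mem_nhdsWithin |>.exists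
  have hs0' : 0 < s := hs0
  set X := center e + s • t' with hX
  have hXF : X ∈ convexHull ℝ (F' : Set E3) := by
    rw [h'.mem_convexHull_subset k'.F_subset]
    refine ⟨(h'.mem_convexHull X).mp hs2, fun a ha haF => ?_⟩
    have : a = E' := by
      by_contra hn
      exact haF (k'.mem_F_of_ne ha hn)
    rw [this, hX, lam_add_smul, hE't, (k'.lam_center h' he).2.2.2]; ring
  have hCF : C ∉ F' := by
    intro hCF
    rw [k'.mem_F] at hCF
    have hCC : C = C' := by
      rcases hCF with h | h | h
      · exact absurd h.symm k.AC
      · exact absurd h.symm k.BC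
      · exact h
    apply hne
    ext x
    rw [k.mem_F, k'.mem_F, hCC]
  have hXI := M.complex.inter_subset_convexHull hT hF' ⟨hs1, hXF⟩
  rw [← Finset.coe_inter, h.mem_convexHull_subset Finset.inter_subset_left] at hXI
  have := hXI.2 C k.C_mem (fun hc => hCF (Finset.mem_inter.mp hc).2)
  rw [hX, lam_add_smul, (k.lam_center h he).2.2.1, zero_add] at this
  exact (mul_pos hs0' hC).ne' this

end Corner

end CurvedFEM
-- Perpendiculars to boundary faces and edges meet Γ nearby
namespace CurvedFEM

open Metric

namespace RegTet

variable {T F : Finset E3} {c : E3 → ℝ} {g : E3 → E3} {z : E3} {r σ η ρ : ℝ} {Ω : Set E3}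
  {n A E : E3} {ψ : E3 → ℝ}

theorem mem_ball (_h : RegTet T c g z r σ) (hA : A ∈ T)
    (hD : 2 * diam (convexHull ℝ (T : Set E3)) < ρ) {x : E3}
    (hx : x ∈ convexHull ℝ (T : Set E3)) : x ∈ Metric.ball A ρ := by
  rw [Metric.mem_ball, dist_eq_norm]
  have h1 := norm_sub_le_diam hx (mem_convexHull_of_mem hA)
  have h2 : 0 ≤ diam (convexHull ℝ (T : Set E3)) := diam_nonneg
  linarith

theorem abs_inner_vertex_le (h : RegTet T c g z r σ) (hΩ : IsOpen Ω) (hη : 0 ≤ η)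
    (hf : IsFlatOn Ω (Metric.ball A ρ) η n ψ) (hA : A ∈ T) (hAf : A ∈ frontier Ω)
    (hD : 2 * diam (convexHull ℝ (T : Set E3)) < ρ) {x : E3} (hx : x ∈ T) (hxf : x ∈ frontier Ω) :
    |⟪n, x - A⟫| ≤ η * diam (convexHull ℝ (T : Set E3)) := by
  have hxb := h.mem_ball hA hD (mem_convexHull_of_mem hx)
  have hAb := h.mem_ball hA hD (mem_convexHull_of_mem hA)
  have h1 := hf.sub_le x hxb A hAb
  rw [hf.eq_zero_of_mem_frontier isOpen_ball hΩ hxb hxf,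
    hf.eq_zero_of_mem_frontier isOpen_ball hΩ hAb hAf, sub_zero, zero_sub, abs_neg] at h1
  refine h1.trans ?_
  gcongr
  exact h.norm_sub_le hx hA

/-- A vector parallel to a face with vertices on the boundary is nearly tangential. -/
theorem abs_inner_le_of_parallel (h : RegTet T c g z r σ) (hΩ : IsOpen Ω) (hη : 0 ≤ η)
    (hf : IsFlatOn Ω (Metric.ball A ρ) η n ψ) (hA : A ∈ T) (hAE : A ≠ E)
    (hD : 2 * diam (convexHull ℝ (T : Set E3)) < ρ)
    (hv : ∀ x ∈ T, x ≠ E → x ∈ frontier Ω) {u : E3} (hu : ⟪g E, u⟫ = 0) :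
    |⟪n, u⟫| ≤ 4 * σ * η * ‖u‖ :=
  h.abs_inner_parallel_le hη
    (fun x hx hxE => h.abs_inner_vertex_le hΩ hη hf hA (hv A hA hAE) hD hx (hv x hx hxE)) hu

theorem grad_ne (h : RegTet T c g z r σ) (hA : A ∈ T) (hE : E ∈ T) (hAE : A ≠ E) : g E ≠ 0 := by
  intro h0
  have := h.bary.grad_ne_zero hE hA hAE.symm
  rw [h0, inner_zero_left] at this
  exact zero_ne_one this

/-- The face is almost tangent to Γ, so `ψ` is small at its centroid and the normal `g E` makes an
inner product of at least half its length with `n`; `exists_zero` then applies along the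
perpendicular. -/
theorem exists_frontier_faceNormalLine (h : RegTet T c g z r σ) (hΩ : IsOpen Ω) (hη : 0 ≤ η)
    (hf : IsFlatOn Ω (Metric.ball A ρ) η n ψ) (hFT : F ⊆ T) (hA : A ∈ F) (hE : E ∈ T) (hEF : E ∉ F)
    (hD : 2 * diam (convexHull ℝ (T : Set E3)) < ρ)
    (hTF : ∀ x ∈ T, x ≠ E → x ∈ F) (hv : ∀ x ∈ F, x ∈ frontier Ω) {δ ε : ℝ}
    (hδ : η + 4 * σ * η ≤ δ) (hδ4 : δ ≤ 1 / 4) (hδε : 4 * δ ≤ ε) (hε : ε ≤ 1) :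
    ∃ P ∈ frontier Ω ∩ faceNormalLine F,
      dist (center F) P ≤ ε * diam (convexHull ℝ (T : Set E3)) := by
  have hAT := hFT hA
  have hAE : A ≠ E := fun e => hEF (e ▸ hA)
  have hv' : ∀ x ∈ T, x ≠ E → x ∈ frontier Ω := fun x hx hxE => hv x (hTF x hx hxE)
  have hσ := h.one_le
  have hση : 0 ≤ 4 * σ * η := by positivity
  have hpar : ∀ u, ⟪g E, u⟫ = 0 → |⟪n, u⟫| ≤ 4 * σ * η * ‖u‖ := fun u hu =>
    h.abs_inner_le_of_parallel hΩ hη hf hAT hAE hD hv' hu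
  have hD0 := h.diam_pos
  set D := diam (convexHull ℝ (T : Set E3))
  have hGF : center F ∈ convexHull ℝ (F : Set E3) := center_mem_convexHull F ⟨A, hA⟩
  have hGT : center F ∈ convexHull ℝ (T : Set E3) :=
    convexHull_mono (Finset.coe_subset.mpr hFT) hGF
  have hgE := h.grad_ne hAT hE hAE
  have hgE0 : 0 < ‖g E‖ := norm_pos_iff.mpr hgE
  have hGA : ⟪g E, center F - A⟫ = 0 := by
    rw [← lam_sub, ((h.bary.mem_convexHull_subset hFT _).mp hGF).2 E hE hEF,
      h.bary.ne E hE A hAT hAE.symm, sub_zero]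
  have hGAD : ‖center F - A‖ ≤ D := norm_sub_le_diam hGT (mem_convexHull_of_mem hAT)
  have hψG : |ψ (center F)| ≤ δ * D := by
    have hAb := h.mem_ball hAT hD (mem_convexHull_of_mem hAT)
    have h1 := abs_le.mp (hf.sub_le _ (h.mem_ball hAT hD hGT) A hAb)
    rw [hf.eq_zero_of_mem_frontier isOpen_ball hΩ hAb (hv A hA)] at h1
    have h2 := abs_le.mp (hpar _ hGA)
    have h3 : η * ‖center F - A‖ + 4 * σ * η * ‖center F - A‖ ≤ δ * D := by
      rw [← add_mul]
      exact mul_le_mul hδ hGAD (norm_nonneg _) (by linarith)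
    exact abs_le.mpr ⟨by linarith, by linarith⟩
  have hc : 1 / 2 ≤ |⟪n, ‖g E‖⁻¹ • g E⟫| := by
    have := abs_inner_normal_ge hf.norm_eq hgE hpar (by linarith)
    rw [inner_smul_right, abs_mul, abs_of_nonneg (by positivity), le_inv_mul_iff₀ hgE0]
    linarith
  have hball : ∀ s : ℝ, |s| ≤ ε * D → center F + s • ‖g E‖⁻¹ • g E ∈ Metric.ball A ρ := by
    intro s hs
    rw [Metric.mem_ball, dist_eq_norm]
    calc ‖center F + s • ‖g E‖⁻¹ • g E - A‖ = ‖(center F - A) + s • ‖g E‖⁻¹ • g E‖ := by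
          congr 1; abel
      _ ≤ D + ε * D := by
          refine norm_add_le_of_le hGAD ?_
          rwa [norm_smul, norm_smul, norm_inv, norm_norm, inv_mul_cancel₀ hgE0.ne', mul_one]
      _ ≤ 2 * D := by nlinarith
      _ < ρ := hD
  obtain ⟨s, hs, h0⟩ := hf.exists_zero (m := ‖g E‖⁻¹ • g E) (t := ε * D)
    (by rw [norm_smul, norm_inv, norm_norm, inv_mul_cancel₀ hgE0.ne']) hc hψG
    (by apply mul_nonneg <;> linarith)
    (by
      have : δ ≤ ε * (1 / 2 - η) := by nlinarith
      nlinarith) hball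
  refine ⟨_, ⟨hf.mem_frontier isOpen_ball hΩ (by linarith) (hball s hs) h0, ?_⟩, ?_⟩
  · intro x hx y hy
    rw [add_sub_cancel_left, inner_smul_left, inner_smul_left, ← lam_sub,
      h.bary.ne E hE x (hFT hx) (fun e => hEF (e ▸ hx)),
      h.bary.ne E hE y (hFT hy) (fun e => hEF (e ▸ hy))]
    simp
  · rw [dist_eq_norm, sub_add_cancel_left, norm_neg, norm_smul, norm_smul, norm_inv, norm_norm,
      inv_mul_cancel₀ hgE0.ne', mul_one]
    exact hs

/-- The gradient of the barycentric coordinate of the vertex opposite to a face on the boundary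
points inwards. -/
theorem inner_normal_neg (h : RegTet T c g z r σ) (hΩ : IsOpen Ω) (hη : 0 ≤ η)
    (hf : IsFlatOn Ω (Metric.ball A ρ) η n ψ) (hA : A ∈ T) (hE : E ∈ T) (hAE : A ≠ E)
    (hD : 2 * diam (convexHull ℝ (T : Set E3)) < ρ)
    (hv : ∀ x ∈ T, x ≠ E → x ∈ frontier Ω) (hEΩ : E ∈ closure Ω) {δ : ℝ}
    (hδ : η + 4 * σ * η ≤ δ) (hδ4 : δ ≤ 1 / 4) (hδσ : 16 * σ * δ ≤ 1) : ⟪n, g E⟫ < 0 := by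
  by_contra! hc
  have hσ := h.one_le
  have hση : 0 ≤ 4 * σ * η := by positivity
  have hpar : ∀ u, ⟪g E, u⟫ = 0 → |⟪n, u⟫| ≤ 4 * σ * η * ‖u‖ := fun u hu =>
    h.abs_inner_le_of_parallel hΩ hη hf hA hAE hD hv hu
  have hD0 := h.diam_pos
  have hDσ := h.diam_le
  have hr := h.rpos
  have hgr := h.bary.norm_grad_le h.rpos h.ball hE
  have hEAD := h.norm_sub_le hE hA
  have hEb := h.mem_ball hA hD (mem_convexHull_of_mem hE)
  have hAb := h.mem_ball hA hD (mem_convexHull_of_mem hA)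
  set D := diam (convexHull ℝ (T : Set E3))
  have hgE := h.grad_ne hA hE hAE
  have hgE0 : 0 < ‖g E‖ := norm_pos_iff.mpr hgE
  have h1 := h.bary.grad_ne_zero hE hA hAE.symm
  -- Splits `E - A` into a part parallel to the face and the height `1 / ‖g E‖ ≥ r`. If `g E`
  -- pointed outwards, the height would contribute at least `r / 2` along `n`, whereas `E` in the
  -- closure of `Ω` allows only `η D` in total.
  set y := (E - A) - (‖g E‖ ^ 2)⁻¹ • g E with hy
  have hgy : ⟪g E, y⟫ = 0 := by
    rw [hy, inner_sub_right, inner_smul_right, real_inner_self_eq_norm_sq, h1]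
    field_simp; ring
  have hyn : ‖y‖ ≤ D := by
    refine le_trans ?_ hEAD
    refine (sq_le_sq₀ (norm_nonneg _) (norm_nonneg _)).mp ?_
    have : E - A = y + (‖g E‖ ^ 2)⁻¹ • g E := by rw [hy]; abel
    rw [this, ← real_inner_self_eq_norm_sq, ← real_inner_self_eq_norm_sq]
    rw [inner_add_left, inner_add_right, inner_add_right, inner_smul_right, inner_smul_left,
      inner_smul_left, inner_smul_right, real_inner_comm (g E) y, hgy]
    have : (0 : ℝ) ≤ ⟪g E, g E⟫ := real_inner_self_nonneg
    simp only [mul_zero, add_zero, zero_add, conj_trivial]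
    nlinarith [mul_nonneg (inv_nonneg.mpr (sq_nonneg ‖g E‖)) (mul_nonneg (inv_nonneg.mpr
      (sq_nonneg ‖g E‖)) this)]
  have h2 : ⟪n, E - A⟫ ≤ η * D := by
    have h3 := abs_le.mp (hf.sub_le E hEb A hAb)
    have h4 := hf.nonpos_of_mem_closure isOpen_ball hEb hEΩ
    rw [hf.eq_zero_of_mem_frontier isOpen_ball hΩ hAb (hv A hA hAE)] at h3
    have h5 : η * ‖E - A‖ ≤ η * D := by gcongr
    linarith
  have h3 : ⟪n, E - A⟫ = ⟪n, y⟫ + (‖g E‖ ^ 2)⁻¹ * ⟪n, g E⟫ := by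
    rw [hy, inner_sub_right n (E - A), inner_smul_right]; ring
  have h4 := (abs_le.mp (hpar y hgy)).1
  have h5 : 4 * σ * η * ‖y‖ ≤ 4 * σ * η * D := by gcongr
  have h6 := abs_inner_normal_ge hf.norm_eq hgE hpar (by linarith)
  rw [abs_of_nonneg hc] at h6
  have h7 : r / 2 ≤ (‖g E‖ ^ 2)⁻¹ * ⟪n, g E⟫ := by
    calc r / 2 ≤ (‖g E‖)⁻¹ / 2 := by
          gcongr
          rw [le_inv_comm₀ hr hgE0]; rwa [← one_div]
      _ = (‖g E‖ ^ 2)⁻¹ * (‖g E‖ / 2) := by field_simp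
      _ ≤ _ := by gcongr
  have h8 : r / 2 ≤ δ * D := by nlinarith
  have h9 : δ * D ≤ δ * (σ * r) := by gcongr; linarith
  nlinarith

end RegTet

theorem Corner.center_eq {T F e : Finset E3} {A B C E : E3} (k : Corner T F e A B C E) :
    center e = A + (1 / 2 : ℝ) • (B - A) := by
  classical
  have he : e = {A, B} := by ext x; simp [k.mem_e]
  rw [CurvedFEM.center_eq e (by rw [he]; simp), he, Finset.card_pair k.AB,
    Finset.sum_pair k.AB]
  push_cast
  module

/-- `t'` is at least half of `t` plus an error of size `4 δ`. The coordinate of `C` has slope at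
least `1 / (σ r)` along `t`, and the error changes the slope by at most `4 δ / r`, a quarter of
that. -/
theorem Corner.inner_C_pos {T F e : Finset E3} {A B C E : E3} {c : E3 → ℝ} {g : E3 → E3} {z : E3}
    {r σ δ : ℝ} (k : Corner T F e A B C E) (h : RegTet T c g z r σ) {t t' : E3}
    (ht : ‖t‖ = 1) (ht' : ‖t'‖ = 1) (hCt : 1 ≤ ⟪g C, t⟫ * diam (convexHull ℝ (T : Set E3)))
    (hn : ‖t' - ⟪t, t'⟫ • t‖ ≤ 4 * δ) (hp : 0 ≤ ⟪t, t'⟫) (hδ : δ ≤ 1 / 16)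
    (hδσ : 16 * σ * δ ≤ 1) : 0 < ⟪g C, t'⟫ := by
  have hr := h.rpos
  have hσ := h.one_le
  have hDσ := h.diam_le
  have hD0 := h.diam_pos
  have hp2 : 1 / 2 ≤ ⟪t, t'⟫ := by
    have h1 : ‖t'‖ ≤ ‖t' - ⟪t, t'⟫ • t‖ + ‖⟪t, t'⟫ • t‖ := by
      have := norm_add_le (t' - ⟪t, t'⟫ • t) (⟪t, t'⟫ • t)
      rwa [sub_add_cancel] at this
    rw [ht', norm_smul, ht, Real.norm_of_nonneg hp] at h1
    linarith
  have h1 : ⟪g C, t'⟫ = ⟪t, t'⟫ * ⟪g C, t⟫ + ⟪g C, t' - ⟪t, t'⟫ • t⟫ := by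
    rw [inner_sub_right, inner_smul_right]; ring
  have h2 : |⟪g C, t' - ⟪t, t'⟫ • t⟫| ≤ 1 / r * (4 * δ) :=
    (abs_real_inner_le_norm _ _).trans (mul_le_mul (h.bary.norm_grad_le h.rpos h.ball k.C_mem) hn
      (norm_nonneg _) (by positivity))
  have h3 : 1 / (σ * r) ≤ ⟪g C, t⟫ := by
    have h0 : 0 < ⟪g C, t⟫ := by
      by_contra! hc
      nlinarith
    rw [div_le_iff₀ (by positivity)]
    refine hCt.trans ?_
    gcongr
  have h4 : 1 / 2 * (1 / (σ * r)) ≤ ⟪t, t'⟫ * ⟪g C, t⟫ := by gcongr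
  have h5 : 1 / r * (4 * δ) ≤ 1 / 4 * (1 / (σ * r)) := by
    rw [one_div_mul_eq_div, one_div_mul_one_div, div_le_div_iff₀ hr (by positivity)]
    nlinarith
  have h6 : 0 < 1 / (σ * r) := by positivity
  have := (abs_le.mp h2).1
  linarith

/-- The perpendicular to an edge in the skin meets the boundary of the domain near the edge. -/
theorem exists_frontier_edgeLine {Ω : Set E3} {M : TetMesh} {T F e T' F' : Finset E3}
    {A B C E C' E' : E3}
    {c c' : E3 → ℝ} {g g' : E3 → E3} {z z' n : E3} {r r' σ δ η κ ε ρ : ℝ} {ψ : E3 → ℝ}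
    (hΩ : IsOpen Ω) (hη : 0 ≤ η) (hf : IsFlatOn Ω (Metric.ball A ρ) η n ψ)
    (k : Corner T F e A B C E) (k' : Corner T' F' e A B C' E')
    (h : RegTet T c g z r σ) (h' : RegTet T' c' g' z' r' σ)
    (hT : T ∈ M.complex.faces) (hT' : T' ∈ M.complex.faces) (hF : F ∈ M.complex.faces)
    (hF' : F' ∈ M.complex.faces) (he : e.card = 2) (hne : F ≠ F')
    (hD : 2 * diam (convexHull ℝ (T : Set E3)) < ρ)
    (hD' : 2 * diam (convexHull ℝ (T' : Set E3)) < ρ)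
    (hv : ∀ x ∈ F, x ∈ frontier Ω) (hv' : ∀ x ∈ F', x ∈ frontier Ω)
    (hE : E ∈ closure Ω) (hE' : E' ∈ closure Ω) {t t' d : E3} (ht : TetMesh.IsConormal e F t)
    (ht' : TetMesh.IsConormal e F' t') (hd : ‖d‖ = 1) (hde : ∀ x ∈ e, ∀ y ∈ e, ⟪d, x - y⟫ = 0)
    (hdt : |⟪d, t - t'⟫| ≤ κ * ‖t - t'‖) (hκ0 : 0 ≤ κ) (hκ : κ < 1) (hδ : η + 4 * σ * η ≤ δ)
    (hδκ : δ ≤ (1 - κ) / 32) (hδσ : 16 * σ * δ ≤ 1) (hδε : δ ≤ ε * (1 - κ) / 64) (hε : ε ≤ 1) :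
    ∃ Q ∈ frontier Ω ∩ edgeLine e d, dist (center e) Q ≤ ε * ‖B - A‖ := by
  have hσ := h.one_le
  have hση : 0 ≤ 4 * σ * η := by positivity
  have hvT : ∀ x ∈ T, x ≠ E → x ∈ frontier Ω := fun x hx hxE => hv x (k.mem_F_of_ne hx hxE)
  have hvT' : ∀ x ∈ T', x ≠ E' → x ∈ frontier Ω := fun x hx hxE => hv' x (k'.mem_F_of_ne hx hxE)
  have hpar : ∀ u, ⟪g E, u⟫ = 0 → |⟪n, u⟫| ≤ δ * ‖u‖ := fun u hu =>
    (h.abs_inner_le_of_parallel hΩ hη hf k.A_mem k.AE hD hvT hu).trans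
      (by gcongr; linarith)
  have hpar' : ∀ u, ⟪g' E', u⟫ = 0 → |⟪n, u⟫| ≤ δ * ‖u‖ := fun u hu =>
    (h'.abs_inner_le_of_parallel hΩ hη hf k'.A_mem k'.AE hD' hvT' hu).trans
      (by gcongr; linarith)
  obtain ⟨hEt, hCt, htBA⟩ := k.conormal h ht
  obtain ⟨hEt', hCt', htBA'⟩ := k'.conormal h' ht'
  have hBA0 : 0 < ‖B - A‖ := norm_pos_iff.mpr (sub_ne_zero.mpr k.AB.symm)
  have hdBA : ⟪d, B - A⟫ = 0 := hde B (by rw [k.mem_e]; simp) A (by rw [k.mem_e]; simp)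
  have hgE : ⟪g E, B - A⟫ = 0 := by
    rw [← lam_sub, h.bary.ne E k.E_mem B k.B_mem k.BE.symm,
      h.bary.ne E k.E_mem A k.A_mem k.AE.symm, sub_zero]
  have hgE' : ⟪g' E', B - A⟫ = 0 := by
    rw [← lam_sub, h'.bary.ne E' k'.E_mem B k'.B_mem k'.BE.symm,
      h'.bary.ne E' k'.E_mem A k'.A_mem k'.AE.symm, sub_zero]
  set b := ‖B - A‖⁻¹ • (B - A) with hb
  have hb1 : ‖b‖ = 1 := by rw [hb, norm_smul, norm_inv, norm_norm, inv_mul_cancel₀ hBA0.ne']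
  have hbperp : ∀ u : E3, ⟪u, B - A⟫ = 0 → ⟪b, u⟫ = 0 := fun u hu => by
    rw [hb, inner_smul_left, real_inner_comm, hu, mul_zero]
  have hnb : |⟪n, b⟫| ≤ δ := by
    have := hpar b (by rw [hb, inner_smul_right, hgE, mul_zero])
    rwa [hb1, mul_one] at this
  have hnt : |⟪n, t⟫| ≤ δ := by simpa [ht.1] using hpar t hEt
  have hnt' : |⟪n, t'⟫| ≤ δ := by simpa [ht'.1] using hpar' t' hEt'
  have hδ16 : δ ≤ 1 / 16 := by linarith
  -- Exclusion of folding. If the conormals were not opposite they would be nearly parallel, so each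
  -- of the coordinates of `C` and `C'` would grow along the other conormal. Compatibility then
  -- makes the coordinates of `E` and `E'` decrease, which is incompatible with both tetrahedra
  -- lying on the inner side.
  have hneg : ⟪t, t'⟫ < 0 := by
    by_contra! hp
    have hp' : 0 ≤ ⟪t', t⟫ := by rwa [real_inner_comm]
    have n1 := nearly_parallel hf.norm_eq hb1 ht.1 ht'.1 (hbperp t htBA) (hbperp t' htBA') hnb hnt
      hnt' hδ16
    have n2 := nearly_parallel hf.norm_eq hb1 ht'.1 ht.1 (hbperp t' htBA') (hbperp t htBA) hnb hnt'
      hnt hδ16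
    have c1 := k.inner_C_pos h ht.1 ht'.1 hCt n1 hp hδ16 hδσ
    have c2 := k'.inner_C_pos h' ht'.1 ht.1 hCt' n2 hp' hδ16 hδσ
    have pos : ∀ {x D : ℝ}, 0 < D → 1 ≤ x * D → 0 ≤ x := fun {x D} hD hx => by
      by_contra! hc
      nlinarith
    have o1 := k.not_overlap M k' h.bary h'.bary hT hF' he hne hEt' (pos h'.diam_pos hCt') c1
    have o2 := k'.not_overlap M k h'.bary h.bary hT' hF he hne.symm hEt (pos h.diam_pos hCt) c2
    have i1 := h.inner_normal_neg hΩ hη hf k.A_mem k.E_mem k.AE hD hvT hE hδ (by linarith) hδσ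
    have i2 := h'.inner_normal_neg hΩ hη hf k'.A_mem k'.E_mem k'.AE hD' hvT' hE' hδ (by linarith)
      hδσ
    exact absurd (not_folded hf.norm_eq hb1 ht.1 ht'.1 (hbperp t htBA) (hbperp t' htBA') hnb hnt
      hnt' hδ16 (hbperp _ hgE) (hbperp _ hgE') (by rwa [real_inner_comm])
      (by rwa [real_inner_comm]) o1 o2 i1 i2) (not_lt.mpr hp)
  have hnd := abs_inner_skin_ge hf.norm_eq hb1 ht.1 ht'.1 hd (hbperp t htBA) (hbperp t' htBA')
    (hbperp d hdBA) hnb hnt hnt' hκ0 hκ (by linarith) hneg hdt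
  have hBAD := h.norm_sub_le k.B_mem k.A_mem
  have hAf := hv A ((k.mem_F A).mpr (by simp))
  have hBf := hv B ((k.mem_F B).mpr (by simp))
  have hAb := h.mem_ball k.A_mem hD (mem_convexHull_of_mem k.A_mem)
  have hBb := h.mem_ball k.A_mem hD (mem_convexHull_of_mem k.B_mem)
  have hGA : ‖center e - A‖ = 1 / 2 * ‖B - A‖ := by
    rw [k.center_eq, add_sub_cancel_left, norm_smul]; norm_num
  have hball : ∀ s : ℝ, |s| ≤ ε * ‖B - A‖ → center e + s • d ∈ Metric.ball A ρ := by
    intro s hs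
    rw [Metric.mem_ball, dist_eq_norm]
    calc ‖center e + s • d - A‖ = ‖(center e - A) + s • d‖ := by congr 1; abel
      _ ≤ 1 / 2 * ‖B - A‖ + ε * ‖B - A‖ := by
          refine norm_add_le_of_le hGA.le ?_
          rwa [norm_smul, hd, mul_one]
      _ ≤ 2 * ‖B - A‖ := by nlinarith
      _ < ρ := by linarith
  have hε0 : 0 ≤ ε := by
    by_contra! hc
    have : 0 ≤ η := hη
    nlinarith
  -- Flatness is used along the edge only, so the bound scales with the edge length and serves every
  -- tetrahedron having the edge, even one without a face on Γ_h.
  have hψ : |ψ (center e)| ≤ δ * ‖B - A‖ := by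
    have h1 := abs_le.mp (hf.sub_le _
      (by simpa using hball 0 (by rw [abs_zero]; positivity)) A hAb)
    have h2 := hf.sub_le B hBb A hAb
    have e1 := hf.eq_zero_of_mem_frontier isOpen_ball hΩ hAb hAf
    rw [e1, hf.eq_zero_of_mem_frontier isOpen_ball hΩ hBb hBf, sub_zero, zero_sub, abs_neg] at h2
    rw [e1, hGA, k.center_eq, add_sub_cancel_left, inner_smul_right, ← k.center_eq] at h1
    have h3 := abs_le.mp h2
    have h4 : η * ‖B - A‖ ≤ δ * ‖B - A‖ := by gcongr; linarith
    exact abs_le.mpr ⟨by linarith, by linarith⟩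
  obtain ⟨s, hs, h0⟩ := hf.exists_zero hd (t := ε * ‖B - A‖) hnd hψ (by positivity)
    (by
      have h1 : ε * (1 - κ) / 64 ≤ ε * ((1 - κ) / 8 - η) := by
        rw [mul_div_assoc]
        gcongr
        linarith
      have h2 : δ * ‖B - A‖ ≤ ε * ((1 - κ) / 8 - η) * ‖B - A‖ := by
        gcongr; linarith
      linarith) hball
  refine ⟨_, ⟨hf.mem_frontier isOpen_ball hΩ (by linarith) (hball s hs) h0, s, rfl⟩, ?_⟩
  rw [dist_eq_norm, sub_add_cancel_left, norm_neg, norm_smul, hd, mul_one]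
  exact hs

theorem isClosed_faceNormalLine (F : Finset E3) : IsClosed (faceNormalLine F) := by
  simp only [faceNormalLine, Set.ofPred_forall]
  refine isClosed_iInter fun x => isClosed_iInter fun _ => isClosed_iInter fun y =>
    isClosed_iInter fun _ => isClosed_eq (by fun_prop) continuous_const

theorem isClosed_edgeLine (e : Finset E3) (d : E3) : IsClosed (edgeLine e d) := by
  have : edgeLine e d = (fun p => p - center e) ⁻¹' (Submodule.span ℝ {d} : Set E3) := by
    ext p
    simp only [edgeLine, Set.mem_ofPred_eq, Set.mem_preimage, SetLike.mem_coe,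
      Submodule.mem_span_singleton]
    exact exists_congr fun τ => ⟨fun h => by rw [h, add_sub_cancel_left],
      fun h => by rw [h]; abel⟩
  rw [this]
  exact (Submodule.closed_of_finiteDimensional _).preimage (by fun_prop)

/-- The trial conditions quantify over nearest points and would be void without one. -/
theorem exists_isNearest {S : Set E3} (hS : IsClosed S) (hne : S.Nonempty) (m : E3) :
    ∃ q, IsNearest S m q := by
  obtain ⟨q, hq, h⟩ := hS.exists_infDist_eq_dist hne m
  exact ⟨q, hq, fun q' hq' => h ▸ infDist_le_dist_of_mem hq'⟩

end CurvedFEM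
-- Passing from tetrahedron to tetrahedron
namespace CurvedFEM

open Metric MeasureTheory

theorem TetMesh.mem_tets (M : TetMesh) {T : Finset E3} :
    T ∈ M.tets ↔ T ∈ M.complex.faces ∧ T.card = 4 := by
  simp [TetMesh.tets]

theorem TetMesh.exists_isBary (M : TetMesh) {T : Finset E3} (hT : T ∈ M.tets) :
    ∃ c g, IsBary T c g :=
  CurvedFEM.exists_isBary T (M.mem_tets.mp hT).2 (M.complex.indep (M.mem_tets.mp hT).1)

theorem IsBary.interior_nonempty {T : Finset E3} {c : E3 → ℝ} {g : E3 → E3} (h : IsBary T c g)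
    (hT : T.Nonempty) : (interior (convexHull ℝ (T : Set E3))).Nonempty := by
  refine ⟨center T, mem_interior.mpr ⟨⋂ a ∈ T, lam c g a ⁻¹' Set.Ioi 0, fun x hx => ?_, ?_, ?_⟩⟩
  · rw [h.mem_convexHull]
    intro a ha
    exact le_of_lt (Set.mem_iInter₂.mp hx a ha)
  · exact isOpen_biInter_finset fun a _ => isOpen_Ioi.preimage (lam_continuous c g a)
  · refine Set.mem_iInter₂.mpr fun a ha => ?_
    change 0 < lam c g a (center T)
    rw [h.lam_center subset_rfl hT ha]
    have := hT.card_pos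
    positivity

/-- A closed convex set with nonempty interior is the closure of its interior. Consequently a point
of a tetrahedron is either in Ω_h or on Γ_h. -/
theorem TetMesh.convexHull_subset_closure (M : TetMesh) {T : Finset E3} (hT : T ∈ M.tets) :
    convexHull ℝ (T : Set E3) ⊆ closure M.domain := by
  obtain ⟨c, g, h⟩ := M.exists_isBary hT
  have hne : T.Nonempty := Finset.card_pos.mp (by rw [(M.mem_tets.mp hT).2]; norm_num)
  have h1 := (convex_convexHull ℝ (T : Set E3)).closure_interior_eq_closure_of_nonempty_interior
    (h.interior_nonempty hne)
  refine subset_closure.trans (h1.symm.subset.trans (closure_mono (interior_mono ?_)))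
  exact Set.subset_biUnion_of_mem (u := fun T : Finset E3 => convexHull ℝ (T : Set E3)) hT

/-- A line that leaves a tetrahedron through a face not contained in the boundary of the mesh enters
a tetrahedron with the same face. -/
theorem TetMesh.exists_crossing (M : TetMesh) {T F : Finset E3} {c : E3 → ℝ} {g : E3 → E3} {E : E3}
    (hT : T ∈ M.tets) (h : IsBary T c g) (hE : E ∈ T) (hF : ∀ x, x ∈ F ↔ x ∈ T ∧ x ≠ E)
    (hb : ¬ M.OnBdry F) {q d : E3} (hq0 : lam c g E q = 0)
    (hq : ∀ a ∈ F, 0 < lam c g a q) :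
    ∃ T' ∈ M.tets, F ⊆ T' ∧
      ∀ᶠ s in nhdsWithin (0 : ℝ) (Set.Ioi 0), q + s • d ∈ convexHull ℝ (T' : Set E3) := by
  classical
  have hFT : F ⊆ T := fun x hx => ((hF x).mp hx).1
  obtain ⟨x, hxF, hxb⟩ := Set.not_subset.mp hb
  have hxT := convexHull_mono (Finset.coe_subset.mpr hFT) hxF
  have hopen : IsOpen M.domain := isOpen_interior
  have hxD : x ∈ M.domain := by
    by_contra hn
    apply hxb
    rw [TetMesh.bdry, hopen.frontier_eq]
    exact ⟨M.convexHull_subset_closure hT hxT, hn⟩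
  have hx0 := (h.mem_convexHull_subset hFT x).mp hxF
  have hEF : E ∉ F := fun hc => ((hF E).mp hc).2 rfl
  have htend : ∀ u v : E3, Filter.Tendsto (fun s : ℝ => u + s • v) (nhdsWithin 0 (Set.Ioi 0))
      (nhds u) := by
    intro u v
    have : Filter.Tendsto (fun s : ℝ => u + s • v) (nhds 0) (nhds (u + (0 : ℝ) • v)) :=
      Continuous.tendsto (by fun_prop) 0
    rw [zero_smul, add_zero] at this
    exact this.mono_left nhdsWithin_le_nhds
  -- The hypothesis `hb` yields just one point `x` of the face in Ω_h, perhaps on an edge of it. A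
  -- small move towards `q` gives a point `y` of Ω_h in the relative interior of the face.
  obtain ⟨τ, ⟨hτD, hτ1⟩, hτ0⟩ := (((htend x (q - x)).eventually (hopen.mem_nhds hxD)).and
    (nhdsWithin_le_nhds (Iio_mem_nhds zero_lt_one))).and self_mem_nhdsWithin |>.exists
  have hτ0' : (0 : ℝ) < τ := hτ0
  have hτ1' : τ < 1 := hτ1
  set y := x + τ • (q - x) with hy
  have hlam : ∀ a, lam c g a y = (1 - τ) * lam c g a x + τ * lam c g a q := by
    intro a
    rw [hy, lam_add_smul, ← lam_sub]; ring
  have hy0 : lam c g E y = 0 := by rw [hlam, hx0.2 E hE hEF, hq0]; ring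
  have hyF : ∀ a ∈ F, 0 < lam c g a y := by
    intro a ha
    rw [hlam]
    have h1 := hx0.1 a (hFT ha)
    have h2 := hq a ha
    have h3 : 0 < 1 - τ := by linarith
    positivity
  -- For short steps, only tetrahedra that already contain `y` can be reached.
  have hev : ∀ᶠ s in nhdsWithin (0 : ℝ) (Set.Ioi 0), ∀ T' ∈ M.tets,
      y ∉ convexHull ℝ (T' : Set E3) → y + s • d ∉ convexHull ℝ (T' : Set E3) := by
    rw [Filter.eventually_all_finset]
    intro T' _
    by_cases hyT : y ∈ convexHull ℝ (T' : Set E3)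
    · exact Filter.Eventually.of_forall fun s hs => absurd hyT hs
    · filter_upwards [(htend y d).eventually
        ((isCompact_convexHull T').isClosed.isOpen_compl.mem_nhds hyT)] with s hs _
      exact hs
  obtain ⟨s, ⟨hsD, hsT⟩, hs0⟩ := (((htend y d).eventually (hopen.mem_nhds hτD)).and hev).and
    self_mem_nhdsWithin |>.exists
  have hs0' : (0 : ℝ) < s := hs0
  obtain ⟨T', hT', hsT'⟩ := Set.mem_iUnion₂.mp (interior_subset hsD)
  have hyT' : y ∈ convexHull ℝ (T' : Set E3) := by
    by_contra hn
    exact hsT T' hT' hn hsT'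
  have hyT : y ∈ convexHull ℝ (T : Set E3) := by
    rw [h.mem_convexHull]
    intro a ha
    by_cases haE : a = E
    · rw [haE, hy0]
    · exact (hyF a ((hF a).mpr ⟨ha, haE⟩)).le
  -- By compatibility `y` lies in the hull of `T ∩ T'`; all its coordinates on the vertices of `F`
  -- are positive, so these vertices are common.
  have hFT' : F ⊆ T' := by
    intro a ha
    by_contra hn
    have hI := M.complex.inter_subset_convexHull (M.mem_tets.mp hT).1 (M.mem_tets.mp hT').1
      ⟨hyT, hyT'⟩
    rw [← Finset.coe_inter, h.mem_convexHull_subset Finset.inter_subset_left] at hI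
    exact (hyF a ha).ne' (hI.2 a (hFT ha) fun hc => hn (Finset.mem_inter.mp hc).2)
  refine ⟨T', hT', hFT', ?_⟩
  obtain ⟨c', g', h'⟩ := M.exists_isBary hT'
  have hweights : ∀ u, lam c g E u = 0 → ∑ a ∈ F, lam c g a u = 1 ∧
      ∑ a ∈ F, lam c g a u • a = u := by
    intro u hu
    constructor
    · rw [← h.sum_one u]
      refine Finset.sum_subset hFT fun a ha haF => ?_
      have : a = E := by
        by_contra hn
        exact haF ((hF a).mpr ⟨ha, hn⟩)
      rw [this, hu]
    · conv_rhs => rw [← h.sum_smul u]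
      refine Finset.sum_subset hFT fun a ha haF => ?_
      have : a = E := by
        by_contra hn
        exact haF ((hF a).mpr ⟨ha, hn⟩)
      rw [this, hu, zero_smul]
  have hlamF : ∀ u, lam c g E u = 0 → ∀ a ∈ F, lam c' g' a u = lam c g a u := by
    intro u hu a ha
    obtain ⟨e1, e2⟩ := hweights u hu
    conv_lhs => rw [← e2]
    exact h'.lam_of_weights hFT' (w := fun a => lam c g a u) e1 ha
  have hlamE : ∀ u, lam c g E u = 0 → ∀ a ∈ T', a ∉ F → lam c' g' a u = 0 := by
    intro u hu a ha haF
    obtain ⟨e1, e2⟩ := hweights u hu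
    conv_lhs => rw [← e2]
    exact h'.lam_of_weights_notMem hFT' (w := fun a => lam c g a u) e1 ha haF
  -- Vertices of `T'` outside `F` have coordinate 0 at both `y` and `q`, so the sign of the slope
  -- along `d` observed from `y` is valid at `q`.
  refine h'.eventually_mem fun a ha => ?_
  by_cases haF : a ∈ F
  · left; rw [hlamF q hq0 a haF]; exact hq a haF
  · right
    refine ⟨hlamE q hq0 a ha haF, ?_⟩
    have h1 := (h'.mem_convexHull _).mp hsT' a ha
    rw [lam_add_smul, hlamE y hy0 a ha haF, zero_add] at h1
    exact nonneg_of_mul_nonneg_right h1 hs0'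

theorem volume_mk'_span_pair (a u v : E3) :
    volume (AffineSubspace.mk' a (Submodule.span ℝ {u, v}) : Set E3) = 0 := by
  apply Measure.addHaar_affineSubspace
  intro htop
  have h1 : Submodule.span ℝ {u, v} = (⊤ : Submodule ℝ E3) := by
    rw [← AffineSubspace.direction_mk' a (Submodule.span ℝ {u, v}), htop,
      AffineSubspace.direction_top]
  have h2 : Module.finrank ℝ (Submodule.span ℝ ({u, v} : Set E3)) ≤ 2 := by
    classical
    have := finrank_span_finset_le_card (R := ℝ) ({u, v} : Finset E3)
    rw [Set.finrank, Finset.coe_pair] at this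
    exact this.trans Finset.card_le_two
  rw [h1, finrank_top] at h2
  simp at h2

/-- Some face of some tetrahedron of a nonempty set `S` of tetrahedra of the mesh is contained in
the boundary of the mesh or belongs to a tetrahedron not in `S`. -/
theorem TetMesh.exists_face_leaving (M : TetMesh) (S : Finset (Finset E3)) (hS : S ⊆ M.tets)
    (hne : S.Nonempty) : ∃ T ∈ S, ∃ F ⊆ T, F.card = 3 ∧
      (M.OnBdry F ∨ ∃ T' ∈ M.tets, T' ∉ S ∧ F ⊆ T') := by
  classical
  by_contra! H
  set d : E3 := EuclideanSpace.single 0 1 with hd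
  have hd1 : ‖d‖ = 1 := by simp [hd]
  set V := S.biUnion id
  -- A ray in direction `d` that starts outside this null set meets no edge of the tetrahedra in
  -- `S`.
  set N : Set E3 := ⋃ a ∈ V, ⋃ b ∈ V, (AffineSubspace.mk' a (Submodule.span ℝ {b - a, d}) : Set E3)
    with hN
  have hN0 : volume N = 0 := by
    refine (measure_biUnion_null_iff V.countable_toSet).mpr fun a _ => ?_
    exact (measure_biUnion_null_iff V.countable_toSet).mpr fun b _ =>
      volume_mk'_span_pair a (b - a) d
  obtain ⟨T₀, hT₀⟩ := hne
  obtain ⟨c₀, g₀, h₀⟩ := M.exists_isBary (hS hT₀)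
  have hint := h₀.interior_nonempty
    (Finset.card_pos.mp (by rw [(M.mem_tets.mp (hS hT₀)).2]; norm_num))
  obtain ⟨p, hp, hpN⟩ : ∃ p ∈ interior (convexHull ℝ (T₀ : Set E3)), p ∉ N := by
    by_contra! hc
    exact (isOpen_interior.measure_pos volume hint).ne' (measure_mono_null hc hN0)
  set U : Set E3 := ⋃ T ∈ S, convexHull ℝ (T : Set E3) with hU
  have hUc : IsCompact U := S.isCompact_biUnion fun T _ => isCompact_convexHull T
  obtain ⟨R, hR⟩ := hUc.isBounded.exists_norm_le
  have hK : IsCompact {t : ℝ | 0 ≤ t ∧ p + t • d ∈ U} := by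
    refine Metric.isCompact_of_isClosed_isBounded ?_ ?_
    · exact isClosed_Ici.inter (hUc.isClosed.preimage (by fun_prop : Continuous fun t : ℝ => p + t • d))
    · refine (Metric.isBounded_Icc 0 (R + ‖p‖)).subset fun t ht => ⟨ht.1, ?_⟩
      have h1 := hR _ ht.2
      have h2 : ‖t • d‖ ≤ ‖p + t • d‖ + ‖p‖ := by
        have := norm_sub_le (p + t • d) p
        rwa [add_sub_cancel_left] at this
      rw [norm_smul, hd1, mul_one, Real.norm_of_nonneg ht.1] at h2
      linarith
  -- The last point of the ray in the union of `S`: there the ray can no longer continue into any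
  -- tetrahedron of `S`, which fails both inside a tetrahedron and inside a face whose neighbours
  -- all belong to `S`.
  obtain ⟨t, ⟨ht0, htU⟩, htmax⟩ := hK.exists_isGreatest
    ⟨0, le_refl _, by
      rw [zero_smul, add_zero]
      exact Set.mem_iUnion₂.mpr ⟨T₀, hT₀, interior_subset hp⟩⟩
  set q := p + t • d with hq
  have hleave : ∀ T ∈ S, ¬ ∀ᶠ s in nhdsWithin (0 : ℝ) (Set.Ioi 0),
      q + s • d ∈ convexHull ℝ (T : Set E3) := by
    intro T hT hev
    obtain ⟨s, hs, hs0⟩ := (hev.and self_mem_nhdsWithin).exists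
    have hs0' : (0 : ℝ) < s := hs0
    have : t + s ≤ t := htmax ⟨by linarith, Set.mem_iUnion₂.mpr ⟨T, hT, by
      rw [add_smul, ← add_assoc]; exact hs⟩⟩
    linarith
  obtain ⟨T, hT, hqT⟩ := Set.mem_iUnion₂.mp htU
  obtain ⟨c, g, h⟩ := M.exists_isBary (hS hT)
  have hcard := (M.mem_tets.mp (hS hT)).2
  have hpos := (h.mem_convexHull q).mp hqT
  -- Two vanishing coordinates would put `q` on the edge of the other two vertices, hence `p` in
  -- `N`.
  have huniq : ∀ a ∈ T, ∀ b ∈ T, lam c g a q = 0 → lam c g b q = 0 → a = b := by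
    intro a ha b hb ha0 hb0
    by_contra hab
    have h2 : ((T.erase a).erase b).card = 2 := by
      rw [Finset.card_erase_of_mem (Finset.mem_erase.mpr ⟨Ne.symm hab, hb⟩),
        Finset.card_erase_of_mem ha, hcard]
    obtain ⟨a', b', hab', he⟩ := Finset.card_eq_two.mp h2
    have hsub : ∀ x ∈ (T.erase a).erase b, x ∈ T := fun x hx =>
      Finset.mem_of_mem_erase (Finset.mem_of_mem_erase hx)
    have ha'T := hsub a' (by rw [he]; simp)
    have hb'T := hsub b' (by rw [he]; simp)
    have e1 := h.sum_one q
    have e2 := h.sum_smul q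
    rw [← Finset.add_sum_erase _ _ ha, ← Finset.add_sum_erase _ _
      (Finset.mem_erase.mpr ⟨Ne.symm hab, hb⟩), he, Finset.sum_pair hab', ha0, hb0] at e1 e2
    simp only [zero_smul, zero_add] at e1 e2
    apply hpN
    rw [hN]
    refine Set.mem_iUnion₂.mpr ⟨a', Finset.mem_biUnion.mpr ⟨T, hT, ha'T⟩, Set.mem_iUnion₂.mpr
      ⟨b', Finset.mem_biUnion.mpr ⟨T, hT, hb'T⟩, ?_⟩⟩
    rw [SetLike.mem_coe, AffineSubspace.mem_mk', vsub_eq_sub, Submodule.mem_span_pair]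
    refine ⟨lam c g b' q, -t, ?_⟩
    have e3 : p = q - t • d := by rw [hq]; abel
    have e4 : lam c g a' q = 1 - lam c g b' q := by linarith
    rw [e3]
    conv_rhs => rw [← e2, e4]
    module
  by_cases hz : ∃ E ∈ T, lam c g E q = 0
  · obtain ⟨E, hE, hE0⟩ := hz
    have hposF : ∀ a ∈ T.erase E, 0 < lam c g a q := by
      intro a ha
      rw [Finset.mem_erase] at ha
      refine lt_of_le_of_ne (hpos a ha.2) fun h0 => ha.1 ?_
      exact huniq a ha.2 E hE h0.symm hE0
    have hF3 : (T.erase E).card = 3 := by rw [Finset.card_erase_of_mem hE, hcard]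
    obtain ⟨hb, hS'⟩ := H T hT (T.erase E) (Finset.erase_subset _ _) hF3
    obtain ⟨T', hT', hFT', hev⟩ := M.exists_crossing (hS hT) h hE (F := T.erase E)
      (fun x => by rw [Finset.mem_erase, and_comm]) hb (d := d) hE0 hposF
    have hT'S : T' ∈ S := by
      by_contra hn
      exact hS' T' hT' hn hFT'
    exact hleave T' hT'S hev
  · push Not at hz
    exact hleave T hT (h.eventually_mem fun a ha =>
      Or.inl (lt_of_le_of_ne (hpos a ha) (Ne.symm (hz a ha))))

end CurvedFEM
-- Small distances to Γ, the energy form and the correction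
namespace CurvedFEM

open Metric MeasureTheory

namespace TetMesh

variable (M : TetMesh)

theorem exists_regTet {σ : ℝ} (hM : M.IsRegular σ) {T : Finset E3} (hT : T ∈ M.tets) :
    ∃ c g z r, RegTet T c g z r σ := by
  obtain ⟨c, g, h⟩ := M.exists_isBary hT
  obtain ⟨z, r, hr, hb, hd⟩ := hM T hT
  exact ⟨c, g, z, r, h, (M.mem_tets.mp hT).2, hr, hb, hd⟩

theorem diam_le_meshSize {T : Finset E3} (hT : T ∈ M.tets) :
    diam (convexHull ℝ (T : Set E3)) ≤ M.meshSize :=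
  le_ciSup (f := fun T : M.tets => diam (convexHull ℝ ((T : Finset E3) : Set E3)))
    (Set.finite_range _).bddAbove ⟨T, hT⟩

theorem mem_bdry_of_onBdry {s : Finset E3} (hs : M.OnBdry s) {x : E3} (hx : x ∈ s) :
    x ∈ M.bdry := hs (mem_convexHull_of_mem hx)

/-- Near a `C¹` boundary the perpendiculars to the faces and edges on the boundary of a fine mesh
meet the boundary of the domain at a small distance. -/
theorem exists_frontier_points {Ω : Set E3} (hΩ : IsC1Domain Ω) (hb : Bornology.IsBounded Ω)
    {σ κ ε : ℝ} (hσ : 1 ≤ σ) (hκ0 : 0 ≤ κ) (hκ : κ < 1) (hε0 : 0 < ε) (hε : ε ≤ 1) :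
    ∃ h₀ : ℝ, 0 < h₀ ∧ ∀ M : TetMesh, M.Fits Ω → M.IsRegular σ → M.meshSize ≤ h₀ →
      ∀ d : Finset E3 → E3, M.IsSkinDirection κ d →
        (∀ F : Finset E3, F.card = 3 → M.OnBdry F → ∀ T ∈ M.tets, F ⊆ T →
          ∃ P ∈ frontier Ω ∩ faceNormalLine F,
            dist (center F) P ≤ ε * diam (convexHull ℝ (T : Set E3))) ∧
        (∀ e : Finset E3, e.card = 2 → M.OnBdry e → ∀ T ∈ M.tets, e ⊆ T →
          ∃ Q ∈ frontier Ω ∩ edgeLine e (d e),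
            dist (center e) Q ≤ ε * diam (convexHull ℝ (T : Set E3))) := by
  have hκ1 : 0 < 1 - κ := by linarith
  -- The three bounds serve, in turn, the transversality of the skin, the comparison with heights of
  -- regular tetrahedra, and the distance `ε`.
  set δ := min ((1 - κ) / 32) (min (1 / (16 * σ)) (ε * (1 - κ) / 64)) with hδ
  have hδ0 : 0 < δ := lt_min (by positivity) (lt_min (by positivity) (by positivity))
  have hδκ : δ ≤ (1 - κ) / 32 := min_le_left _ _
  have hδσ : 16 * σ * δ ≤ 1 := by
    have : δ ≤ 1 / (16 * σ) := (min_le_right _ _).trans (min_le_left _ _)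
    rw [le_div_iff₀ (by positivity)] at this
    linarith
  have hδε : δ ≤ ε * (1 - κ) / 64 := (min_le_right _ _).trans (min_le_right _ _)
  -- Chosen so that the flatness error `η` and the tilt `4 σ η` of a boundary face add up to `δ`.
  set η := δ / (1 + 4 * σ) with hη
  have hη0 : 0 < η := by positivity
  have hηδ : η + 4 * σ * η ≤ δ := by
    rw [hη]; apply le_of_eq; field_simp
  obtain ⟨ρ, hρ, hflat⟩ := exists_isFlatOn hΩ hb hη0
  refine ⟨ρ / 3, by positivity, fun M hfit hreg hsize d hd => ?_⟩
  have hD : ∀ T ∈ M.tets, 2 * diam (convexHull ℝ (T : Set E3)) < ρ := fun T hT => by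
    have := M.diam_le_meshSize hT
    linarith
  have hmem : ∀ T ∈ M.tets, ∀ s ⊆ T, M.OnBdry s → ∀ x ∈ s, x ∈ frontier Ω :=
    fun T hT s hs hbs x hx => (hfit T hT x (hs hx)).2 (M.mem_bdry_of_onBdry hbs hx)
  constructor
  · intro F hF3 hFb T hT hFT
    obtain ⟨c, g, z, r, h⟩ := M.exists_regTet hreg hT
    obtain ⟨A, hA⟩ := Finset.card_pos.mp (by rw [hF3]; norm_num : 0 < F.card)
    have hv := hmem T hT F hFT hFb
    obtain ⟨n, ψ, hf⟩ := hflat A (hv A hA)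
    classical
    obtain ⟨E, hE⟩ := Finset.card_eq_one.mp
      (by rw [Finset.card_sdiff_of_subset hFT, h.card, hF3] : (T \ F).card = 1)
    have hE' : ∀ x, (x ∈ T ∧ x ∉ F) ↔ x = E := fun x => by
      rw [← Finset.mem_sdiff, hE, Finset.mem_singleton]
    refine h.exists_frontier_faceNormalLine hΩ.1 hη0.le hf hFT hA ((hE' E).mpr rfl).1
      ((hE' E).mpr rfl).2 (hD T hT) (fun x hx hxE => ?_) hv hηδ (by linarith) (by nlinarith) hε
    by_contra hxF
    exact hxE ((hE' x).mp ⟨hx, hxF⟩)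
  · intro e he2 heb T hT heT
    have hef : e ∈ M.complex.faces := M.complex.down_closed (M.mem_tets.mp hT).1 heT
      (Finset.card_pos.mp (by rw [he2]; norm_num))
    obtain ⟨hd1, hde, F, hF, F', hF', hF3, hF3', heF, heF', hne, hFb, hFb', t, t', ht, ht', hdt⟩ :=
      hd e hef he2 heb
    classical
    obtain ⟨A, B, hAB, he⟩ := Finset.card_eq_two.mp he2
    have hmem_e : ∀ x, x ∈ e ↔ x = A ∨ x = B := fun x => by rw [he]; simp
    -- The geometry at the edge is read off tetrahedra carrying the two boundary faces; these need
    -- not include `T`.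
    obtain ⟨T₁, hT₁, hT₁4, hFT₁⟩ := M.pure F hF
    obtain ⟨T₂, hT₂, hT₂4, hFT₂⟩ := M.pure F' hF'
    have hT₁m := M.mem_tets.mpr ⟨hT₁, hT₁4⟩
    have hT₂m := M.mem_tets.mpr ⟨hT₂, hT₂4⟩
    obtain ⟨c₁, g₁, z₁, r₁, h₁⟩ := M.exists_regTet hreg hT₁m
    obtain ⟨c₂, g₂, z₂, r₂, h₂⟩ := M.exists_regTet hreg hT₂m
    obtain ⟨C, E, k⟩ := exists_corner hT₁4 hF3 hFT₁ heF hAB hmem_e he2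
    obtain ⟨C', E', k'⟩ := exists_corner hT₂4 hF3' hFT₂ heF' hAB hmem_e he2
    have hv := hmem T₁ hT₁m F hFT₁ hFb
    have hv' := hmem T₂ hT₂m F' hFT₂ hFb'
    obtain ⟨n, ψ, hf⟩ := hflat A (hv A ((k.mem_F A).mpr (by simp)))
    obtain ⟨Q, hQ, hdist⟩ := exists_frontier_edgeLine hΩ.1 hη0.le hf k k' h₁ h₂ hT₁ hT₂ hF hF' he2
      hne (hD T₁ hT₁m) (hD T₂ hT₂m) hv hv' (hfit T₁ hT₁m E k.E_mem).1
      (hfit T₂ hT₂m E' k'.E_mem).1 ht ht' hd1 hde hdt hκ0 hκ hηδ hδκ hδσ hδε hε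
    refine ⟨Q, hQ, hdist.trans ?_⟩
    gcongr
    exact norm_sub_le_diam (mem_convexHull_of_mem (heT ((hmem_e B).mpr (Or.inr rfl))))
      (mem_convexHull_of_mem (heT ((hmem_e A).mpr (Or.inl rfl))))

/-- The bilinear form of the broken gradients. -/
noncomputable def formLin : LinearMap.BilinForm ℝ M.Broken :=
  LinearMap.mk₂ ℝ M.form
    (fun u v w => by
      simp only [form, ← Finset.sum_add_distrib]
      refine Finset.sum_congr rfl fun T _ => ?_
      rw [← integral_add (integrableOn_inner_grad (isCompact_convexHull _) _ _)
        (integrableOn_inner_grad (isCompact_convexHull _) _ _)]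
      simp [grad_add, inner_add_left])
    (fun c u v => by
      simp only [form, smul_eq_mul, Finset.mul_sum]
      refine Finset.sum_congr rfl fun T _ => ?_
      rw [← integral_const_mul]
      simp [grad_smul, inner_smul_left])
    (fun u v w => by
      simp only [form, ← Finset.sum_add_distrib]
      refine Finset.sum_congr rfl fun T _ => ?_
      rw [← integral_add (integrableOn_inner_grad (isCompact_convexHull _) _ _)
        (integrableOn_inner_grad (isCompact_convexHull _) _ _)]
      simp [grad_add, inner_add_right])
    (fun c u v => by
      simp only [form, smul_eq_mul, Finset.mul_sum]
      refine Finset.sum_congr rfl fun T _ => ?_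
      rw [← integral_const_mul]
      simp [grad_smul, inner_smul_right])

theorem formLin_apply (u v : M.Broken) : M.formLin u v = M.form u v := rfl

theorem form_self (w : M.Broken) : M.form w w =
    ∑ T : M.tets, ∫ x in convexHull ℝ ((T : Finset E3) : Set E3), ‖grad (w T) x‖ ^ 2 := by
  simp only [form, real_inner_self_eq_norm_sq]

theorem form_self_nonneg (w : M.Broken) : 0 ≤ M.form w w := by
  rw [form_self]
  exact Finset.sum_nonneg fun T _ => integral_nonneg fun x => by positivity

theorem form_comm (u v : M.Broken) : M.form u v = M.form v u := by
  simp only [form, real_inner_comm]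

theorem energyNorm_nonneg (w : M.Broken) : 0 ≤ M.energyNorm w := Real.sqrt_nonneg _

theorem energyNorm_sq (w : M.Broken) : M.energyNorm w ^ 2 = M.form w w :=
  Real.sq_sqrt (M.form_self_nonneg w)

theorem abs_form_le (u v : M.Broken) : |M.form u v| ≤ M.energyNorm u * M.energyNorm v := by
  have h := LinearMap.BilinForm.apply_sq_le_of_symm M.formLin M.form_self_nonneg
    ⟨fun x y => by simpa [formLin_apply] using M.form_comm x y⟩ u v
  simp only [formLin_apply] at h
  rw [energyNorm, energyNorm, ← Real.sqrt_mul (M.form_self_nonneg u)]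
  exact Real.abs_le_sqrt h

theorem form_sub_right (u v w : M.Broken) : M.form u (v - w) = M.form u v - M.form u w :=
  (M.formLin u).map_sub v w

/-- The real supremum of an unbounded family is 0 by convention, so a lower bound by one quotient
needs this Cauchy-Schwarz bound. -/
theorem bddAbove_ratio (w : M.Broken) (p : M.Broken → Prop) :
    BddAbove (Set.range fun v : {v : M.Broken // p v} =>
      M.form w v / (M.energyNorm w * M.energyNorm v)) := by
  refine ⟨1, ?_⟩
  rintro _ ⟨v, rfl⟩
  exact div_le_one_of_le₀ ((le_abs_self _).trans (M.abs_form_le w v))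
    (mul_nonneg (M.energyNorm_nonneg w) (M.energyNorm_nonneg v))

/-- If the correction `q` is small compared to `w`, then the ratio for the test function `w - q` is
bounded below. -/
theorem ratio_ge {w q : M.Broken} (hw : 0 < M.energyNorm w)
    (hq : M.energyNorm q ≤ 1 / 2 * M.energyNorm w) :
    w - q ≠ 0 ∧ 1 / 3 ≤ M.form w (w - q) / (M.energyNorm w * M.energyNorm (w - q)) := by
  have h1 := (abs_le.mp (M.abs_form_le w q)).2
  have h2 : 1 / 2 * M.energyNorm w ^ 2 ≤ M.form w (w - q) := by
    rw [form_sub_right, ← energyNorm_sq]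
    nlinarith
  have hpos : 0 < M.form w (w - q) := lt_of_lt_of_le (by positivity) h2
  have h3 := (le_abs_self _).trans (M.abs_form_le w (w - q))
  have h4 : 0 < M.energyNorm (w - q) := by
    by_contra! hc
    nlinarith
  refine ⟨fun h0 => ?_, ?_⟩
  · rw [h0, ← formLin_apply, map_zero] at hpos
    exact lt_irrefl _ hpos
  · have h5 : M.energyNorm (w - q) ≤ 3 / 2 * M.energyNorm w := by
      have e1 : M.energyNorm (w - q) ^ 2 = M.form w w - M.form w q - M.form w q + M.form q q := by
        rw [energyNorm_sq, form_sub_right, form_comm, form_sub_right, form_comm _ (w - q) q,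
          form_sub_right, form_comm _ q w]
        ring
      rw [← energyNorm_sq, ← energyNorm_sq] at e1
      have h6 := (abs_le.mp (M.abs_form_le w q)).1
      have h7 := M.energyNorm_nonneg q
      have h8 : M.energyNorm (w - q) ^ 2 ≤ (M.energyNorm w + M.energyNorm q) ^ 2 := by nlinarith
      have h9 := (sq_le_sq₀ h4.le (by linarith)).mp h8
      linarith
    rw [le_div_iff₀ (by positivity)]
    have h6 : M.energyNorm w * M.energyNorm (w - q) ≤
        M.energyNorm w * (3 / 2 * M.energyNorm w) := by gcongr
    nlinarith

/-- A function of the trial space with vanishing energy is zero. -/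
theorem eq_zero_of_form_self_eq_zero {Ω : Set E3} {σ : ℝ} {d : Finset E3 → E3}
    (hreg : M.IsRegular σ) {w : M.Broken} (hw : w ∈ M.trialSpace Ω d)
    (hP : ∀ F : Finset E3, F.card = 3 → M.OnBdry F → ∀ T ∈ M.tets, F ⊆ T →
      (frontier Ω ∩ faceNormalLine F).Nonempty)
    (h0 : M.form w w = 0) : w = 0 := by
  classical
  obtain ⟨⟨hsv, -⟩, hbd, -⟩ := hw
  have hint : ∀ T : M.tets, ∫ x in convexHull ℝ ((T : Finset E3) : Set E3),
      ‖grad (w T) x‖ ^ 2 = 0 := by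
    rw [form_self, Finset.sum_eq_zero_iff_of_nonneg
      fun T _ => integral_nonneg fun x => by positivity] at h0
    exact fun T => h0 T (Finset.mem_univ T)
  -- The inverse estimate holds at any distance from the ball, so the gradient vanishes in all of
  -- space; this is needed because `P` may be outside `T`.
  have hgrad : ∀ (T : M.tets) (x : E3), grad (w T) x = 0 := by
    intro T x
    obtain ⟨c, g, z, r, h⟩ := M.exists_regTet hreg T.2
    have := norm_grad_le_of_closedBall (w T) (isCompact_convexHull T.1) (R := ‖x - z‖ + 1) h.rpos
      (by positivity) h.ball (y := x) (by linarith)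
    rw [hint T, mul_zero, Real.sqrt_zero, mul_zero] at this
    exact norm_le_zero_iff.mp this
  have hconst : ∀ (T : M.tets) (x y : E3), val (w T) x = val (w T) y := by
    intro T x y
    have := abs_val_sub_le (w T) convex_univ (K := 0) (fun x _ => by rw [hgrad, norm_zero])
      (Set.mem_univ y) (Set.mem_univ x)
    rw [zero_mul, abs_nonpos_iff, sub_eq_zero] at this
    exact this
  -- The tetrahedra where the constant is not zero. A face leaving this set would carry a zero
  -- value, from Γ or from its neighbour.
  set S : Finset (Finset E3) := M.tets.filter
    (fun T => ∃ hT : T ∈ M.tets, val (w ⟨T, hT⟩) 0 ≠ 0) with hS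
  have hSe : S = ∅ := by
    by_contra hne
    obtain ⟨T, hT, F, hFT, hF3, hcase⟩ := M.exists_face_leaving S (Finset.filter_subset _ _)
      (Finset.nonempty_iff_ne_empty.mpr hne)
    obtain ⟨hTm, _, hT0⟩ := Finset.mem_filter.mp hT
    by_cases hFb : M.OnBdry F
    · have hcl : IsClosed (frontier Ω ∩ faceNormalLine F) :=
        isClosed_frontier.inter (isClosed_faceNormalLine F)
      obtain ⟨P, hPn⟩ := exists_isNearest hcl (hP F hF3 hFb T hTm hFT) (center F)
      apply hT0
      rw [hconst ⟨T, hTm⟩ 0 P]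
      exact hbd F hF3 hFb ⟨T, hTm⟩ hFT P hPn
    · rcases hcase with hFb' | ⟨T', hT', hT'S, hFT'⟩
      · exact hFb hFb'
      · apply hT'S
        refine Finset.mem_filter.mpr ⟨hT', hT', ?_⟩
        have := hsv F hF3 hFb ⟨T, hTm⟩ ⟨T', hT'⟩ hFT hFT'
        rw [faceDof, faceDof, hconst _ (center F) 0, hconst ⟨T', hT'⟩ (center F) 0] at this
        rwa [← this]
  ext1 T
  apply eq_of_val_eq
  intro x
  rw [Pi.zero_apply, val_zero, hconst T x 0]
  by_contra hn
  have : T.1 ∈ S := Finset.mem_filter.mpr ⟨T.2, T.2, hn⟩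
  rw [hSe] at this
  exact absurd this (Finset.notMem_empty _)

/-- The coefficients of the boundary degrees of freedom of a trial function. -/
theorem abs_faceDof_le {Ω : Set E3} {σ ε : ℝ} {d : Finset E3 → E3} {w : M.Broken}
    (hw : w ∈ M.trialSpace Ω d) {T : M.tets} {c : E3 → ℝ} {g : E3 → E3} {z : E3} {r : ℝ}
    (h : RegTet T.1 c g z r σ) (hε : ε ≤ 1) {F : Finset E3} (hFT : F ⊆ T.1) (hF3 : F.card = 3)
    (hFb : M.OnBdry F)
    (hP : ∃ P ∈ frontier Ω ∩ faceNormalLine F,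
      dist (center F) P ≤ ε * diam (convexHull ℝ (T.1 : Set E3))) :
    |faceDof F (w T)| ≤ ε * diam (convexHull ℝ (T.1 : Set E3)) *
      gradBound σ r (convexHull ℝ (T.1 : Set E3)) (w T) := by
  obtain ⟨P', hP', hdist⟩ := hP
  obtain ⟨P, hPn⟩ := exists_isNearest (isClosed_frontier.inter (isClosed_faceNormalLine F))
    ⟨P', hP'⟩ (center F)
  have h0 := hw.2.1 F hF3 hFb T hFT P hPn
  have hne : F.Nonempty := Finset.card_pos.mp (by rw [hF3]; norm_num)
  have h1 := abs_val_sub_le_gradBound (w T) (isCompact_convexHull T.1) h.rpos h.ball h.diam_pos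
    h.diam_le (convexHull_mono (Finset.coe_subset.mpr hFT) (center_mem_convexHull F hne)) hε
    (y := P) (by rw [← dist_eq_norm, dist_comm]; exact (hPn.2 P' hP').trans hdist)
  rwa [h0, sub_zero] at h1

/-- The end-point terms cancel against those of the vanishing shifted edge value, leaving 0.4 times
the difference of the values at the mid-point and at `Q`. -/
theorem abs_edgeDof_le {Ω : Set E3} {σ ε : ℝ} {d : Finset E3 → E3} {w : M.Broken}
    (hw : w ∈ M.trialSpace Ω d) {T : M.tets} {c : E3 → ℝ} {g : E3 → E3} {z : E3} {r : ℝ}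
    (h : RegTet T.1 c g z r σ) (hε : ε ≤ 1) {e : Finset E3} (heT : e ⊆ T.1) (he2 : e.card = 2)
    (heb : M.OnBdry e)
    (hQ : ∃ Q ∈ frontier Ω ∩ edgeLine e (d e),
      dist (center e) Q ≤ ε * diam (convexHull ℝ (T.1 : Set E3))) :
    |edgeDof e (w T)| ≤ ε * diam (convexHull ℝ (T.1 : Set E3)) *
      gradBound σ r (convexHull ℝ (T.1 : Set E3)) (w T) := by
  obtain ⟨Q', hQ', hdist⟩ := hQ
  obtain ⟨Q, hQn⟩ := exists_isNearest (isClosed_frontier.inter (isClosed_edgeLine e (d e)))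
    ⟨Q', hQ'⟩ (center e)
  have h0 := hw.2.2 e he2 heb T heT Q hQn
  have hne : e.Nonempty := Finset.card_pos.mp (by rw [he2]; norm_num)
  have h1 := abs_val_sub_le_gradBound (w T) (isCompact_convexHull T.1) h.rpos h.ball h.diam_pos
    h.diam_le (convexHull_mono (Finset.coe_subset.mpr heT) (center_mem_convexHull e hne)) hε
    (y := Q) (by rw [← dist_eq_norm, dist_comm]; exact (hQn.2 Q' hQ').trans hdist)
  have h2 : edgeDof e (w T) = 0.4 * (val (w T) (center e) - val (w T) Q) := by
    rw [← sub_zero (edgeDof e (w T)), ← h0, edgeDof, edgeValue, edgeValue]; ring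
  rw [h2, abs_mul]
  refine (mul_le_of_le_one_left (abs_nonneg _) ?_).trans h1
  rw [abs_of_nonneg (by norm_num)]; norm_num

/-- Every function of the trial space is close in energy to a function of the test space. -/
theorem exists_correction {Ω : Set E3} {σ ε : ℝ} {d : Finset E3 → E3} (hreg : M.IsRegular σ)
    (hσ : 0 ≤ σ) (hε0 : 0 ≤ ε) (hε : ε ≤ 1)
    (hP : ∀ F : Finset E3, F.card = 3 → M.OnBdry F → ∀ T ∈ M.tets, F ⊆ T →
      ∃ P ∈ frontier Ω ∩ faceNormalLine F,
        dist (center F) P ≤ ε * diam (convexHull ℝ (T : Set E3)))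
    (hQ : ∀ e : Finset E3, e.card = 2 → M.OnBdry e → ∀ T ∈ M.tets, e ⊆ T →
      ∃ Q ∈ frontier Ω ∩ edgeLine e (d e),
        dist (center e) Q ≤ ε * diam (convexHull ℝ (T : Set E3)))
    {w : M.Broken} (hw : w ∈ M.trialSpace Ω d) :
    ∃ q : M.Broken, w - q ∈ M.testSpace ∧ M.energyNorm q ≤ corrConst σ * ε * M.energyNorm w := by
  classical
  choose c g z r h using fun T : M.tets => M.exists_regTet hreg T.2
  -- Removing only the boundary degrees of freedom leaves the interior ones of `w`, and hence their
  -- single-valuedness, untouched.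
  let α : M.tets → Finset E3 → ℝ := fun T F => if M.OnBdry F then faceDof F (w T) else 0
  let β : M.tets → Finset E3 → ℝ := fun T e => if M.OnBdry e then edgeDof e (w T) else 0
  let q : M.Broken := fun T => interp T.1 (c T) (g T) (α T) (β T)
  have hfq : ∀ (T : M.tets) (F : Finset E3), F ⊆ T.1 → F.card = 3 →
      faceDof F ((w - q) T) = faceDof F (w T) - α T F := by
    intro T F hF h3
    rw [← (h T).bary.faceDof_interp (h T).card (α T) (β T) hF h3]
    exact (valLin (center F)).map_sub _ _
  have heq : ∀ (T : M.tets) (e : Finset E3), e ⊆ T.1 → e.card = 2 →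
      edgeDof e ((w - q) T) = edgeDof e (w T) - β T e := by
    intro T e he h2
    rw [← (h T).bary.edgeDof_interp (h T).card (α T) (β T) he h2]
    exact (IsBary.edgeDofLin e).map_sub _ _
  refine ⟨q, ⟨⟨?_, ?_⟩, ?_, ?_⟩, ?_⟩
  · intro F h3 hb T T' hT hT'
    rw [hfq T F hT h3, hfq T' F hT' h3, hw.1.1 F h3 hb T T' hT hT']
    simp [α, hb]
  · intro e h2 hb T T' hT hT'
    rw [heq T e hT h2, heq T' e hT' h2, hw.1.2 e h2 hb T T' hT hT']
    simp [β, hb]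
  · intro F h3 hb T hT
    rw [hfq T F hT h3]
    simp [α, hb]
  · intro e h2 hb T hT
    rw [heq T e hT h2]
    simp [β, hb]
  · have hC : 0 ≤ corrConst σ := by unfold corrConst; positivity
    have key : M.form q q ≤ (corrConst σ * ε) ^ 2 * M.form w w := by
      rw [form_self, form_self, Finset.mul_sum]
      refine Finset.sum_le_sum fun T _ => ?_
      have hpos : 0 ≤ ε * diam (convexHull ℝ (T.1 : Set E3)) *
          gradBound σ (r T) (convexHull ℝ (T.1 : Set E3)) (w T) := by
        have := diam_nonneg (s := convexHull ℝ (T.1 : Set E3))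
        unfold gradBound
        positivity
      refine (h T).bary.integral_grad_interp_le (h T).card (w T) (h T).rpos (h T).ball
        (h T).diam_pos (h T).diam_le hε0 ?_ ?_
      · intro F hF h3
        by_cases hb : M.OnBdry F
        · simp only [α, if_pos hb]
          exact M.abs_faceDof_le hw (h T) hε hF h3 hb (hP F h3 hb T.1 T.2 hF)
        · simp only [α, if_neg hb, abs_zero]
          exact hpos
      · intro e he h2
        by_cases hb : M.OnBdry e
        · simp only [β, if_pos hb]
          exact M.abs_edgeDof_le hw (h T) hε he h2 hb (hQ e h2 hb T.1 T.2 he)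
        · simp only [β, if_neg hb, abs_zero]
          exact hpos
    have h1 := Real.sqrt_le_sqrt key
    rwa [Real.sqrt_mul (sq_nonneg _), Real.sqrt_sq (by positivity)] at h1

end TetMesh

end CurvedFEM

/-! ### The inf-sup condition -/

theorem mainTheorem11 (Ω : Set CurvedFEM.E3) (hΩ : CurvedFEM.IsC1Domain Ω)
    (hb : Bornology.IsBounded Ω) (σ κ : ℝ) (hκ : κ < 1) :
    ∃ α : ℝ, 0 < α ∧ ∃ h₀ : ℝ, 0 < h₀ ∧
      ∀ M : CurvedFEM.TetMesh, M.Fits Ω → M.IsRegular σ → M.meshSize ≤ h₀ →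
        ∀ d : Finset CurvedFEM.E3 → CurvedFEM.E3, M.IsSkinDirection κ d →
          ∀ w ∈ M.trialSpace Ω d, w ≠ 0 →
            α ≤ ⨆ v : {v : M.Broken // v ∈ M.testSpace ∧ v ≠ 0},
              M.form w v / (M.energyNorm w * M.energyNorm v) := by
  -- Enlarging `σ` and `κ` weakens the mesh conditions and supplies the signs that the estimates
  -- need.
  set σ' := max σ 1
  set κ' := max κ 0
  have hσ' : 1 ≤ σ' := le_max_right _ _
  have hC : 0 < CurvedFEM.corrConst σ' := by unfold CurvedFEM.corrConst; positivity
  -- Makes the correction at most half of `w` in energy, as `ratio_ge` requires.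
  set ε := min 1 (1 / (2 * CurvedFEM.corrConst σ'))
  have hε0 : 0 < ε := lt_min one_pos (by positivity)
  have hε1 : ε ≤ 1 := min_le_left _ _
  have hCε : CurvedFEM.corrConst σ' * ε ≤ 1 / 2 := by
    have : ε ≤ 1 / (2 * CurvedFEM.corrConst σ') := min_le_right _ _
    rw [le_div_iff₀ (by positivity)] at this
    linarith
  obtain ⟨h₀, hh₀, H⟩ := CurvedFEM.TetMesh.exists_frontier_points hΩ hb hσ'
    (le_max_right κ 0) (max_lt hκ one_pos) hε0 hε1
  refine ⟨1 / 3, by norm_num, h₀, hh₀, fun M hfit hreg hsize d hd w hw hw0 => ?_⟩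
  have hreg' : M.IsRegular σ' := by
    intro T hT
    obtain ⟨c, r, hr, hball, hdiam⟩ := hreg T hT
    exact ⟨c, r, hr, hball, hdiam.trans (by gcongr; exact le_max_left _ _)⟩
  have hd' : M.IsSkinDirection κ' d := by
    intro e he h2 heb
    obtain ⟨a1, a2, F, hF, F', hF', b1, b2, b3, b4, b5, b6, b7, t, t', c1, c2, c3⟩ := hd e he h2 heb
    exact ⟨a1, a2, F, hF, F', hF', b1, b2, b3, b4, b5, b6, b7, t, t', c1, c2,
      c3.trans (by gcongr; exact le_max_left _ _)⟩
  obtain ⟨hP, hQ⟩ := H M hfit hreg' hsize d hd'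
  have hpos : 0 < M.energyNorm w := by
    refine Real.sqrt_pos.mpr (lt_of_le_of_ne (M.form_self_nonneg w) fun h0 => hw0 ?_)
    refine M.eq_zero_of_form_self_eq_zero hreg' hw (fun F h3 hFb T hT hFT => ?_) h0.symm
    obtain ⟨P, hP', -⟩ := hP F h3 hFb T hT hFT
    exact ⟨P, hP'⟩
  obtain ⟨q, hq, hqn⟩ := M.exists_correction hreg' (by linarith) hε0.le hε1 hP hQ hw
  obtain ⟨hne, hratio⟩ := M.ratio_ge hpos (hqn.trans (by gcongr))
  exact hratio.trans (le_ciSup (M.bddAbove_ratio w fun v => v ∈ M.testSpace ∧ v ≠ 0)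
    ⟨w - q, hq, hne⟩)
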